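/- Let $n\ge 1$. Let $I_{n|n}=\{\pm1,\dots,\pm n\}$ with $|i|=\bar 0$ for $i>0$ and $|i|=\bar 1$ for $i<0$, and let $E_{ij}$ be the matrix units of $\mathrm{End}(\mathbb C^{n|n})$, of parity $|i|+|j|$. All tensor products of superalgebras carry the multiplication $(a\otimes b)(a'\otimes b')=(-1)^{|b||a'|}aa'\otimes bb'$, and upper indices indicate the tensor factor of $\mathrm{End}(\mathbb C^{n|n})^{\otimes m}$ in which a matrix acts. Put $P=\sum_{i,j}(-1)^{|j|}E_{ij}\otimes E_{ji}$, $Q=\sum_{i,j}(-1)^{|j|}E_{ij}\otimes E_{-j,-i}$ and $R(u,v)=1-\frac{P}{u-v}-\frac{Q}{u+v}$. The queer super-Yangian $\mathrm Y(\mathfrak q_n)$ is the unital associative superalgebra over $\mathbb C$ generated by $t_{ij}^{(r)}$ ($i,j\in I_{n|n}$, $r\ge1$) of parity $|i|+|j|$, subject to $t_{ij}(-u)=t_{-i,-j}(u)$ and $R(u,v)T^1(u)T^2(v)=T^2(v)T^1(u)R(u,v)$, where $t_{ij}(u)=\delta_{ij}+\sum_{r\ge1}t_{ij}^{(r)}u^{-r}$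 and $T(u)=\sum_{i,j}E_{ij}\otimes t_{ij}(u)$ (the second relation being understood after multiplication by $u^2-v^2$). Order the indices as $1,-1,2,-2,\dots,n,-n$ and regard $T(u)$ as an $n\times n$ matrix of $2\times2$ blocks in $\mathrm{End}(\mathbb C^{1|1})\otimes \mathrm Y(\mathfrak q_n)[[u^{-1}]]$. Then $T(u)$ has a unique block Gauss decomposition $T(u)=F(u)H(u)E(u)$ with $F(u)$ block lower unitriangular, $H(u)$ block diagonal and $E(u)$ block upper unitriangular. Let $E_a(u)$ be the $(a,a+1)$ block of $E(u)$, $1\le a\le n-1$, and put $E_a(u,v)=E_a(u)-E_a(v)$. Then for all $a,b\in\{1,\dots,n-1\}$ with $|a-b|=1$ the Serre relation $$\frac{P^{12}}{u-v}\big[E_a^1(u,v),[E_a^2(u,v),E_b^3(w)]\big]+\frac{Q^{12}}{u+v}\big[E_a^1(u,-v),[E_a^2(-u,v),E_b^3(w)]\big]=0$$ holds in $\mathrm{End}(\mathbb C^{1|1})^{\otimes3}\otimes \mathrm Y(\mathfrak q_n)[[u^{-1},v^{-1},w^{-1}]]$, where $P,Q$ are now taken for $\mathbb C^{1|1}$;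 equivalently, after multiplication by $u^2-v^2$, $$(u+v)P^{12}\big[E_a^1(u,v),[E_a^2(u,v),E_b^3(w)]\big]+(u-v)Q^{12}\big[E_a^1(u,-v),[E_a^2(-u,v),E_b^3(w)]\big]=0.$$ In particular this holds in $\mathrm Y(\mathfrak q_3)$ for $(a,b)=(1,2)$ and $(2,1)$. -/

import Mathlib

open scoped BigOperators

noncomputable section

namespace QueerYangian

/-! ### Superalgebras and matrix superalgebras -/

/-- The sign `(-1)^x` attached to a parity `x` in `ZMod 2`. -/
def sgn (x : ZMod 2) : ℤ := if x = 0 then 1 else -1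

theorem sgn_add (x y : ZMod 2) : sgn (x + y) = sgn x * sgn y := by
  revert x y; decide

theorem sgn_mul_self (x : ZMod 2) : sgn x * sgn x = 1 := by
  revert x; decide

/-- A `ZMod 2`-grading of a (complex, associative, unital) algebra, recorded through its parity
automorphism `par a = (-1)^|a| a`: the even part is the eigenspace of `par` for `1`, the odd part
the eigenspace for `-1`, and `A` is the direct sum of the two as soon as `2` is invertible. -/
class SuperRing (A : Type*) [Ring A] where
  par : A →+* A
  par_par : ∀ a, par (par a) = a

open SuperRing

section Super

variable {A : Type*} [Ring A] [SuperRing A]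

/-- `twist x a = (-1)^(x |a|) a`. -/
def twist (x : ZMod 2) (a : A) : A := if x = 0 then a else par a

theorem twist_zero (a : A) : twist 0 a = a := by simp [twist]

theorem twist_add_arg (x : ZMod 2) (a b : A) : twist x (a + b) = twist x a + twist x b := by
  unfold twist; split_ifs <;> simp

theorem twist_mul (x : ZMod 2) (a b : A) : twist x (a * b) = twist x a * twist x b := by
  unfold twist; split_ifs <;> simp

theorem twist_of_zero (x : ZMod 2) : twist x (0 : A) = 0 := by
  unfold twist; split_ifs <;> simp

theorem twist_of_one (x : ZMod 2) : twist x (1 : A) = 1 := by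
  unfold twist; split_ifs <;> simp

theorem twist_zsmul (x : ZMod 2) (k : ℤ) (a : A) : twist x (k • a) = k • twist x a := by
  unfold twist; split_ifs <;> simp

theorem twist_sum {κ : Type*} (x : ZMod 2) (s : Finset κ) (f : κ → A) :
    twist x (∑ k ∈ s, f k) = ∑ k ∈ s, twist x (f k) := by
  unfold twist; split_ifs <;> simp

theorem twist_twist (x y : ZMod 2) (a : A) : twist x (twist y a) = twist (y + x) a := by
  have h : ∀ z : ZMod 2, z = 0 ∨ z = 1 := by decide
  have h11 : (1 : ZMod 2) + 1 = 0 := by decide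
  rcases h x with rfl | rfl <;> rcases h y with rfl | rfl <;> simp [twist, par_par, h11]

theorem par_twist (x : ZMod 2) (a : A) : par (twist x a) = twist x (par a) := by
  unfold twist; split_ifs <;> rfl

end Super

/-- The index set `{±1, …, ±n}` of the standard basis of `ℂ^{n|n}`: the pair `(a, 0)` stands for
the index `a + 1` and the pair `(a, 1)` for the index `-(a + 1)`. -/
abbrev Idx (n : ℕ) := Fin n × ZMod 2

/-- The involution `i ↦ -i` of the index set. -/
def Idx.opp {n : ℕ} (i : Idx n) : Idx n := (i.1, i.2 + 1)

/-- The superalgebra `End(ℂ^{n|n}) ⊗ A`; the function `X` stands for `∑_{i,j} E_{ij} ⊗ X i j`,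
where the matrix unit `E_{ij}` has parity `|i| + |j|`. -/
def SEnd (n : ℕ) (A : Type*) := Idx n → Idx n → A

namespace SEnd

variable {n : ℕ} {A : Type*}

@[ext] theorem ext {X Y : SEnd n A} (h : ∀ i j, X i j = Y i j) : X = Y :=
  funext fun i => funext fun j => h i j

variable [Ring A]

instance : AddCommGroup (SEnd n A) := inferInstanceAs (AddCommGroup (Idx n → Idx n → A))

theorem add_apply (X Y : SEnd n A) (i j : Idx n) : (X + Y) i j = X i j + Y i j := rfl
theorem zero_apply (i j : Idx n) : (0 : SEnd n A) i j = 0 := rfl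

instance : One (SEnd n A) := ⟨fun i j => if i = j then 1 else 0⟩

theorem one_apply (i j : Idx n) : (1 : SEnd n A) i j = if i = j then 1 else 0 := rfl

/-- The element `1 ⊗ a` of `End(ℂ^{n|n}) ⊗ A`. -/
def emb (a : A) : SEnd n A := fun i j => if i = j then a else 0

/-- Apply a function to all entries. -/
def map {B : Type*} (f : A → B) (X : SEnd n A) : SEnd n B := fun i j => f (X i j)

variable [SuperRing A]

/-- The multiplication of the tensor product superalgebra `End(ℂ^{n|n}) ⊗ A`:
`(E_{ij} ⊗ a)(E_{jl} ⊗ b) = (-1)^{|a|(|j|+|l|)} E_{il} ⊗ a b`. -/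
instance : Mul (SEnd n A) :=
  ⟨fun X Y i l => ∑ j, twist (j.2 + l.2) (X i j) * Y j l⟩

theorem mul_apply (X Y : SEnd n A) (i l : Idx n) :
    (X * Y) i l = ∑ j, twist (j.2 + l.2) (X i j) * Y j l := rfl

instance : Ring (SEnd n A) :=
  { (inferInstance : AddCommGroup (SEnd n A)), (inferInstance : One (SEnd n A)),
    (inferInstance : Mul (SEnd n A)) with
    left_distrib := fun X Y Z => by
      ext i l; simp only [mul_apply, add_apply, mul_add, Finset.sum_add_distrib]
    right_distrib := fun X Y Z => by
      ext i l; simp only [mul_apply, add_apply, twist_add_arg, add_mul, Finset.sum_add_distrib]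
    zero_mul := fun X => by
      ext i l; simp only [mul_apply, zero_apply, twist_of_zero, zero_mul, Finset.sum_const_zero]
    mul_zero := fun X => by
      ext i l; simp only [mul_apply, zero_apply, mul_zero, Finset.sum_const_zero]
    one_mul := fun X => by
      ext i l
      rw [mul_apply, Finset.sum_eq_single i]
      · simp [one_apply, twist_of_one]
      · intro j _ hj
        simp [one_apply, hj.symm, twist_of_zero]
      · simp
    mul_one := fun X => by
      ext i l
      rw [mul_apply, Finset.sum_eq_single l]
      · have h : l.2 + l.2 = 0 := CharTwo.add_self_eq_zero l.2
        simp [one_apply, h, twist_zero]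
      · intro j _ hj
        simp [one_apply, hj]
      · simp
    mul_assoc := fun X Y Z => by
      ext i l
      simp only [mul_apply, twist_sum, twist_mul, twist_twist, Finset.sum_mul, Finset.mul_sum]
      rw [Finset.sum_comm]
      refine Finset.sum_congr rfl fun j _ => Finset.sum_congr rfl fun k _ => ?_
      have h : j.2 + k.2 + (k.2 + l.2) = j.2 + l.2 := by
        have := CharTwo.add_self_eq_zero k.2
        linear_combination this
      rw [h, mul_assoc] }

/-- The parity map of `End(ℂ^{n|n}) ⊗ A`, where `|E_{ij} ⊗ a| = |i| + |j| + |a|`. -/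
def parity (X : SEnd n A) : SEnd n A := fun i j => sgn (i.2 + j.2) • par (X i j)

theorem parity_apply (X : SEnd n A) (i j : Idx n) :
    parity X i j = sgn (i.2 + j.2) • par (X i j) := rfl

instance : SuperRing (SEnd n A) where
  par :=
    { toFun := parity
      map_one' := by
        ext i j
        by_cases h : i = j
        · subst h
          have h : i.2 + i.2 = 0 := CharTwo.add_self_eq_zero i.2
          simp [parity_apply, one_apply, h, sgn]
        · simp [parity_apply, one_apply, h]
      map_zero' := by ext i j; simp [parity_apply, zero_apply]
      map_add' := fun X Y => by
        ext i j; simp only [parity_apply, add_apply, map_add, smul_add]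
      map_mul' := fun X Y => by
        ext i l
        simp only [parity_apply, mul_apply, map_sum, map_mul, Finset.smul_sum, twist_zsmul,
          par_twist]
        refine Finset.sum_congr rfl fun j _ => ?_
        have h : i.2 + l.2 = (i.2 + j.2) + (j.2 + l.2) := by
          have := CharTwo.add_self_eq_zero j.2
          linear_combination -this
        rw [h, sgn_add, smul_mul_smul_comm] }
  par_par := fun X => by
    ext i j
    change parity (parity X) i j = X i j
    rw [parity_apply, parity_apply, map_zsmul, smul_smul, sgn_mul_self, one_smul, par_par]

theorem par_apply (X : SEnd n A) (i j : Idx n) : par X i j = sgn (i.2 + j.2) • par (X i j) := rfl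

theorem par_emb (a : A) : par (emb a : SEnd n A) = emb (par a) := by
  ext i j
  rw [par_apply]
  by_cases h : i = j
  · subst h
    have h : i.2 + i.2 = 0 := CharTwo.add_self_eq_zero i.2
    simp [emb, h, sgn]
  · simp [emb, h]

theorem parity_eq_zsmul_apply (s : ℤ) (X : SEnd n A) (i j : Idx n) :
    (s • par X) i j = (s * sgn (i.2 + j.2)) • par (X i j) := by
  change s • (par X i j) = _
  rw [par_apply, smul_smul]

/-- `P = ∑_{i,j} (-1)^{|j|} E_{ij} ⊗ E_{ji}` as an element of
`End(ℂ^{n|n}) ⊗ (End(ℂ^{n|n}) ⊗ A)`. -/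
def P (n : ℕ) (A : Type*) [Ring A] : SEnd n (SEnd n A) :=
  fun i j k l => if k = j ∧ l = i then ((sgn j.2 : ℤ) : A) else 0

/-- `Q = ∑_{i,j} (-1)^{|j|} E_{ij} ⊗ E_{-j,-i}` as an element of
`End(ℂ^{n|n}) ⊗ (End(ℂ^{n|n}) ⊗ A)`. -/
def Q (n : ℕ) (A : Type*) [Ring A] : SEnd n (SEnd n A) :=
  fun i j k l => if k = j.opp ∧ l = i.opp then ((sgn j.2 : ℤ) : A) else 0

theorem par_P : par (P n A) = P n A := by
  ext i j k l
  rw [par_apply, parity_eq_zsmul_apply]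
  by_cases h : k = j ∧ l = i
  · obtain ⟨rfl, rfl⟩ := h
    simp [P, add_comm l.2 k.2, sgn_mul_self]
  · simp [P, h]

theorem par_Q : par (Q n A) = Q n A := by
  ext i j k l
  rw [par_apply, parity_eq_zsmul_apply]
  by_cases h : k = j.opp ∧ l = i.opp
  · obtain ⟨rfl, rfl⟩ := h
    have h : j.opp.2 + i.opp.2 = i.2 + j.2 := by
      have : (1 : ZMod 2) + 1 = 0 := by decide
      simp only [Idx.opp]
      linear_combination this
    simp only [h, sgn_mul_self, one_smul]
    simp [Q]
  · simp [Q, h]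

/-- The `(a, b)` block (a `2 × 2` matrix) of a block matrix, under
`End(ℂ^{n|n}) ≅ End(ℂ^n) ⊗ End(ℂ^{1|1})`. -/
def block (X : SEnd n A) (a b : Fin n) : SEnd 1 A := fun i j => X (a, i.2) (b, j.2)

/-- `X = F H E` is the block Gauss decomposition of `X`: `F` is block lower triangular with
identity diagonal blocks, `H` is block diagonal, and `E` is block upper triangular with identity
diagonal blocks. -/
structure IsBlockGauss (X F H E : SEnd n A) : Prop where
  eq_mul : X = F * H * E
  lower : ∀ a b, a < b → F.block a b = 0
  lower_diag : ∀ a, F.block a a = 1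
  diag : ∀ a b, a ≠ b → H.block a b = 0
  upper : ∀ a b, b < a → E.block a b = 0
  upper_diag : ∀ a, E.block a a = 1

end SEnd

/-! ### Formal power series over a superalgebra -/

section Series

variable {A : Type*} [Ring A]

/-- The variables of power series are even and central. -/
instance {σ : Type*} [SuperRing A] : SuperRing (MvPowerSeries σ A) where
  par := MvPowerSeries.map par
  par_par := fun f => by
    ext m; simp [MvPowerSeries.coeff_map, par_par]

/-- For `ε = ±1`, a formal series `f(u) = ∑_r f_r u^{-r}` and a set of variables
`u_1, …, u_d`, the series `f(ε u_k) = ∑_r ε^r f_r u_k^{-r}`. The indeterminates of the power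
series rings stand for the inverses `u^{-1}` and `u_1^{-1}, …, u_d^{-1}`. -/
def atVar {d : ℕ} (k : Fin d) (ε : ℤ) (f : PowerSeries A) : MvPowerSeries (Fin d) A :=
  fun m => if m = Finsupp.single k (m k) then ε ^ m k • PowerSeries.coeff (m k) f else 0

end Series

/-! ### The queer super-Yangian -/

section RTT

variable {n : ℕ} {A : Type*} [Ring A]

/-- The coefficients `t_{ij}^{(r)}`, `r ≥ 0`, where `t_{ij}^{(0)} = δ_{ij}` and `t i j r` plays the
role of `t_{ij}^{(r+1)}`. -/
def tCoeff (t : Idx n → Idx n → ℕ → A) (i j : Idx n) : ℕ → A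
  | 0 => if i = j then 1 else 0
  | r + 1 => t i j r

/-- The generator matrix `T(u) = ∑_{i,j} E_{ij} ⊗ t_{ij}(u)`,
`t_{ij}(u) = ∑_{r ≥ 0} t_{ij}^{(r)} u^{-r}`. -/
def tMatrix (t : Idx n → Idx n → ℕ → A) : SEnd n (PowerSeries A) :=
  fun i j => PowerSeries.mk (tCoeff t i j)

variable [SuperRing A]

/-- With `x = u^{-1}` and `y = v^{-1}`, this is `u^{-2} v^{-2} (u^2 - v^2) R(u,v)` for
`R(u,v) = 1 - P/(u-v) - Q/(u+v)`; note `u^{-2} v^{-2} (u^2 - v^2) = y^2 - x^2`,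
`u^{-2} v^{-2} (u + v) = x y (x + y)` and `u^{-2} v^{-2} (u - v) = x y (y - x)`. -/
def rMatrix (n : ℕ) (A : Type*) [Ring A] [SuperRing A] :
    SEnd n (SEnd n (MvPowerSeries (Fin 2) A)) :=
  let x : MvPowerSeries (Fin 2) A := MvPowerSeries.X 0
  let y : MvPowerSeries (Fin 2) A := MvPowerSeries.X 1
  SEnd.emb (SEnd.emb (y ^ 2 - x ^ 2))
    - SEnd.emb (SEnd.emb (x * y * (x + y))) * SEnd.P n _
    - SEnd.emb (SEnd.emb (x * y * (y - x))) * SEnd.Q n _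

/-- `T^1(u)` in `End(ℂ^{n|n})^{⊗ 2} ⊗ A[[u^{-1}, v^{-1}]]`. -/
def tOne (t : Idx n → Idx n → ℕ → A) : SEnd n (SEnd n (MvPowerSeries (Fin 2) A)) :=
  (tMatrix t).map fun f => SEnd.emb (atVar 0 1 f)

/-- `T^2(v)` in `End(ℂ^{n|n})^{⊗ 2} ⊗ A[[u^{-1}, v^{-1}]]`. -/
def tTwo (t : Idx n → Idx n → ℕ → A) : SEnd n (SEnd n (MvPowerSeries (Fin 2) A)) :=
  SEnd.emb ((tMatrix t).map (atVar 1 1))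

end RTT

/-- The indices `(i, j, r)` of the generators `t_{ij}^{(r+1)}`. -/
abbrev Gen (n : ℕ) := Idx n × Idx n × ℕ

/-- The free superalgebra on the generators `t_{ij}^{(r)}` of parity `|i| + |j|`. -/
abbrev FreeGen (n : ℕ) := FreeAlgebra ℂ (Gen n)

/-- The parity automorphism of the free superalgebra. -/
def freePar (n : ℕ) : FreeGen n →ₐ[ℂ] FreeGen n :=
  FreeAlgebra.lift ℂ fun g => sgn (g.1.2 + g.2.1.2) • FreeAlgebra.ι ℂ g

theorem freePar_gen {n : ℕ} (g : Gen n) :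
    freePar n (FreeAlgebra.ι ℂ g) = sgn (g.1.2 + g.2.1.2) • FreeAlgebra.ι ℂ g := by
  simp [freePar]

theorem freePar_freePar {n : ℕ} (a : FreeGen n) : freePar n (freePar n a) = a := by
  have h : (freePar n).comp (freePar n) = AlgHom.id ℂ (FreeGen n) := by
    apply FreeAlgebra.hom_ext
    funext g
    simp only [Function.comp_apply, AlgHom.comp_apply, freePar_gen, map_zsmul, smul_smul,
      sgn_mul_self, one_smul, AlgHom.id_apply]
  exact DFunLike.congr_fun h a

instance (n : ℕ) : SuperRing (FreeGen n) where
  par := (freePar n : FreeGen n →+* FreeGen n)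
  par_par := freePar_freePar

/-- The free generators. -/
def freeT (n : ℕ) : Idx n → Idx n → ℕ → FreeGen n := fun i j r => FreeAlgebra.ι ℂ (i, j, r)

theorem par_free (n : ℕ) (a : FreeGen n) : SuperRing.par a = freePar n a := rfl

theorem freePar_tCoeff {n : ℕ} (i j : Idx n) (r : ℕ) :
    freePar n (tCoeff (freeT n) i j r) = sgn (i.2 + j.2) • tCoeff (freeT n) i j r := by
  cases r with
  | zero =>
    by_cases h : i = j
    · subst h
      have h : i.2 + i.2 = 0 := CharTwo.add_self_eq_zero i.2
      simp [tCoeff, h, sgn]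
    · simp [tCoeff, h]
  | succ r => exact freePar_gen (i, j, r)

theorem par_atVar_tMatrix {n d : ℕ} (k : Fin d) (ε : ℤ) (i j : Idx n) :
    SuperRing.par (atVar k ε (tMatrix (freeT n) i j)) =
      sgn (i.2 + j.2) • atVar k ε (tMatrix (freeT n) i j) := by
  ext m
  change freePar n (atVar k ε (tMatrix (freeT n) i j) m) =
    sgn (i.2 + j.2) • (atVar k ε (tMatrix (freeT n) i j) m)
  unfold atVar
  split_ifs with h
  · simp only [tMatrix, PowerSeries.coeff_mk, map_zsmul, freePar_tCoeff]
    rw [smul_comm]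
  · simp

theorem SEnd.emb_zsmul {n : ℕ} {A : Type*} [Ring A] (s : ℤ) (a : A) :
    (SEnd.emb (s • a) : SEnd n A) = s • SEnd.emb a := by
  ext i j
  change _ = s • (SEnd.emb a i j)
  by_cases h : i = j <;> simp [SEnd.emb, h]

theorem par_tOne (n : ℕ) : SuperRing.par (tOne (freeT n)) = tOne (freeT n) := by
  funext i j
  rw [SEnd.par_apply]
  simp only [tOne, SEnd.map, SEnd.par_emb, par_atVar_tMatrix, SEnd.emb_zsmul, smul_smul,
    sgn_mul_self, one_smul]

theorem par_tTwo (n : ℕ) : SuperRing.par (tTwo (freeT n)) = tTwo (freeT n) := by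
  rw [tTwo, SEnd.par_emb]
  congr 1
  funext i j
  rw [SEnd.par_apply]
  simp only [SEnd.map, par_atVar_tMatrix, smul_smul, sgn_mul_self, one_smul]

theorem par_X {A σ : Type*} [Ring A] [SuperRing A] (s : σ) :
    SuperRing.par (MvPowerSeries.X s : MvPowerSeries σ A) = MvPowerSeries.X s :=
  MvPowerSeries.map_X _ s

theorem par_rMatrix (n : ℕ) (A : Type*) [Ring A] [SuperRing A] :
    SuperRing.par (rMatrix n A) = rMatrix n A := by
  simp only [rMatrix, map_sub, map_mul, SEnd.par_emb, SEnd.par_P, SEnd.par_Q, map_pow, map_add,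
    par_X]

theorem freePar_coeff {n : ℕ} {X : SEnd n (SEnd n (MvPowerSeries (Fin 2) (FreeGen n)))}
    (hX : SuperRing.par X = X) (i j k l : Idx n) (m : Fin 2 →₀ ℕ) :
    freePar n (MvPowerSeries.coeff m (X i j k l)) =
      (sgn (i.2 + j.2) * sgn (k.2 + l.2)) • MvPowerSeries.coeff m (X i j k l) := by
  have h : (sgn (i.2 + j.2) * sgn (k.2 + l.2)) • SuperRing.par (X i j k l) = X i j k l := by
    rw [← SEnd.parity_eq_zsmul_apply, ← SEnd.par_apply, hX]
  have hs : (sgn (i.2 + j.2) * sgn (k.2 + l.2)) * (sgn (i.2 + j.2) * sgn (k.2 + l.2)) = 1 := by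
    rw [mul_mul_mul_comm, sgn_mul_self, sgn_mul_self, one_mul]
  conv_rhs => rw [← h]
  rw [map_zsmul, smul_smul, hs, one_smul]
  rfl

/-- The defining relations of `Y(q_n)`: the coefficients of `t_{ij}(-u) = t_{-i,-j}(u)`, and the
coefficients of all entries of `R(u,v) T^1(u) T^2(v) = T^2(v) T^1(u) R(u,v)`, multiplied by
`u^2 - v^2`. -/
inductive Rel (n : ℕ) : FreeGen n → FreeGen n → Prop
  | symm (i j : Idx n) (r : ℕ) :
      Rel n ((-1 : ℤ) ^ r • tCoeff (freeT n) i j r) (tCoeff (freeT n) i.opp j.opp r)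
  | rtt (i j k l : Idx n) (m : Fin 2 →₀ ℕ) :
      Rel n
        (MvPowerSeries.coeff m
          ((rMatrix n (FreeGen n) * tOne (freeT n) * tTwo (freeT n)) i j k l))
        (MvPowerSeries.coeff m
          ((tTwo (freeT n) * tOne (freeT n) * rMatrix n (FreeGen n)) i j k l))

/-- The queer super-Yangian `Y(q_n)`. -/
abbrev Yangian (n : ℕ) := RingQuot (Rel n)

/-- The parity automorphism of `Y(q_n)`, given by `|t_{ij}^{(r)}| = |i| + |j|`. -/
def yangianPar (n : ℕ) : Yangian n →ₐ[ℂ] Yangian n :=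
  RingQuot.liftAlgHom ℂ ⟨(RingQuot.mkAlgHom ℂ (Rel n)).comp (freePar n), by
    intro x y hxy
    have hq := RingQuot.mkAlgHom_rel ℂ hxy
    rw [AlgHom.comp_apply, AlgHom.comp_apply]
    cases hxy with
    | symm i j r =>
      have h : i.opp.2 + j.opp.2 = i.2 + j.2 := by
        have : (1 : ZMod 2) + 1 = 0 := by decide
        simp only [Idx.opp]
        linear_combination this
      rw [map_zsmul, freePar_tCoeff, freePar_tCoeff, h, smul_comm, map_zsmul, hq, map_zsmul]
    | rtt i j k l m =>
      rw [freePar_coeff (by simp only [map_mul, par_rMatrix, par_tOne, par_tTwo]),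
        freePar_coeff (by simp only [map_mul, par_rMatrix, par_tOne, par_tTwo]),
        map_zsmul, hq, map_zsmul]⟩

theorem yangianPar_mk {n : ℕ} (a : FreeGen n) :
    yangianPar n (RingQuot.mkAlgHom ℂ (Rel n) a) = RingQuot.mkAlgHom ℂ (Rel n) (freePar n a) := by
  rw [yangianPar, RingQuot.liftAlgHom_mkAlgHom_apply, AlgHom.comp_apply]

instance (n : ℕ) : SuperRing (Yangian n) where
  par := (yangianPar n : Yangian n →+* Yangian n)
  par_par := fun a => by
    obtain ⟨b, rfl⟩ := RingQuot.mkAlgHom_surjective ℂ (Rel n) a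
    change yangianPar n (yangianPar n _) = _
    rw [yangianPar_mk, yangianPar_mk, freePar_freePar]

/-- The generators `t_{ij}^{(r+1)}` of `Y(q_n)`. -/
def yangianT (n : ℕ) : Idx n → Idx n → ℕ → Yangian n :=
  fun i j r => RingQuot.mkAlgHom ℂ (Rel n) (freeT n i j r)

/-- The generator matrix `T(u)` of `Y(q_n)`. -/
def genMatrix (n : ℕ) : SEnd n (PowerSeries (Yangian n)) := tMatrix (yangianT n)

/-! ### Three-fold tensor products -/

section Legs

variable {A : Type*} [Ring A] [SuperRing A]

/-- `End(ℂ^{1|1})^{⊗ 3} ⊗ A[[u^{-1}, v^{-1}, w^{-1}]]`; the variables `u, v, w` have the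
numbers `0, 1, 2`. -/
abbrev Triple (A : Type*) := SEnd 1 (SEnd 1 (SEnd 1 (MvPowerSeries (Fin 3) A)))

/-- `X^1(ε u_k)` for `X(u)` in `End(ℂ^{1|1}) ⊗ A[[u^{-1}]]` and `ε = ±1`. -/
def legOne (X : SEnd 1 (PowerSeries A)) (k : Fin 3) (ε : ℤ) : Triple A :=
  X.map fun f => SEnd.emb (SEnd.emb (atVar k ε f))

/-- `X^2(ε u_k)`. -/
def legTwo (X : SEnd 1 (PowerSeries A)) (k : Fin 3) (ε : ℤ) : Triple A :=
  SEnd.emb (X.map fun f => SEnd.emb (atVar k ε f))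

/-- `X^3(ε u_k)`. -/
def legThree (X : SEnd 1 (PowerSeries A)) (k : Fin 3) (ε : ℤ) : Triple A :=
  SEnd.emb (SEnd.emb (X.map fun f => atVar k ε f))

/-- `1 ⊗ 1 ⊗ 1 ⊗ c`. -/
def scalar (c : MvPowerSeries (Fin 3) A) : Triple A := SEnd.emb (SEnd.emb (SEnd.emb c))

/-- `P^{12}`. -/
def P12 (A : Type*) [Ring A] [SuperRing A] : Triple A := SEnd.P 1 _

/-- `Q^{12}`. -/
def Q12 (A : Type*) [Ring A] [SuperRing A] : Triple A := SEnd.Q 1 _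

end Legs

end QueerYangian

end

open QueerYangian

/-!
The ring of `2n × 2n` matrices is regarded as the ring of `n × n` matrices over the ring of `2 × 2`
matrices (`SEnd.blockEquiv`). With `K(u, v) = P / (u - v) + Q / (u + v)`, the defining relation of
`Y(q_n)` then reads, for the blocks of `T^1(u)` and `T^2(v)`,
`[T_ab^1(u), T_cd^2(v)] = K(u, v) T_cb^1(u) T_ad^2(v) - T_cb^2(v) T_ad^1(u) K(u, v)`;
this is the predicate `RTT` (with denominators cleared), and `kMat` is `K` times `v⁻² - u⁻²`.

*Gauss decomposition.* A series of `2 × 2` matrices with constant term `1` is a unit, so the Gauss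
decomposition of `T(u)` exists by induction with Schur complements (`exists_isGauss`), and it is
unique (`IsGauss.unique`). By uniqueness an endomorphism that fixes `T(u)` fixes its factors
(`IsGenMatrix.fixed_factors`); hence `E_a(u)` is even and `E_a(-u)` is obtained from `E_a(u)` by
`E_ij ↦ E_{-i,-j}`. Therefore `P^{12}` exchanges `E_a^1(u)` and `E_a^2(u)`, and `Q^{12}` exchanges
`E_a^1(u)` and `E_a^2(-u)` (`LegSwap`).

*Reduction to `3 × 3` matrices.* The RTT relation passes to submatrices and, in reversed order, to
inverse matrices. Taking a Schur complement means inverting, deleting the first row and column, and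
inverting again. So the product of any three consecutive rows and columns of the Gauss factors again
satisfies the RTT relation (`IsGauss.exists_tail`, `IsGenMatrix.exists_corner`).

*The case `b = a + 1`.* Let `e = E_a(u)`, `f = E_b(w)` and `b(u) = [E_a(u), f]`. Combining the
RTT relation with the Yang-Baxter equation (`IsYBTriple.kMat`) gives a formula for the commutator
of `e^1(u)` and `b^2(v)` (`commutator_eq_of_rtt`), which says that the difference `Y` between
`(v⁻² - u⁻²) [e^1(u), b^2(v)]` and an explicit bilinear expression satisfies
`(1 - K) Y = - u⁻¹ v⁻¹ (u⁻¹ B + v⁻¹ C)`, where `B` and `C` do not involve `v`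
(`commutator_functional_eq`). Comparing the coefficients of the powers of `v⁻¹`, and using that no
nonzero series is divisible by all powers of `u⁻¹`, one finds `Y = B = C = 0`
(`eq_zero_of_functional_eq`). These identities, together with those for `u` and `v` exchanged, imply
the Serre relation (`serre_of_commutators`).

*The case `b = a - 1`.* The argument applies in the opposite ring to the transpose along the
antidiagonal of the inverse of the `3 × 3` matrix, with `-P` and `-Q` in place of `P` and `Q`
(`Corner.currentSetupOp`); conjugation by `P^{12}` brings the result into the stated form
(`serre_of_op`).
-/

noncomputable section

set_option linter.unusedSimpArgs false

namespace QueerYangian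

open SuperRing

theorem mul_mul_of_eq {M : Type*} [Semigroup M] {a b c e : M} (h : a * b = c * e) (z : M) :
    a * (b * z) = c * (e * z) := by
  rw [← mul_assoc, h, mul_assoc]

/-! ### The commutator formula -/

section CommutatorFormula

variable {𝕜 R : Type*} [CommRing 𝕜] [Ring R] [Algebra 𝕜 R]

/-- Let `t_i`, `h_i`, `s_i` be the entries `T_01`, `T_00`, `T_02` of a matrix with the RTT relation,
in the tensor factor `i`, and let `f`, `et` be entries of the upper triangular Gauss factor in the
third tensor factor. Then `t_1` and `[t_2, f]` satisfy an exchange relation in which the third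
variable has disappeared: the Yang-Baxter equation `yb` cancels all terms with `k13` and `k23`. -/
theorem mul_commutator_of_rtt (d d13 d23 : 𝕜) (reg13 : ∀ r : R, d13 • r = 0 → r = 0)
    (reg23 : ∀ r : R, d23 • r = 0 → r = 0) (k k13 k23 h1 h2 t1 t2 s1 s2 f et : R)
    (r_th : d • (t1 * h2 - h2 * t1) = k * t1 * h2 - t2 * h1 * k)
    (r_tt : d • (t1 * t2 - t2 * t1) = k * t1 * t2 - t2 * t1 * k)
    (r_ts : d • (t1 * s2 - s2 * t1) = k * t1 * s2 - t2 * s1 * k)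
    (m1 : d13 • (t1 * f - f * t1) = t1 * k13 * f - s1 * k13 - h1 * k13 * et)
    (m2 : d23 • (t2 * f - f * t2) = t2 * k23 * f - s2 * k23 - h2 * k23 * et)
    (tet : t1 * et = et * t1) (kf : k * f = f * k) (ket : k * et = et * k)
    (kh : k23 * h1 = h1 * k23) (kt : k23 * t1 = t1 * k23) (ks : k23 * s1 = s1 * k23)
    (yb : d13 • (k * k23) - d23 • (k13 * k) = d • (k23 * k13)) :
    d • (t1 * (t2 * f - f * t2)) - k * t1 * (t2 * f - f * t2)
      = d • ((t2 * f - f * t2) * t1) - t2 * (t1 * f - f * t1) * k := by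
  rw [← sub_eq_zero]
  apply reg13
  apply reg23
  -- `d13 d23` times the difference, expressed by the given relations
  linear_combination (norm := skip) (d13 * d) • (t1 * m2) - d13 • (k * t1 * m2)
    - (d13 * d) • (m2 * t1) + d23 • (t2 * m1 * k)
    + d13 • (r_tt * k23 * f) - d13 • (r_ts * k23) - d13 • (r_th * k23 * et)
    - t2 * t1 * yb * f + t2 * s1 * yb + t2 * h1 * yb * et + d • (t2 * k23 * m1)
  simp only [mul_add, add_mul, mul_sub, sub_mul, smul_mul_assoc, mul_smul_comm, smul_add,
    smul_sub, smul_smul, mul_assoc, kf, ket, ← tet, kh, kt, ks, mul_mul_of_eq kf,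
    mul_mul_of_eq ket, mul_mul_of_eq tet.symm, mul_mul_of_eq kh, mul_mul_of_eq kt, mul_mul_of_eq ks]
  module

/-- Dividing the exchange relation `mul_commutator_of_rtt` by `h_1` and `h_2` on the left, where
`t_i = h_i e_i`, gives a formula for the commutator of `e_1` and `b_2 = [e_2, f]`. -/
theorem commutator_eq_of_rtt (d d13 d23 : 𝕜) (reg13 : ∀ r : R, d13 • r = 0 → r = 0)
    (reg23 : ∀ r : R, d23 • r = 0 → r = 0) (k k13 k23 h1 h2 e1 e2 g1 g2 f et h1' h2' : R)
    (i1 : h1' * h1 = 1) (i2 : h2' * h2 = 1)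
    (r_hh : d • (h1 * h2 - h2 * h1) = k * h1 * h2 - h2 * h1 * k)
    (r_ht : d • (h1 * (h2 * e2) - (h2 * e2) * h1) = k * h1 * (h2 * e2) - h2 * (h1 * e1) * k)
    (r_th : d • (h1 * e1 * h2 - h2 * (h1 * e1)) = k * (h1 * e1) * h2 - (h2 * e2) * h1 * k)
    (r_tt : d • ((h1 * e1) * (h2 * e2) - (h2 * e2) * (h1 * e1))
      = k * (h1 * e1) * (h2 * e2) - (h2 * e2) * (h1 * e1) * k)
    (r_ts : d • ((h1 * e1) * (h2 * g2) - (h2 * g2) * (h1 * e1))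
      = k * (h1 * e1) * (h2 * g2) - (h2 * e2) * (h1 * g1) * k)
    (hf1 : h1 * f = f * h1) (hf2 : h2 * f = f * h2)
    (m1 : d13 • (h1 * e1 * f - f * (h1 * e1)) = h1 * e1 * k13 * f - h1 * g1 * k13 - h1 * k13 * et)
    (m2 : d23 • (h2 * e2 * f - f * (h2 * e2)) = h2 * e2 * k23 * f - h2 * g2 * k23 - h2 * k23 * et)
    (tet : h1 * e1 * et = et * (h1 * e1)) (kf : k * f = f * k) (ket : k * et = et * k)
    (kh : k23 * h1 = h1 * k23) (kt : k23 * e1 = e1 * k23) (ks : k23 * g1 = g1 * k23)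
    (yb : d13 • (k * k23) - d23 • (k13 * k) = d • (k23 * k13)) (b1 b2 : R)
    (hb1 : b1 = e1 * f - f * e1) (hb2 : b2 = e2 * f - f * e2) :
    (d * d) • (e1 * b2 - b2 * e1)
      = d • ((b1 * k - k * b2) * e1 - e2 * (b1 * k - k * b2))
        - (e1 * k - k * e2) * (b1 * k - k * b2) := by
  have hC := mul_commutator_of_rtt d d13 d23 reg13 reg23 k k13 k23 h1 h2
    (h1 * e1) (h2 * e2) (h1 * g1)
    (h2 * g2) f et r_th r_tt r_ts m1 m2 tet kf ket kh
    (by rw [← mul_assoc, kh, mul_assoc, kt, mul_assoc])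
    (by rw [← mul_assoc, kh, mul_assoc, ks, mul_assoc]) yb
  have c1 : ∀ a b : R, h1 * a = h1 * b → a = b := fun a b h => by
    have := congrArg (h1' * ·) h
    simpa only [← mul_assoc, i1, one_mul] using this
  have c2 : ∀ a b : R, h2 * a = h2 * b → a = b := fun a b h => by
    have := congrArg (h2' * ·) h
    simpa only [← mul_assoc, i2, one_mul] using this
  have B1 : h1 * e1 * f - f * (h1 * e1) = h1 * b1 := by
    rw [hb1, mul_sub, ← mul_assoc f, ← hf1]; simp only [mul_assoc]
  have B2 : h2 * e2 * f - f * (h2 * e2) = h2 * b2 := by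
    rw [hb2, mul_sub, ← mul_assoc f, ← hf2]; simp only [mul_assoc]
  rw [B1, B2] at hC
  -- conjugation of `e2` and `b2` by `h1`
  have E : d • (e2 * h1) = h1 * (d • e2 - k * e2 + e1 * k) := by
    apply c2
    have h := congrArg (· * e2) r_hh
    linear_combination (norm := skip) h - r_ht
    simp only [mul_add, add_mul, mul_sub, sub_mul, smul_mul_assoc, mul_smul_comm, smul_add,
      smul_sub, smul_smul, mul_assoc]
    module
  -- the relation for `b2` is the commutator of the one for `e2` with `f`
  have B : d • (b2 * h1) = h1 * (d • b2 - k * b2 + b1 * k) := by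
    have hE := congrArg (fun z => z * f - f * z) E
    rw [hb1, hb2]
    linear_combination (norm := skip) hE
    simp only [mul_add, add_mul, mul_sub, sub_mul, smul_mul_assoc, mul_smul_comm, smul_add,
      smul_sub, smul_smul, mul_assoc, ← hf1, mul_mul_of_eq hf1.symm, kf, mul_mul_of_eq kf]
    module
  have X : d • (h1 * e1 * b2 - b2 * (h1 * e1)) = e2 * h1 * (k * b2 - b1 * k) := by
    apply c2
    have h := congrArg (· * b2) r_th
    linear_combination (norm := skip) hC - h
    simp only [mul_add, add_mul, mul_sub, sub_mul, smul_mul_assoc, mul_smul_comm, smul_add,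
      smul_sub, smul_smul, mul_assoc]
    module
  apply c1
  linear_combination (norm := skip) d • X + d • (B * e1) + E * (k * b2 - b1 * k)
  simp only [mul_add, add_mul, mul_sub, sub_mul, smul_mul_assoc, mul_smul_comm, smul_add,
      smul_sub, smul_smul, mul_assoc]
  module

end CommutatorFormula

/-! ### The functional equation -/

section FunctionalEquation

variable {𝕜 R : Type*} [CommRing 𝕜] [Ring R] [Algebra 𝕜 R]

/-- The algebraic relations between the tensors `P` and `Q` of `ℂ^{1|1}`. -/
structure IsPQPair (P Q : R) : Prop where
  P_mul_P : P * P = 1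
  Q_mul_Q : Q * Q = 1
  Q_mul_P : Q * P = -(P * Q)

/-- The families `e1 p ε` and `e2 p ε`, thought of as `e^1(ε p)` and `e^2(ε p)` for a variable `p`
and a sign `ε`, are exchanged by `P`, and by `Q` up to a change of the sign of the variable. -/
structure LegSwap {κ : Type*} (P Q : R) (e1 e2 : κ → ℤ → R) : Prop where
  P_one : ∀ p ε, P * e1 p ε = e2 p ε * P
  P_two : ∀ p ε, P * e2 p ε = e1 p ε * P
  Q_one : ∀ p ε, Q * e1 p ε = e2 p (-ε) * Q
  Q_two : ∀ p ε, Q * e2 p ε = e1 p (-ε) * Q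

/-- With `x = u⁻¹` and `y = v⁻¹`, the element
`(y² - x²) (P / (u - v) + Q / (u + v))`. -/
def kMat (x y : 𝕜) (P Q : R) : R := (x * y) • ((x + y) • P + (y - x) • Q)

/-- Extraction of the coefficients of the powers of `y` in a ring of formal power series in `x`,
`y` and possibly other variables: `S` plays the role of the series that do not involve `y`. -/
structure CoeffMaps (x y : 𝕜) (P Q : R) (S : Subring R) where
  coeff : ℕ → R →+ R
  coeff_x : ∀ s r, coeff s (x • r) = x • coeff s r
  coeff_zero_y : ∀ r, coeff 0 (y • r) = 0
  coeff_succ_y : ∀ s r, coeff (s + 1) (y • r) = coeff s r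
  coeff_P : ∀ s r, coeff s (P * r) = P * coeff s r
  coeff_Q : ∀ s r, coeff s (Q * r) = Q * coeff s r
  ext_zero : ∀ r, (∀ s, coeff s r = 0) → r = 0
  coeff_succ_mem : ∀ s, ∀ r ∈ S, coeff (s + 1) r = 0
  coeff_zero_mem : ∀ r ∈ S, coeff 0 r = r

/-- The commutator formula, rewritten as the equation `(d - k) Y = -d x y (x B + y C)` for the
difference `Y` of `d [e^1(u), b^2(v)]` and the expression `N`. The elements `B` and `C` involve only
the variable `u`. -/
theorem commutator_functional_eq {κ : Type*} (u v : κ) (x y : 𝕜) (P Q : R) (e1 e2 b1 b2 : κ → ℤ → R)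
    (hPQ : IsPQPair P Q) (he : LegSwap P Q e1 e2) (hb : LegSwap P Q b1 b2)
    (d : 𝕜) (hd : d = y ^ 2 - x ^ 2) (k : R)
    (hk : k = kMat x y P Q)
    (s1 : (d * d) • (e1 u 1 * b2 v 1 - b2 v 1 * e1 u 1)
      = d • ((b1 u 1 * k - k * b2 v 1) * e1 u 1 - e2 v 1 * (b1 u 1 * k - k * b2 v 1))
        - (e1 u 1 * k - k * e2 v 1) * (b1 u 1 * k - k * b2 v 1))
    (a c g N B C Y : R)
    (ha : a = e1 u 1 * b2 u 1 - b2 u 1 * e1 u 1)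
    (hc : c = e1 u 1 * b2 u (-1) - b2 u (-1) * e1 u 1)
    (hg : g = (e1 u 1 - e1 u (-1)) * (b2 u 1 - b2 u (-1)))
    (hN : N = (x * y) • ((x + y) • (P * ((e1 u 1 - e1 v 1) * (b2 u 1 - b2 v 1)))
      + (y - x) • (Q * ((e1 u 1 - e1 v (-1)) * (b2 u (-1) - b2 v 1)))))
    (hB : B = P * a - Q * c) (hC : C = P * a + Q * c + x • (P * Q * g))
    (hY : Y = d • (e1 u 1 * b2 v 1 - b2 v 1 * e1 u 1) - N) :
    d • Y - k * Y = -((d * x * y) • (x • B + y • C)) := by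
  obtain ⟨hPP, hQQ, hQP⟩ := hPQ
  obtain ⟨Pe1, Pe2, Qe1, Qe2⟩ := he
  obtain ⟨Pb1, Pb2, Qb1, Qb2⟩ := hb
  rw [← sub_eq_zero]
  subst hY hB hC hg hc ha hN hk
  unfold kMat at s1 ⊢
  linear_combination (norm := skip) s1
  subst hd
  have h1 := fun p ε => mul_mul_of_eq (Pe1 p ε)
  have h2 := fun p ε => mul_mul_of_eq (Pe2 p ε)
  have h3 := fun p ε => mul_mul_of_eq (Qe1 p ε)
  have h4 := fun p ε => mul_mul_of_eq (Qe2 p ε)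
  have h5 := fun p ε => mul_mul_of_eq (Pb1 p ε)
  have h6 := fun p ε => mul_mul_of_eq (Pb2 p ε)
  have h7 := fun p ε => mul_mul_of_eq (Qb1 p ε)
  have h8 := fun p ε => mul_mul_of_eq (Qb2 p ε)
  have h9 : ∀ z, P * (P * z) = z := fun z => by rw [← mul_assoc, hPP, one_mul]
  have h10 : ∀ z, Q * (Q * z) = z := fun z => by rw [← mul_assoc, hQQ, one_mul]
  have h11 : ∀ z, Q * (P * z) = -(P * (Q * z)) := fun z => by
    rw [← mul_assoc, hQP, neg_mul, mul_assoc]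
  simp only [mul_add, add_mul, mul_sub, sub_mul, smul_mul_assoc, mul_smul_comm, smul_add,
    smul_sub, smul_smul, mul_assoc, Pe1, Pe2, Qe1, Qe2, Pb1, Pb2, Qb1, Qb2, h1, h2, h3, h4,
    h5, h6, h7, h8, h9, h10, h11, hPP, hQQ, hQP, neg_neg, mul_neg, neg_mul, smul_neg]
  module

/-- The only solution of the equation `(d - k) Y = -d x y (x B + y C)`, with `B` and `C` free of
`y`, is the trivial one. -/
theorem eq_zero_of_functional_eq (x y : 𝕜) (P Q : R)
    (hPQ : IsPQPair P Q) (regx : ∀ r : R, x • r = 0 → r = 0)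
    (reg2 : ∀ r : R, (2 : ℤ) • r = 0 → r = 0)
    (sep : ∀ r : R, (∀ n : ℕ, ∃ r', r = x ^ n • r') → r = 0)
    {S : Subring R} (cm : CoeffMaps x y P Q S) (B C Y : R) (hBS : B ∈ S) (hCS : C ∈ S)
    (d : 𝕜) (hd : d = y ^ 2 - x ^ 2) (k : R)
    (hk : k = kMat x y P Q)
    (h : d • Y - k * Y = -((d * x * y) • (x • B + y • C))) :
    Y = 0 ∧ B = 0 ∧ C = 0 := by
  obtain ⟨hPP, hQQ, hQP⟩ := hPQ
  obtain ⟨cf, cf_x, cf_y0, cf_y, cf_P, cf_Q, cf_ext, cf_S, cf_S0⟩ := cm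
  have cB := fun s => cf_S s B hBS
  have cC := fun s => cf_S s C hCS
  have cB0 := cf_S0 B hBS
  have cC0 := cf_S0 C hCS
  have h' : y • y • Y - x • x • Y - y • x • x • (P * Y) - y • y • x • (P * Y)
      - y • y • x • (Q * Y) + y • x • x • (Q * Y)
      = y • x • x • x • x • B + y • y • x • x • x • C - y • y • y • x • x • B
        - y • y • y • y • x • C := by
    subst hd hk
    unfold kMat at h
    linear_combination (norm := skip) h
    simp only [mul_add, add_mul, mul_sub, sub_mul, smul_mul_assoc, smul_smul, smul_add, smul_sub]
    module
  have H := fun s => congrArg (cf s) h'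
  simp only [map_sub, map_add] at H
  have e0 := H 0
  have e1 := H 1
  have e2 := H 2
  have e3 := H 3
  have e4 := H 4
  have eN := fun s => H (s + 5)
  simp only [cf_x, cf_y0, cf_y, cf_P, cf_Q, cB, cC, cB0, cC0, smul_zero, sub_zero, add_zero,
    zero_sub, zero_add, zero_sub, sub_self] at e0 e1 e2 e3 e4 eN
  have hPP' : ∀ z, P * (P * z) = z := fun z => by rw [← mul_assoc, hPP, one_mul]
  have hQQ' : ∀ z, Q * (Q * z) = z := fun z => by rw [← mul_assoc, hQQ, one_mul]
  have hQP' : ∀ z, Q * (P * z) = -(P * (Q * z)) := fun z => by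
    rw [← mul_assoc, hQP, neg_mul, mul_assoc]
  have Y0 : cf 0 Y = 0 := regx _ (regx _ (neg_eq_zero.1 e0))
  -- The coefficients of `y ^ (s + 5)` express the coefficient `s + 3` of `Y` as a multiple of `x`,
  -- in terms of coefficients of the same kind, so it is divisible by all powers of `x`.
  have Y3 : ∀ s, cf (s + 3) Y = 0 := by
    have key : ∀ n s, ∃ r', cf (s + 3) Y = x ^ n • r' := by
      intro n
      induction n with
      | zero => exact fun s => ⟨_, by rw [pow_zero, one_smul]⟩
      | succ n ih =>
        intro s
        obtain ⟨r0, h0⟩ := ih s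
        obtain ⟨r1, h1⟩ := ih (s + 1)
        obtain ⟨r2, h2⟩ := ih (s + 2)
        have := eN s
        rw [show s + 5 = s + 2 + 3 by ring, show s + 4 = s + 1 + 3 by ring] at this
        refine ⟨x • r2 + x • (P * r1) + P * r0 + Q * r0 - x • (Q * r1), ?_⟩
        rw [h1, h2, h0] at this
        rw [h0]
        linear_combination (norm := skip) this
        simp only [mul_smul_comm, pow_succ]
        module
    exact fun s => sep _ fun n => key n s
  -- the coefficients of `y`, `y ^ 2`, `y ^ 3` and `y ^ 4` determine the remaining unknowns
  rw [Y3 0, Y3 1] at e4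
  rw [Y3 0] at e3
  rw [Y0] at e1 e2
  simp only [mul_zero, smul_zero, sub_zero, add_zero, zero_sub, zero_add] at e1 e2 e3 e4
  have Y1 : cf 1 Y = -(x • x • B) := by
    rw [← sub_eq_zero]
    apply regx; apply regx
    linear_combination (norm := module) -e1
  have Y2 : cf 2 Y = -(x • C) - P * cf 1 Y + Q * cf 1 Y := by
    rw [← sub_eq_zero]
    apply regx; apply regx
    linear_combination (norm := module) -e2
  have F1 : x • (P * cf 2 Y) + P * cf 1 Y + Q * cf 1 Y - x • (Q * cf 2 Y) = 0 := by
    apply regx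
    linear_combination (norm := module) Y1 - e3
  have F2 : x • (P * cf 2 Y) + x • (Q * cf 2 Y) + P * cf 1 Y - Q * cf 1 Y = 0 := by
    linear_combination (norm := module) Y2 - e4
  have Y2' : cf 2 Y = 0 := by
    have F : x • (P * (Q * cf 2 Y)) = 0 := by
      apply reg2; apply reg2
      linear_combination (norm := skip) (P - Q) * F2 - (P + Q) * F1
      simp only [mul_add, add_mul, mul_sub, sub_mul, mul_smul_comm, hPP', hQQ', hQP',
        mul_neg, mul_zero]
      module
    have := congrArg (Q * ·) (congrArg (P * ·) (regx _ F))
    simpa only [hPP', hQQ', mul_zero] using this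
  rw [Y2'] at F1 F2 e4
  simp only [mul_zero, smul_zero, sub_zero, add_zero, zero_add] at F1 F2
  have Y1' : cf 1 Y = 0 := by
    have : P * cf 1 Y = 0 := by
      apply reg2
      linear_combination (norm := module) F1 + F2
    have := congrArg (P * ·) this
    simpa only [hPP', mul_zero] using this
  refine ⟨cf_ext _ fun s => ?_, regx _ (regx _ ?_), regx _ ?_⟩
  · match s with
    | 0 => exact Y0
    | 1 => exact Y1'
    | 2 => exact Y2'
    | s + 3 => exact Y3 s
  · rw [Y1'] at Y1
    exact neg_eq_zero.1 Y1.symm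
  · simpa using e4.symm

end FunctionalEquation

/-! ### From commutators to the Serre relation -/

section SerreOfCommutators

variable {𝕜 R : Type*} [CommRing 𝕜] [Ring R] [Algebra 𝕜 R]

/-- The Serre relation follows from the formulas for `[e^1(u), b^2(v)]` and `[e^1(v), b^2(u)]`, and
from the relations that involve a single variable. -/
theorem serre_of_commutators {κ : Type*} (u v : κ) (x y : 𝕜) (P Q : R) (e1 e2 b1 b2 : κ → ℤ → R)
    (hPQ : IsPQPair P Q) (he : LegSwap P Q e1 e2) (hb : LegSwap P Q b1 b2)
    (d : 𝕜) (hd : d = y ^ 2 - x ^ 2)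
    (reg2 : ∀ r : R, (2 : ℤ) • r = 0 → r = 0) (regd : ∀ r : R, d • r = 0 → r = 0)
    (Xuv : d • (e1 u 1 * b2 v 1 - b2 v 1 * e1 u 1)
      - (x * y) • ((x + y) • (P * ((e1 u 1 - e1 v 1) * (b2 u 1 - b2 v 1)))
      + (y - x) • (Q * ((e1 u 1 - e1 v (-1)) * (b2 u (-1) - b2 v 1)))) = 0)
    (Xvu : (-d) • (e1 v 1 * b2 u 1 - b2 u 1 * e1 v 1)
      - (y * x) • ((y + x) • (P * ((e1 v 1 - e1 u 1) * (b2 v 1 - b2 u 1)))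
      + (x - y) • (Q * ((e1 v 1 - e1 u (-1)) * (b2 v (-1) - b2 u 1)))) = 0)
    (Bu : P * (e1 u 1 * b2 u 1 - b2 u 1 * e1 u 1)
      - Q * (e1 u 1 * b2 u (-1) - b2 u (-1) * e1 u 1) = 0)
    (Cu : P * (e1 u 1 * b2 u 1 - b2 u 1 * e1 u 1)
      + Q * (e1 u 1 * b2 u (-1) - b2 u (-1) * e1 u 1)
      + x • (P * Q * ((e1 u 1 - e1 u (-1)) * (b2 u 1 - b2 u (-1)))) = 0)
    (Bv : P * (e1 v 1 * b2 v 1 - b2 v 1 * e1 v 1)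
      - Q * (e1 v 1 * b2 v (-1) - b2 v (-1) * e1 v 1) = 0)
    (Cv : P * (e1 v 1 * b2 v 1 - b2 v 1 * e1 v 1)
      + Q * (e1 v 1 * b2 v (-1) - b2 v (-1) * e1 v 1)
      + y • (P * Q * ((e1 v 1 - e1 v (-1)) * (b2 v 1 - b2 v (-1)))) = 0) :
    (x + y) • (P * ((e1 u 1 - e1 v 1) * (b2 u 1 - b2 v 1) - (b2 u 1 - b2 v 1) * (e1 u 1 - e1 v 1)))
      + (y - x) • (Q * ((e1 u 1 - e1 v (-1)) * (b2 u (-1) - b2 v 1)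
        - (b2 u (-1) - b2 v 1) * (e1 u 1 - e1 v (-1)))) = 0 := by
  obtain ⟨hPP, hQQ, hQP⟩ := hPQ
  obtain ⟨Pe1, Pe2, Qe1, Qe2⟩ := he
  obtain ⟨Pb1, Pb2, Qb1, Qb2⟩ := hb
  apply reg2
  apply regd
  -- the conjugations by `P * Q` change the signs of both variables
  linear_combination (norm := skip) (d * (x + y)) • (Bu + Cu) + (d * (x + y)) • (Bv + Cv)
    + (d * (y - x)) • (Cu - Bu) - (d * (y - x)) • (P * Q * (Cv - Bv) * Q * P)
    - (2 * (x + y)) • (P * Xuv) + (2 * (x + y)) • (P * Xvu)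
    - (2 * (y - x)) • (Q * Xuv) + (2 * (y - x)) • (Q * P * Q * Xvu * Q * P)
  subst hd
  have h1 := fun p ε => mul_mul_of_eq (Pe1 p ε)
  have h2 := fun p ε => mul_mul_of_eq (Pe2 p ε)
  have h3 := fun p ε => mul_mul_of_eq (Qe1 p ε)
  have h4 := fun p ε => mul_mul_of_eq (Qe2 p ε)
  have h5 := fun p ε => mul_mul_of_eq (Pb1 p ε)
  have h6 := fun p ε => mul_mul_of_eq (Pb2 p ε)
  have h7 := fun p ε => mul_mul_of_eq (Qb1 p ε)
  have h8 := fun p ε => mul_mul_of_eq (Qb2 p ε)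
  have h9 : ∀ z, P * (P * z) = z := fun z => by rw [← mul_assoc, hPP, one_mul]
  have h10 : ∀ z, Q * (Q * z) = z := fun z => by rw [← mul_assoc, hQQ, one_mul]
  have h11 : ∀ z, Q * (P * z) = -(P * (Q * z)) := fun z => by
    rw [← mul_assoc, hQP, neg_mul, mul_assoc]
  simp only [mul_add, add_mul, mul_sub, sub_mul, smul_mul_assoc, mul_smul_comm, smul_add,
    smul_sub, smul_smul, mul_assoc, Pe1, Pe2, Qe1, Qe2, Pb1, Pb2, Qb1, Qb2, h1, h2, h3, h4,
    h5, h6, h7, h8, h9, h10, h11, hPP, hQQ, hQP, neg_neg, mul_neg, neg_mul, smul_neg, mul_zero,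
    zero_mul, mul_one]
  module

end SerreOfCommutators

/-! ### Matrices with the RTT relation -/

section RTTMatrices

variable {𝕜 R ι : Type*} [CommRing 𝕜] [Ring R] [Algebra 𝕜 R]

/-- The RTT relation between the entries of two matrices, where `k / d` plays the role of
`P / (u - v) + Q / (u + v)`. -/
def RTT (d : 𝕜) (k : R) (A B : Matrix ι ι R) : Prop :=
  ∀ a b c e, d • (A a b * B c e - B c e * A a b) = k * A c b * B a e - B c b * A a e * k

theorem RTT.submatrix {ι' : Type*} {d : 𝕜} {k : R} {A B : Matrix ι ι R} (h : RTT d k A B)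
    (σ : ι' → ι) : RTT d k (A.submatrix σ σ) (B.submatrix σ σ) :=
  fun a b c e => h (σ a) (σ b) (σ c) (σ e)

variable [Fintype ι] [DecidableEq ι]

/-- The RTT relation between the entries of `A` and those of the inverse of `B`. -/
theorem RTT.mix {d : 𝕜} {k : R} {A B B' : Matrix ι ι R} (h : RTT d k A B)
    (hB : B * B' = 1) (hB' : B' * B = 1) (a b c e : ι) :
    d • (A a b * B' c e - B' c e * A a b)
      = (if b = c then ∑ x, A a x * k * B' x e else 0)
        - (if a = e then ∑ y, B' c y * k * A y b else 0) := by
  have hb : ∀ i j, ∑ x, B i x * B' x j = if i = j then 1 else 0 := fun i j => by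
    rw [← Matrix.mul_apply, hB, Matrix.one_apply]
  have hb' : ∀ i j, ∑ x, B' i x * B x j = if i = j then 1 else 0 := fun i j => by
    rw [← Matrix.mul_apply, hB', Matrix.one_apply]
  have key : ∑ p, ∑ q, B' c p * (d • (A a b * B p q - B p q * A a b)) * B' q e
      = ∑ p, ∑ q, B' c p * (k * A p b * B a q - B p b * A a q * k) * B' q e :=
    Finset.sum_congr rfl fun p _ => Finset.sum_congr rfl fun q _ => by rw [h a b p q]
  have t1 : ∑ p, ∑ q, B' c p * (A a b * B p q) * B' q e = B' c e * A a b := by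
    have : ∀ p, ∑ q, B' c p * (A a b * B p q) * B' q e = if p = e then B' c p * A a b else 0 := by
      intro p
      simp only [mul_assoc, ← Finset.mul_sum, hb, mul_ite, mul_one, mul_zero]
    simp [this]
  have t2 : ∑ p, ∑ q, B' c p * (B p q * A a b) * B' q e = A a b * B' c e := by
    rw [Finset.sum_comm]
    have : ∀ q, ∑ p, B' c p * (B p q * A a b) * B' q e = if c = q then A a b * B' q e else 0 := by
      intro q
      simp only [← mul_assoc, ← Finset.sum_mul, hb', ite_mul, one_mul, zero_mul]
    simp [this]
  have t3 : ∑ p, ∑ q, B' c p * (k * A p b * B a q) * B' q e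
      = if a = e then ∑ y, B' c y * k * A y b else 0 := by
    have : ∀ p, ∑ q, B' c p * (k * A p b * B a q) * B' q e
        = if a = e then B' c p * k * A p b else 0 := by
      intro p
      simp only [mul_assoc, ← Finset.mul_sum, hb, mul_ite, mul_one, mul_zero]
    simp only [this]
    split_ifs <;> simp
  have t4 : ∑ p, ∑ q, B' c p * (B p b * A a q * k) * B' q e
      = if b = c then ∑ x, A a x * k * B' x e else 0 := by
    rw [Finset.sum_comm]
    have : ∀ q, ∑ p, B' c p * (B p b * A a q * k) * B' q e
        = if b = c then A a q * k * B' q e else 0 := by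
      intro q
      simp only [← mul_assoc, ← Finset.sum_mul, hb', ite_mul, one_mul, zero_mul, eq_comm]
    simp only [this]
    split_ifs <;> simp
  simp only [mul_sub, sub_mul, smul_sub, mul_smul_comm, smul_mul_assoc, Finset.sum_sub_distrib,
    ← Finset.smul_sum, t1, t2, t3, t4] at key
  rw [smul_sub]
  linear_combination (norm := abel) -key

/-- The RTT relation passes to the inverse matrices, in reversed order. -/
theorem RTT.inv {d : 𝕜} {k : R} {A A' B B' : Matrix ι ι R} (h : RTT d k A B)
    (hA : A * A' = 1) (hA' : A' * A = 1) (hB : B * B' = 1) (hB' : B' * B = 1) :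
    RTT d k B' A' := by
  intro a b c e
  have ha : ∀ i j, ∑ x, A i x * A' x j = if i = j then 1 else 0 := fun i j => by
    rw [← Matrix.mul_apply, hA, Matrix.one_apply]
  have ha' : ∀ i j, ∑ x, A' i x * A x j = if i = j then 1 else 0 := fun i j => by
    rw [← Matrix.mul_apply, hA', Matrix.one_apply]
  have key : ∑ p, ∑ q, A' c p * (d • (A p q * B' a b - B' a b * A p q)) * A' q e
      = ∑ p, ∑ q, A' c p * ((if q = a then ∑ x, A p x * k * B' x b else 0)
        - (if p = b then ∑ y, B' a y * k * A y q else 0)) * A' q e :=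
    Finset.sum_congr rfl fun p _ => Finset.sum_congr rfl fun q _ => by
      rw [h.mix hB hB' p q a b]
  have t1 : ∑ p, ∑ q, A' c p * (A p q * B' a b) * A' q e = B' a b * A' c e := by
    rw [Finset.sum_comm]
    have : ∀ q, ∑ p, A' c p * (A p q * B' a b) * A' q e = if c = q then B' a b * A' q e else 0 := by
      intro q
      simp only [← mul_assoc, ← Finset.sum_mul, ha', ite_mul, one_mul, zero_mul]
    simp [this]
  have t2 : ∑ p, ∑ q, A' c p * (B' a b * A p q) * A' q e = A' c e * B' a b := by
    have : ∀ p, ∑ q, A' c p * (B' a b * A p q) * A' q e = if p = e then A' c p * B' a b else 0 := by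
      intro p
      simp only [mul_assoc, ← Finset.mul_sum, ha, mul_ite, mul_one, mul_zero]
    simp [this]
  have t3 : ∑ p, ∑ q, A' c p * (if q = a then ∑ x, A p x * k * B' x b else 0) * A' q e
      = k * B' c b * A' a e := by
    have h1 : ∀ p, ∑ q, A' c p * (if q = a then ∑ x, A p x * k * B' x b else 0) * A' q e
        = ∑ x, A' c p * A p x * (k * B' x b * A' a e) := by
      intro p
      simp [Finset.mul_sum, Finset.sum_mul, mul_assoc]
    simp only [h1]
    rw [Finset.sum_comm]
    simp only [← Finset.sum_mul, ha', ite_mul, one_mul, zero_mul]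
    simp
  have t4 : ∑ p, ∑ q, A' c p * (if p = b then ∑ y, B' a y * k * A y q else 0) * A' q e
      = A' c b * B' a e * k := by
    rw [Finset.sum_comm]
    have h1 : ∀ q, ∑ p, A' c p * (if p = b then ∑ y, B' a y * k * A y q else 0) * A' q e
        = ∑ y, A' c b * B' a y * k * (A y q * A' q e) := by
      intro q
      simp [Finset.mul_sum, Finset.sum_mul, mul_assoc]
    simp only [h1]
    rw [Finset.sum_comm]
    simp only [← Finset.mul_sum, ha, mul_ite, mul_one, mul_zero]
    simp
  simp only [mul_sub, sub_mul, smul_sub, mul_smul_comm, smul_mul_assoc, Finset.sum_sub_distrib,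
    ← Finset.smul_sum, t1, t2, t3, t4] at key
  rw [smul_sub]
  exact key

end RTTMatrices

/-! ### The Yang-Baxter equation and the commutator formula for matrices -/

section SerreRTT

variable {𝕜 R : Type*} [CommRing 𝕜] [Ring R] [Algebra 𝕜 R]

/-- The relations between the tensors `P`, `Q` of `ℂ^{1|1}` in three tensor factors that express the
Yang-Baxter equation. -/
structure IsYBTriple (P12 Q12 P13 Q13 P23 Q23 : R) : Prop where
  PP : P12 * P23 = P23 * P13
  PP' : P13 * P12 = P23 * P13
  PQ : P12 * Q23 = Q23 * Q13
  PQ' : Q13 * P12 = Q23 * Q13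
  QP : Q12 * P23 = P23 * Q13
  QP' : Q13 * Q12 = -(P23 * Q13)
  QQ : Q12 * Q23 = Q23 * P13
  QQ' : P13 * Q12 = -(Q23 * P13)

/-- The Yang-Baxter equation for the part of the R-matrix of degree two in `P` and `Q`. -/
theorem IsYBTriple.kMat {P12 Q12 P13 Q13 P23 Q23 : R} (h : IsYBTriple P12 Q12 P13 Q13 P23 Q23)
    (x y z : 𝕜) :
    (z ^ 2 - x ^ 2) • (kMat x y P12 Q12 * kMat y z P23 Q23)
      - (z ^ 2 - y ^ 2) • (kMat x z P13 Q13 * kMat x y P12 Q12)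
      = (y ^ 2 - x ^ 2) • (kMat y z P23 Q23 * kMat x z P13 Q13) := by
  unfold QueerYangian.kMat
  simp only [mul_add, add_mul, smul_mul_assoc, mul_smul_comm, smul_add, smul_smul, h.PP, h.PP',
    h.PQ, h.PQ', h.QP, h.QP', h.QQ, h.QQ', smul_neg]
  module

theorem kMat_neg (x y : 𝕜) (P Q : R) : kMat x y (-P) (-Q) = -kMat x y P Q := by
  unfold kMat; module

/-- The commutator formula for a matrix with the RTT relation: here `M1`, `M2`, `M3` are the images
of the matrix in three tensor factors, `h`, `h e`, `h g` are the entries of the first row of `M1`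
and `M2`, and `-f q`, `et q` and `q` are entries of the last column of the inverse of `M3`. -/
theorem commutator_eq_of_rtt_matrices {d d13 d23 : 𝕜} (reg13 : ∀ r : R, d13 • r = 0 → r = 0)
    (reg23 : ∀ r : R, d23 • r = 0 → r = 0) {k k13 k23 : R}
    {M1 M2 M3 M3' : Matrix (Fin 3) (Fin 3) R} (r12 : RTT d k M1 M2) (r13 : RTT d13 k13 M1 M3)
    (r23 : RTT d23 k23 M2 M3) (hM : M3 * M3' = 1) (hM' : M3' * M3 = 1)
    (h1 h2 e1 e2 g1 g2 f et q q' h1' h2' : R) (hq : q * q' = 1)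
    (i1 : h1' * h1 = 1) (i2 : h2' * h2 = 1)
    (M1h : M1 0 0 = h1) (M1e : M1 0 1 = h1 * e1) (M1g : M1 0 2 = h1 * g1)
    (M2h : M2 0 0 = h2) (M2e : M2 0 1 = h2 * e2) (M2g : M2 0 2 = h2 * g2)
    (Mq : M3' 2 2 = q) (Mf : M3' 1 2 = -(f * q)) (Met : M3' 0 2 = et * q)
    (kf : k * f = f * k) (ket : k * et = et * k)
    (kh : k23 * h1 = h1 * k23) (kt : k23 * e1 = e1 * k23) (ks : k23 * g1 = g1 * k23)
    (yb : d13 • (k * k23) - d23 • (k13 * k) = d • (k23 * k13)) (b1 b2 : R)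
    (hb1 : b1 = e1 * f - f * e1) (hb2 : b2 = e2 * f - f * e2) :
    (d * d) • (e1 * b2 - b2 * e1)
      = d • ((b1 * k - k * b2) * e1 - e2 * (b1 * k - k * b2))
        - (e1 * k - k * e2) * (b1 * k - k * b2) := by
  have canc : ∀ a b : R, a * q = b * q → a = b := fun a b h => by
    have := congrArg (· * q') h
    simpa only [mul_assoc, hq, mul_one] using this
  have aux : ∀ (δ : 𝕜) (κ : R) (M : Matrix (Fin 3) (Fin 3) R) (h e g : R),
      (∀ r : R, δ • r = 0 → r = 0) → RTT δ κ M M3 → M 0 0 = h → M 0 1 = h * e → M 0 2 = h * g →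
      h * f = f * h ∧ h * e * et = et * (h * e) ∧
      δ • (h * e * f - f * (h * e)) = h * e * κ * f - h * g * κ - h * κ * et := by
    intro δ κ M h e g reg r Mh Me Mg
    have x0 := r.mix hM hM' 0 0 2 2
    have x1 := r.mix hM hM' 0 0 1 2
    have x2 := r.mix hM hM' 0 1 2 2
    have x3 := r.mix hM hM' 0 1 0 2
    have x4 := r.mix hM hM' 0 1 1 2
    simp [Fin.sum_univ_three, Mq, Mf, Met, Mh, Me, Mg] at x0 x1 x2 x3 x4
    have hq0 : h * q = q * h := sub_eq_zero.1 (reg _ x0)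
    have tq : h * e * q = q * (h * e) := sub_eq_zero.1 (reg _ x2)
    have y1 : h * (f * q) = f * q * h := sub_eq_zero.1 (reg _ (by
      rw [smul_sub]; linear_combination (norm := module) -x1))
    have y3 := sub_eq_zero.1 (reg _ x3)
    refine ⟨canc _ _ ?_, canc _ _ ?_, canc _ _ ?_⟩
    · rw [mul_assoc, mul_assoc, hq0, ← mul_assoc f]
      exact y1
    · rw [mul_assoc _ et, y3, mul_assoc, mul_assoc, tq]
    · linear_combination (norm := skip) -x4 - δ • (f * tq)
      simp only [mul_add, add_mul, mul_sub, sub_mul, smul_mul_assoc, mul_smul_comm, smul_add,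
        smul_sub, smul_smul, mul_assoc, neg_mul, mul_neg]
      module
  obtain ⟨hf1, tet, m1⟩ := aux d13 k13 M1 h1 e1 g1 reg13 r13 M1h M1e M1g
  obtain ⟨hf2, -, m2⟩ := aux d23 k23 M2 h2 e2 g2 reg23 r23 M2h M2e M2g
  have r_hh := r12 0 0 0 0
  have r_ht := r12 0 0 0 1
  have r_th := r12 0 1 0 0
  have r_tt := r12 0 1 0 1
  have r_ts := r12 0 1 0 2
  simp only [M1h, M1e, M1g, M2h, M2e, M2g] at r_hh r_ht r_th r_tt r_ts
  exact commutator_eq_of_rtt d d13 d23 reg13 reg23 k k13 k23 h1 h2 e1 e2 g1 g2 f et h1' h2'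
    i1 i2 r_hh r_ht
    r_th r_tt r_ts hf1 hf2 m1 m2 tet kf ket kh kt ks yb b1 b2 hb1 hb2

end SerreRTT

/-! ### The Serre relation in an abstract ring -/

section Setup

variable {𝕜 R κ : Type*} [CommRing 𝕜] [Ring R] [Algebra 𝕜 R]

theorem LegSwap.commutator {P Q f : R} {e1 e2 : κ → ℤ → R} (h : LegSwap P Q e1 e2)
    (hP : P * f = f * P) (hQ : Q * f = f * Q) :
    LegSwap P Q (fun p ε => e1 p ε * f - f * e1 p ε) (fun p ε => e2 p ε * f - f * e2 p ε) where
  P_one p ε := by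
    simp only [mul_sub, sub_mul, mul_assoc, h.P_one, mul_mul_of_eq (h.P_one p ε), hP,
      mul_mul_of_eq hP]
  P_two p ε := by
    simp only [mul_sub, sub_mul, mul_assoc, h.P_two, mul_mul_of_eq (h.P_two p ε), hP,
      mul_mul_of_eq hP]
  Q_one p ε := by
    simp only [mul_sub, sub_mul, mul_assoc, h.Q_one, mul_mul_of_eq (h.Q_one p ε), hQ,
      mul_mul_of_eq hQ]
  Q_two p ε := by
    simp only [mul_sub, sub_mul, mul_assoc, h.Q_two, mul_mul_of_eq (h.Q_two p ε), hQ,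
      mul_mul_of_eq hQ]

/-- The properties of the tensors `P`, `Q` and of the variables `X p` and `z` that enter the proof
of the Serre relation. The subring `S p` plays the role of the series that involve `X p` and `z` but
no other variable. -/
structure TensorSetup (X : κ → 𝕜) (z : 𝕜) (P12 Q12 P13 Q13 P23 Q23 : R) (S : κ → Subring R) where
  pq : IsPQPair P12 Q12
  yb : IsYBTriple P12 Q12 P13 Q13 P23 Q23
  reg_two : ∀ r : R, (2 : ℤ) • r = 0 → r = 0
  reg_var : ∀ p, ∀ r : R, X p • r = 0 → r = 0
  reg_sub : ∀ p q, p ≠ q → ∀ r : R, (X q ^ 2 - X p ^ 2) • r = 0 → r = 0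
  reg_sub_last : ∀ p, ∀ r : R, (z ^ 2 - X p ^ 2) • r = 0 → r = 0
  sep : ∀ p, ∀ r : R, (∀ n : ℕ, ∃ r', r = X p ^ n • r') → r = 0
  coeffMaps : ∀ p q, p ≠ q → CoeffMaps (X p) (X q) P12 Q12 (S p)
  P_mem : ∀ p, P12 ∈ S p
  Q_mem : ∀ p, Q12 ∈ S p
  smul_mem : ∀ p, ∀ r ∈ S p, X p • r ∈ S p

/-- Three copies of a `3 × 3` matrix with the RTT relation, in three tensor factors and with various
values of the variable, together with the series that occur in the Serre relation: `e1 p ε` and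
`e2 p ε` stand for `e^1(ε u_p)` and `e^2(ε u_p)`, where `e` is the entry `(0, 1)` of the upper
triangular Gauss factor, and `f` is the entry `(1, 2)` of that factor, in the third tensor factor.
The latter is read off from the inverse `M3'` of `M3`. -/
structure CurrentSetup (X : κ → 𝕜) (z : 𝕜) (P12 Q12 P13 Q13 P23 Q23 : R) (S : κ → Subring R)
    (M1 M2 : κ → Matrix (Fin 3) (Fin 3) R) (M3 M3' : Matrix (Fin 3) (Fin 3) R)
    (e1 e2 : κ → ℤ → R) (f : R) where
  rtt12 : ∀ p q, p ≠ q →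
    RTT (X q ^ 2 - X p ^ 2) (kMat (X p) (X q) P12 Q12) (M1 p) (M2 q)
  rtt13 : ∀ p, RTT (z ^ 2 - X p ^ 2) (kMat (X p) z P13 Q13) (M1 p) M3
  rtt23 : ∀ p, RTT (z ^ 2 - X p ^ 2) (kMat (X p) z P23 Q23) (M2 p) M3
  mul_inv : M3 * M3' = 1
  inv_mul : M3' * M3 = 1
  h1_unit : ∀ p, IsUnit (M1 p 0 0)
  h2_unit : ∀ p, IsUnit (M2 p 0 0)
  e1_eq : ∀ p, M1 p 0 1 = M1 p 0 0 * e1 p 1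
  e2_eq : ∀ p, M2 p 0 1 = M2 p 0 0 * e2 p 1
  q_unit : IsUnit (M3' 2 2)
  f_eq : M3' 1 2 = -(f * M3' 2 2)
  swap : LegSwap P12 Q12 e1 e2
  P_comm : ∀ i, P12 * M3' i 2 = M3' i 2 * P12
  Q_comm : ∀ i, Q12 * M3' i 2 = M3' i 2 * Q12
  P23_comm : ∀ p j, P23 * M1 p 0 j = M1 p 0 j * P23
  Q23_comm : ∀ p j, Q23 * M1 p 0 j = M1 p 0 j * Q23
  e1_mem : ∀ p ε, e1 p ε ∈ S p
  e2_mem : ∀ p ε, e2 p ε ∈ S p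
  f_mem : ∀ p, f ∈ S p

theorem commute_kMat {x y : 𝕜} {P Q r : R} (hP : P * r = r * P) (hQ : Q * r = r * Q) :
    kMat x y P Q * r = r * kMat x y P Q := by
  simp only [kMat, smul_mul_assoc, mul_smul_comm, add_mul, mul_add, hP, hQ]

/-- The Serre relation in an abstract ring. -/
theorem serre_of_setup {X : κ → 𝕜} {z : 𝕜} {P12 Q12 P13 Q13 P23 Q23 : R} {S : κ → Subring R}
    {M1 M2 : κ → Matrix (Fin 3) (Fin 3) R} {M3 M3' : Matrix (Fin 3) (Fin 3) R}
    {e1 e2 : κ → ℤ → R} {f : R} (ts : TensorSetup X z P12 Q12 P13 Q13 P23 Q23 S)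
    (cs : CurrentSetup X z P12 Q12 P13 Q13 P23 Q23 S M1 M2 M3 M3' e1 e2 f) {u v : κ}
    (huv : u ≠ v) :
    (X u + X v) • (P12 * ⁅e1 u 1 - e1 v 1, ⁅e2 u 1 - e2 v 1, f⁆⁆)
      + (X v - X u) • (Q12 * ⁅e1 u 1 - e1 v (-1), ⁅e2 u (-1) - e2 v 1, f⁆⁆) = 0 := by
  obtain ⟨⟨q, q', hqq', hq'q⟩, hq⟩ := cs.q_unit
  dsimp only at hq
  subst hq
  -- elements commuting with `M3' 2 2` and with `M3' i 2 = r * M3' 2 2` commute with `r`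
  have canc : ∀ a r : R, a * M3' 2 2 = M3' 2 2 * a → a * (r * M3' 2 2) = r * M3' 2 2 * a →
      a * r = r * a := fun a r h0 h1 => by
    have := congrArg (· * q') h1
    simp only [mul_assoc, hqq', mul_one] at this
    rw [this, ← mul_assoc (M3' 2 2), ← h0, mul_assoc a, hqq', mul_one]
  have hPf : P12 * f = f * P12 := canc _ _ (cs.P_comm 2) (by
    have := cs.P_comm 1
    rw [cs.f_eq] at this
    simpa using this)
  have hQf : Q12 * f = f * Q12 := canc _ _ (cs.Q_comm 2) (by
    have := cs.Q_comm 1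
    rw [cs.f_eq] at this
    simpa using this)
  set et : R := M3' 0 2 * q' with het
  have het' : M3' 0 2 = et * M3' 2 2 := by rw [het, mul_assoc, hq'q, mul_one]
  have hPt : P12 * et = et * P12 := canc _ _ (cs.P_comm 2) (by rw [← het', cs.P_comm 0])
  have hQt : Q12 * et = et * Q12 := canc _ _ (cs.Q_comm 2) (by rw [← het', cs.Q_comm 0])
  choose U1 hU1 using cs.h1_unit
  choose U2 hU2 using cs.h2_unit
  have canc1 : ∀ a p r, a * M1 p 0 0 = M1 p 0 0 * a →
      a * (M1 p 0 0 * r) = M1 p 0 0 * r * a → a * r = r * a := by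
    intro a p r h0 h1
    rw [← mul_assoc, h0, ← hU1 p, mul_assoc, mul_assoc] at h1
    exact (U1 p).mul_right_inj.1 h1
  have hg1 : ∀ p, M1 p 0 2 = M1 p 0 0 * (↑(U1 p)⁻¹ * M1 p 0 2) := fun p => by
    rw [← hU1 p, Units.mul_inv_cancel_left]
  have hg2 : ∀ p, M2 p 0 2 = M2 p 0 0 * (↑(U2 p)⁻¹ * M2 p 0 2) := fun p => by
    rw [← hU2 p, Units.mul_inv_cancel_left]
  set b1 : κ → ℤ → R := fun p ε => e1 p ε * f - f * e1 p ε with hb1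
  set b2 : κ → ℤ → R := fun p ε => e2 p ε * f - f * e2 p ε with hb2
  have hb : LegSwap P12 Q12 b1 b2 := cs.swap.commutator hPf hQf
  -- the formula for `[e^1(p), b^2(q)]` and the relations for the single variable `p`
  have key : ∀ p q, p ≠ q →
      let N := (X p * X q) • ((X p + X q) • (P12 * ((e1 p 1 - e1 q 1) * (b2 p 1 - b2 q 1)))
        + (X q - X p) • (Q12 * ((e1 p 1 - e1 q (-1)) * (b2 p (-1) - b2 q 1))))
      let B := P12 * (e1 p 1 * b2 p 1 - b2 p 1 * e1 p 1)
        - Q12 * (e1 p 1 * b2 p (-1) - b2 p (-1) * e1 p 1)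
      let C := P12 * (e1 p 1 * b2 p 1 - b2 p 1 * e1 p 1)
        + Q12 * (e1 p 1 * b2 p (-1) - b2 p (-1) * e1 p 1)
        + X p • (P12 * Q12 * ((e1 p 1 - e1 p (-1)) * (b2 p 1 - b2 p (-1))))
      (X q ^ 2 - X p ^ 2) • (e1 p 1 * b2 q 1 - b2 q 1 * e1 p 1) - N = 0 ∧ B = 0 ∧ C = 0 := by
    intro p q hpq N B C
    have s1 := commutator_eq_of_rtt_matrices (ts.reg_sub_last p) (ts.reg_sub_last q)
      (cs.rtt12 p q hpq)
      (cs.rtt13 p) (cs.rtt23 q) cs.mul_inv cs.inv_mul (M1 p 0 0) (M2 q 0 0) (e1 p 1) (e2 q 1)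
      (↑(U1 p)⁻¹ * M1 p 0 2) (↑(U2 q)⁻¹ * M2 q 0 2) f et (M3' 2 2) q' ↑(U1 p)⁻¹ ↑(U2 q)⁻¹ hqq'
      (by rw [← hU1 p, Units.inv_mul]) (by rw [← hU2 q, Units.inv_mul]) rfl (cs.e1_eq p) (hg1 p)
      rfl (cs.e2_eq q) (hg2 q) rfl cs.f_eq het' (commute_kMat hPf hQf) (commute_kMat hPt hQt)
      (commute_kMat (cs.P23_comm p 0) (cs.Q23_comm p 0))
      (commute_kMat (canc1 _ p _ (cs.P23_comm p 0) (by rw [← cs.e1_eq p, cs.P23_comm p 1]))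
        (canc1 _ p _ (cs.Q23_comm p 0) (by rw [← cs.e1_eq p, cs.Q23_comm p 1])))
      (commute_kMat (canc1 _ p _ (cs.P23_comm p 0) (by rw [← hg1 p, cs.P23_comm p 2]))
        (canc1 _ p _ (cs.Q23_comm p 0) (by rw [← hg1 p, cs.Q23_comm p 2])))
      (ts.yb.kMat (X p) (X q) z) (b1 p 1) (b2 q 1) rfl rfl
    have fe := commutator_functional_eq p q (X p) (X q) P12 Q12 e1 e2 b1 b2 ts.pq cs.swap hb
      _ rfl _ rfl s1
      _ _ _ N B C _ rfl rfl rfl rfl rfl rfl rfl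
    have mb : ∀ ε, b2 p ε ∈ S p := fun ε => sub_mem (mul_mem (cs.e2_mem p ε) (cs.f_mem p))
      (mul_mem (cs.f_mem p) (cs.e2_mem p ε))
    have m1 := fun ε => cs.e1_mem p ε
    have mP := ts.P_mem p
    have mQ := ts.Q_mem p
    have ma : ∀ ε, e1 p 1 * b2 p ε - b2 p ε * e1 p 1 ∈ S p := fun ε =>
      sub_mem (mul_mem (m1 1) (mb ε)) (mul_mem (mb ε) (m1 1))
    refine eq_zero_of_functional_eq (X p) (X q) P12 Q12 ts.pq (ts.reg_var p) ts.reg_two (ts.sep p)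
      (ts.coeffMaps p q hpq) B C _ ?_ ?_ _ rfl _ rfl fe
    · exact sub_mem (mul_mem mP (ma _)) (mul_mem mQ (ma _))
    · exact add_mem (add_mem (mul_mem mP (ma _)) (mul_mem mQ (ma _)))
        (ts.smul_mem p _ (mul_mem (mul_mem mP mQ)
          (mul_mem (sub_mem (m1 _) (m1 _)) (sub_mem (mb _) (mb _)))))
  obtain ⟨k1, k2, k3⟩ := key u v huv
  obtain ⟨k4, k5, k6⟩ := key v u huv.symm
  have fin := serre_of_commutators u v (X u) (X v) P12 Q12 e1 e2 b1 b2 ts.pq cs.swap hb _ rfl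
    ts.reg_two (ts.reg_sub u v huv) k1 (by rw [neg_sub]; exact k4) k2 k3 k5 k6
  rw [← fin]
  simp only [hb2, Ring.lie_def]
  congr 3 <;> noncomm_ring

end Setup

/-! ### Superrings and block matrices -/

/-- A homomorphism of superrings: a ring homomorphism that preserves parities. -/
structure SuperHom (A B : Type*) [Ring A] [Ring B] [SuperRing A] [SuperRing B] extends
    A →+* B where
  map_par : ∀ a, toFun (par a) = par (toFun a)

namespace SuperHom
variable {A B C : Type*} [Ring A] [Ring B] [Ring C] [SuperRing A] [SuperRing B] [SuperRing C]

instance : FunLike (SuperHom A B) A B where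
  coe φ := φ.toFun
  coe_injective φ ψ h := by
    cases φ; cases ψ; congr; exact RingHom.ext (congrFun h)

instance : RingHomClass (SuperHom A B) A B where
  map_mul φ := φ.map_mul'
  map_one φ := φ.map_one'
  map_add φ := φ.map_add'
  map_zero φ := φ.map_zero'

theorem apply_par (φ : SuperHom A B) (a : A) : φ (par a) = par (φ a) := φ.map_par a

theorem apply_twist (φ : SuperHom A B) (x : ZMod 2) (a : A) : φ (twist x a) = twist x (φ a) := by
  unfold twist; split_ifs <;> simp [apply_par]

/-- Composition of homomorphisms of superrings. -/
def comp (ψ : SuperHom B C) (φ : SuperHom A B) : SuperHom A C where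
  toRingHom := ψ.toRingHom.comp φ.toRingHom
  map_par a := by
    change ψ (φ (par a)) = par (ψ (φ a))
    rw [apply_par, apply_par]

@[simp] theorem comp_apply (ψ : SuperHom B C) (φ : SuperHom A B) (a : A) : ψ.comp φ a = ψ (φ a) :=
  rfl

/-- Functoriality of `End(ℂ^{n|n}) ⊗ -`. -/
def sEnd (n : ℕ) (φ : SuperHom A B) : SuperHom (SEnd n A) (SEnd n B) where
  toFun := SEnd.map φ
  map_one' := by
    ext i j; simp only [SEnd.map, SEnd.one_apply]; split_ifs <;> simp
  map_mul' X Y := by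
    ext i j
    simp only [SEnd.map, SEnd.mul_apply, map_sum, map_mul, apply_twist]
  map_zero' := by ext i j; simp [SEnd.map, SEnd.zero_apply]
  map_add' X Y := by ext i j; simp [SEnd.map, SEnd.add_apply]
  map_par X := by
    ext i j
    simp only [SEnd.map, SEnd.par_apply, map_zsmul, apply_par]

theorem sEnd_apply (n : ℕ) (φ : SuperHom A B) (X : SEnd n A) (i j : Idx n) :
    φ.sEnd n X i j = φ (X i j) := rfl

/-- The inclusion `a ↦ 1 ⊗ a`. -/
def emb (n : ℕ) : SuperHom A (SEnd n A) where
  toFun := SEnd.emb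
  map_one' := by ext i j; simp [SEnd.emb, SEnd.one_apply]
  map_mul' a b := by
    ext i j
    rw [SEnd.mul_apply, Finset.sum_eq_single j]
    · have h : j.2 + j.2 = 0 := CharTwo.add_self_eq_zero j.2
      by_cases hij : i = j <;> simp [SEnd.emb, hij, h, twist_zero]
    · intro k _ hk
      simp [SEnd.emb, hk]
    · simp
  map_zero' := by ext i j; simp [SEnd.emb, SEnd.zero_apply]
  map_add' a b := by
    ext i j
    by_cases hij : i = j <;> simp [SEnd.emb, SEnd.add_apply, hij]
  map_par a := (SEnd.par_emb a).symm

theorem emb_apply (n : ℕ) (a : A) : emb n a = (SEnd.emb a : SEnd n A) := rfl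

end SuperHom

namespace SEnd
variable {n : ℕ} {A B : Type*} [Ring A] [SuperRing A] [Ring B] [SuperRing B]

theorem sum_apply {κ : Type*} (s : Finset κ) (f : κ → SEnd n A) (i j : Idx n) :
    (∑ k ∈ s, f k) i j = ∑ k ∈ s, f k i j := by
  classical
  induction s using Finset.induction_on with
  | empty => rfl
  | insert a s ha ih => rw [Finset.sum_insert ha, Finset.sum_insert ha, add_apply, ih]

theorem emb_mul_apply (a : A) (X : SEnd n A) (i j : Idx n) :
    ((emb a : SEnd n A) * X) i j = twist (i.2 + j.2) a * X i j := by
  rw [mul_apply, Finset.sum_eq_single i]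
  · simp [emb]
  · intro k _ hk; simp [emb, hk.symm, twist_of_zero]
  · simp

theorem mul_emb_apply (a : A) (X : SEnd n A) (i j : Idx n) :
    (X * (emb a : SEnd n A)) i j = X i j * a := by
  rw [mul_apply, Finset.sum_eq_single j]
  · have h : j.2 + j.2 = 0 := CharTwo.add_self_eq_zero j.2
    simp [emb, h, twist_zero]
  · intro k _ hk; simp [emb, hk]
  · simp

theorem emb_commute {a : A} {X : SEnd n A} (ha : par a = a) (h : ∀ i j, a * X i j = X i j * a) :
    (emb a : SEnd n A) * X = X * emb a := by
  ext i j
  have : ∀ x, twist x a = a := fun x => by unfold twist; split_ifs <;> simp [ha]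
  rw [emb_mul_apply, mul_emb_apply, this, h]

theorem block_apply {A : Type*} (X : SEnd n A) (a b : Fin n) (i j : Idx 1) :
    X.block a b i j = X (a, i.2) (b, j.2) := rfl

theorem block_mul (X Y : SEnd n A) (a b : Fin n) :
    (X * Y).block a b = ∑ c, X.block a c * Y.block c b := by
  ext i j
  rw [sum_apply, block_apply, mul_apply, Fintype.sum_prod_type]
  refine Finset.sum_congr rfl fun c _ => ?_
  rw [mul_apply, Fintype.sum_prod_type, Fin.sum_univ_one]
  rfl

/-- `End(ℂ^{n|n}) ⊗ A` as the ring of `n × n` matrices of `2 × 2` blocks. -/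
def blockEquiv (n : ℕ) (A : Type*) [Ring A] [SuperRing A] :
    SEnd n A ≃+* Matrix (Fin n) (Fin n) (SEnd 1 A) where
  toFun X := Matrix.of fun a b => X.block a b
  invFun M := fun i j => M i.1 j.1 (0, i.2) (0, j.2)
  left_inv X := rfl
  right_inv M := by
    ext a b i j
    obtain ⟨i1, i2⟩ := i
    obtain ⟨j1, j2⟩ := j
    rw [Subsingleton.elim i1 0, Subsingleton.elim j1 0]
    rfl
  map_mul' X Y := by
    refine Matrix.ext fun a b => ?_
    rw [Matrix.mul_apply]
    exact block_mul X Y a b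
  map_add' X Y := rfl

theorem blockEquiv_apply (X : SEnd n A) (a b : Fin n) : blockEquiv n A X a b = X.block a b := rfl

end SEnd

namespace SEnd
variable {n : ℕ} {B : Type*} [Ring B] [SuperRing B]

/-- The component of a tensor in `End(ℂ^{n|n}) ⊗ (End(ℂ^{n|n}) ⊗ B)` with given blocks in both
factors. -/
def blocks {B : Type*} (X : SEnd n (SEnd n B)) (a b c d : Fin n) : SEnd 1 (SEnd 1 B) :=
  (X.block a b).map fun Y => Y.block c d

theorem blocks_apply {B : Type*} (X : SEnd n (SEnd n B)) (a b c d : Fin n) (i j k l : Idx 1) :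
    X.blocks a b c d i j k l = X (a, i.2) (b, j.2) (c, k.2) (d, l.2) := rfl

theorem block_twist (x : ZMod 2) (X : SEnd n B) (a b : Fin n) :
    (twist x X).block a b = twist x (X.block a b) := by
  unfold twist; split_ifs <;> rfl

theorem block_sum {κ : Type*} (s : Finset κ) (f : κ → SEnd n B) (a b : Fin n) :
    (∑ k ∈ s, f k).block a b = ∑ k ∈ s, (f k).block a b := by
  ext i j; simp [block_apply, sum_apply]

theorem blocks_mul (X Y : SEnd n (SEnd n B)) (a b c d : Fin n) :
    (X * Y).blocks a b c d = ∑ p, ∑ q, X.blocks a p c q * Y.blocks p b q d := by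
  unfold blocks
  rw [block_mul]
  refine SEnd.ext fun i l => ?_
  rw [sum_apply]
  change (((∑ p, X.block a p * Y.block p b) : SEnd 1 (SEnd n B)) i l).block c d = _
  rw [sum_apply, block_sum]
  refine Finset.sum_congr rfl fun p _ => ?_
  rw [sum_apply, mul_apply, block_sum]
  simp only [mul_apply (A := SEnd 1 B)]
  rw [Finset.sum_comm]
  refine Finset.sum_congr rfl fun j _ => ?_
  rw [block_mul]
  refine Finset.sum_congr rfl fun q _ => ?_
  rw [block_twist]
  rfl

theorem blocks_sub (X Y : SEnd n (SEnd n B)) (a b c d : Fin n) :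
    (X - Y).blocks a b c d = X.blocks a b c d - Y.blocks a b c d := rfl

theorem blocks_map_emb (X : SEnd n B) (a b c d : Fin n) :
    (X.map (emb : B → SEnd n B)).blocks a b c d
      = if c = d then ((X.block a b).map emb : SEnd 1 (SEnd 1 B)) else 0 := by
  ext i j k l
  rw [blocks_apply]
  obtain ⟨k1, k2⟩ := k
  obtain ⟨l1, l2⟩ := l
  rw [Subsingleton.elim k1 0, Subsingleton.elim l1 0]
  by_cases h : c = d <;> simp [h, map, emb, block_apply, zero_apply]

theorem blocks_emb (X : SEnd n B) (a b c d : Fin n) :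
    (emb X : SEnd n (SEnd n B)).blocks a b c d
      = if a = b then (emb (X.block c d) : SEnd 1 (SEnd 1 B)) else 0 := by
  ext i j k l
  rw [blocks_apply]
  obtain ⟨k1, k2⟩ := i
  obtain ⟨l1, l2⟩ := j
  rw [Subsingleton.elim k1 0, Subsingleton.elim l1 0]
  by_cases h : a = b
  · by_cases h' : k2 = l2 <;> simp [h, h', emb, block_apply, zero_apply]
  · simp [h, emb, zero_apply]

theorem block_emb (c : B) (a b : Fin n) :
    (emb c : SEnd n B).block a b = if a = b then emb c else 0 := by
  ext i j
  rw [block_apply]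
  obtain ⟨k1, k2⟩ := i
  obtain ⟨l1, l2⟩ := j
  rw [Subsingleton.elim k1 0, Subsingleton.elim l1 0]
  by_cases h : a = b
  · by_cases h' : k2 = l2 <;> simp [h, h', emb, zero_apply]
  · simp [h, emb, zero_apply]

theorem blocks_emb_emb (e : B) (a b c d : Fin n) :
    (emb (emb e) : SEnd n (SEnd n B)).blocks a b c d
      = if a = b ∧ c = d then (emb (emb e) : SEnd 1 (SEnd 1 B)) else 0 := by
  rw [blocks_emb, block_emb]
  by_cases h : a = b <;> by_cases h' : c = d <;> simp [h, h']
  exact map_zero (SuperHom.emb (A := SEnd 1 B) 1)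

theorem blocks_P (a b c d : Fin n) :
    (P n B).blocks a b c d = if c = b ∧ d = a then P 1 B else 0 := by
  ext i j k l
  rw [blocks_apply]
  obtain ⟨i1, i2⟩ := i
  obtain ⟨j1, j2⟩ := j
  obtain ⟨k1, k2⟩ := k
  obtain ⟨l1, l2⟩ := l
  rw [Subsingleton.elim k1 0, Subsingleton.elim l1 0, Subsingleton.elim i1 0,
    Subsingleton.elim j1 0]
  by_cases h : c = b <;> by_cases h' : d = a <;> simp [h, h', P, zero_apply]

theorem blocks_Q (a b c d : Fin n) :
    (Q n B).blocks a b c d = if c = b ∧ d = a then Q 1 B else 0 := by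
  ext i j k l
  rw [blocks_apply]
  obtain ⟨i1, i2⟩ := i
  obtain ⟨j1, j2⟩ := j
  obtain ⟨k1, k2⟩ := k
  obtain ⟨l1, l2⟩ := l
  rw [Subsingleton.elim k1 0, Subsingleton.elim l1 0, Subsingleton.elim i1 0,
    Subsingleton.elim j1 0]
  by_cases h : c = b <;> by_cases h' : d = a <;> simp [h, h', Q, Idx.opp, zero_apply]

theorem blocks_emb_emb_mul (e : B) (X : SEnd n (SEnd n B)) (a b c d : Fin n) :
    ((emb (emb e) : SEnd n (SEnd n B)) * X).blocks a b c d
      = (emb (emb e) : SEnd 1 (SEnd 1 B)) * X.blocks a b c d := by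
  rw [blocks_mul, Finset.sum_eq_single a, Finset.sum_eq_single c]
  · simp [blocks_emb_emb]
  · intro q _ hq; simp [blocks_emb_emb, hq.symm]
  · simp
  · intro q _ hq; simp [blocks_emb_emb, hq.symm]
  · simp

/-- The RTT relation between matrices, in terms of their blocks. -/
theorem rtt_blocks (δ γ γ' : B) (X Y : SEnd n B)
    (h : ((emb (emb δ) : SEnd n (SEnd n B)) - emb (emb γ) * P n B - emb (emb γ') * Q n B)
        * X.map emb * emb Y
      = emb Y * X.map emb * ((emb (emb δ) : SEnd n (SEnd n B)) - emb (emb γ) * P n B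
        - emb (emb γ') * Q n B)) (a b c e : Fin n) :
    let k : SEnd 1 (SEnd 1 B) := emb (emb γ) * P 1 B + emb (emb γ') * Q 1 B
    (emb (emb δ) : SEnd 1 (SEnd 1 B)) * ((X.block a b).map emb * emb (Y.block c e))
        - k * ((X.block c b).map emb * emb (Y.block a e))
      = emb (Y.block c e) * (X.block a b).map emb * (emb (emb δ) : SEnd 1 (SEnd 1 B))
        - emb (Y.block c b) * (X.block a e).map emb * k := by
  intro k
  have hk : ∀ a b c e, ((emb (emb δ) : SEnd n (SEnd n B)) - emb (emb γ) * P n B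
      - emb (emb γ') * Q n B).blocks a b c e
      = (if a = b ∧ c = e then (emb (emb δ) : SEnd 1 (SEnd 1 B)) else 0)
        - if c = b ∧ e = a then k else 0 := by
    intro a b c e
    rw [blocks_sub, blocks_sub, blocks_emb_emb_mul, blocks_emb_emb_mul, blocks_emb_emb, blocks_P,
      blocks_Q]
    split_ifs <;> simp [k] <;> abel
  have hXY : ∀ a b c e, (X.map emb * (emb Y : SEnd n (SEnd n B))).blocks a b c e
      = (X.block a b).map emb * (emb (Y.block c e) : SEnd 1 (SEnd 1 B)) := by
    intro a b c e
    rw [blocks_mul, Finset.sum_eq_single b, Finset.sum_eq_single c]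
    · simp [blocks_map_emb, blocks_emb]
    · intro q _ hq; simp [blocks_map_emb, hq.symm]
    · simp
    · intro q _ hq; simp [blocks_emb, hq]
    · simp
  have hYX : ∀ a b c e, ((emb Y : SEnd n (SEnd n B)) * X.map emb).blocks a b c e
      = (emb (Y.block c e) : SEnd 1 (SEnd 1 B)) * (X.block a b).map emb := by
    intro a b c e
    rw [blocks_mul, Finset.sum_eq_single a, Finset.sum_eq_single e]
    · simp [blocks_map_emb, blocks_emb]
    · intro q _ hq; simp [blocks_map_emb, hq]
    · simp
    · intro q _ hq; simp [blocks_emb, hq.symm]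
    · simp
  have := congrArg (fun Z => SEnd.blocks Z a b c e) h
  beta_reduce at this
  rw [mul_assoc, blocks_mul _ (X.map emb * (emb Y : SEnd n (SEnd n B))),
    blocks_mul ((emb Y : SEnd n (SEnd n B)) * X.map emb)] at this
  simp only [hk, hXY, hYX, sub_mul, mul_sub, ite_mul,
    mul_ite, zero_mul, mul_zero, Finset.sum_sub_distrib, ite_and, Finset.sum_ite_eq,
    Finset.sum_ite_eq', Finset.mem_univ, if_true] at this
  simpa using this

end SEnd

/-! ### Homomorphisms of power series rings -/

section SeriesHoms
variable {A : Type*} [Ring A] [SuperRing A]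

theorem par_mvPowerSeries_apply {σ : Type*} (f : MvPowerSeries σ A) (m : σ →₀ ℕ) :
    (par f : MvPowerSeries σ A) m = par (f m) := rfl

theorem mvPowerSeries_mul_apply {A σ : Type*} [Ring A] [DecidableEq σ]
    (f g : MvPowerSeries σ A) (m : σ →₀ ℕ) :
    (f * g) m = ∑ p ∈ Finset.HasAntidiagonal.antidiagonal m, f p.1 * g p.2 :=
  MvPowerSeries.coeff_mul m f g

theorem atVar_single {A : Type*} [Ring A] {d : ℕ} (k : Fin d) (ε : ℤ) (f : PowerSeries A) (r : ℕ) :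
    atVar k ε f (Finsupp.single k r) = ε ^ r • PowerSeries.coeff r f := by
  simp [atVar]

theorem atVar_of_ne {A : Type*} [Ring A] {d : ℕ} {k : Fin d} (ε : ℤ) (f : PowerSeries A)
    {m : Fin d →₀ ℕ}
    (h : m ≠ Finsupp.single k (m k)) : atVar k ε f m = 0 := if_neg h

/-- The substitution `f ↦ f(ε u_k)` as a homomorphism. -/
def atVarHom {d : ℕ} (k : Fin d) (ε : ℤ) : SuperHom (PowerSeries A) (MvPowerSeries (Fin d) A) where
  toFun := atVar k ε
  map_zero' := by funext m; simp [atVar]; rfl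
  map_add' f g := by
    funext m
    change _ = atVar k ε f m + atVar k ε g m
    unfold atVar
    split_ifs <;> simp
  map_one' := by
    funext m
    change _ = MvPowerSeries.coeff m 1
    rw [MvPowerSeries.coeff_one]
    by_cases h : m = Finsupp.single k (m k)
    · generalize m k = r at h
      subst h
      rw [atVar_single, PowerSeries.coeff_one]
      by_cases hr : r = 0 <;> simp [hr]
    · rw [atVar_of_ne _ _ h, if_neg]
      rintro rfl
      simp at h
  map_mul' f g := by
    funext m
    rw [mvPowerSeries_mul_apply]
    by_cases h : m = Finsupp.single k (m k)
    · generalize m k = r at h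
      subst h
      rw [atVar_single, PowerSeries.coeff_mul, Finsupp.antidiagonal_single, Finset.sum_map,
        Finset.smul_sum]
      refine Finset.sum_congr rfl fun p hp => ?_
      rw [Finset.HasAntidiagonal.mem_antidiagonal] at hp
      change _ = atVar k ε f (Finsupp.single k p.1) * atVar k ε g (Finsupp.single k p.2)
      rw [atVar_single, atVar_single, smul_mul_smul_comm, ← pow_add, hp]
    · rw [atVar_of_ne _ _ h, eq_comm]
      refine Finset.sum_eq_zero fun p hp => ?_
      rw [Finset.HasAntidiagonal.mem_antidiagonal] at hp
      by_cases h1 : p.1 = Finsupp.single k (p.1 k)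
      · by_cases h2 : p.2 = Finsupp.single k (p.2 k)
        · exfalso
          apply h
          rw [← hp, Finsupp.add_apply, Finsupp.single_add, ← h1, ← h2]
        · rw [atVar_of_ne _ _ h2, mul_zero]
      · rw [atVar_of_ne _ _ h1, zero_mul]
  map_par f := by
    funext m
    change atVar k ε (par f) m = par (atVar k ε f m)
    unfold atVar
    split_ifs
    · rw [map_zsmul]; rfl
    · rw [map_zero]

/-- The power series obtained from `f` by renaming its variables along an embedding. -/
def renameSeries {A σ τ : Type*} [Zero A] (e : σ ↪ τ) (f : MvPowerSeries σ A) :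
    MvPowerSeries τ A :=
  fun m => Function.extend (Finsupp.embDomain e) (fun a => f a) (fun _ => 0) m

theorem renameSeries_embDomain {A σ τ : Type*} [Zero A] (e : σ ↪ τ)
    (f : MvPowerSeries σ A) (m : σ →₀ ℕ) : renameSeries e f (Finsupp.embDomain e m) = f m :=
  (Finsupp.embDomain_injective e).extend_apply _ _ _

theorem renameSeries_of_notMem {A σ τ : Type*} [Zero A] (e : σ ↪ τ)
    (f : MvPowerSeries σ A) {m : τ →₀ ℕ} (h : ¬ ∃ a, Finsupp.embDomain e a = m) :
    renameSeries e f m = 0 :=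
  Function.extend_apply' _ _ _ h

/-- Renaming of the variables of power series along an embedding, as a homomorphism. -/
def renameHom {σ τ : Type*} [DecidableEq σ] [DecidableEq τ] (e : σ ↪ τ) :
    SuperHom (MvPowerSeries σ A) (MvPowerSeries τ A) where
  toFun := renameSeries e
  map_zero' := by
    funext m
    by_cases h : ∃ a, Finsupp.embDomain e a = m
    · obtain ⟨a, rfl⟩ := h
      exact renameSeries_embDomain e _ a
    · exact renameSeries_of_notMem e _ h
  map_add' f g := by
    funext m
    change _ = renameSeries e f m + renameSeries e g m
    by_cases h : ∃ a, Finsupp.embDomain e a = m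
    · obtain ⟨a, rfl⟩ := h
      simp only [renameSeries_embDomain]; rfl
    · simp only [renameSeries_of_notMem e _ h, add_zero]
  map_one' := by
    funext m
    change _ = MvPowerSeries.coeff m 1
    rw [MvPowerSeries.coeff_one]
    by_cases h : ∃ a, Finsupp.embDomain e a = m
    · obtain ⟨a, rfl⟩ := h
      rw [renameSeries_embDomain]
      change MvPowerSeries.coeff a 1 = _
      rw [MvPowerSeries.coeff_one]
      simp
    · rw [renameSeries_of_notMem e _ h, if_neg]
      rintro rfl
      exact h ⟨0, by simp⟩
  map_mul' f g := by
    funext m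
    rw [mvPowerSeries_mul_apply]
    by_cases h : ∃ a, Finsupp.embDomain e a = m
    · obtain ⟨a, rfl⟩ := h
      rw [renameSeries_embDomain, mvPowerSeries_mul_apply,
        ← Finsupp.image_prodMap_embDomain_antidiagonal, Finset.sum_image]
      · simp only [Prod.map, renameSeries_embDomain]
      · exact ((Finsupp.embDomain_injective e).prodMap (Finsupp.embDomain_injective e)).injOn
    · rw [renameSeries_of_notMem e _ h, eq_comm]
      refine Finset.sum_eq_zero fun p hp => ?_
      rw [Finset.HasAntidiagonal.mem_antidiagonal] at hp
      by_cases h1 : ∃ a, Finsupp.embDomain e a = p.1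
      · by_cases h2 : ∃ a, Finsupp.embDomain e a = p.2
        · exfalso
          obtain ⟨a, ha⟩ := h1
          obtain ⟨b, hb⟩ := h2
          exact h ⟨a + b, by rw [← hp, ← ha, ← hb]; exact Finsupp.embDomain_add e a b⟩
        · rw [renameSeries_of_notMem e _ h2, mul_zero]
      · rw [renameSeries_of_notMem e _ h1, zero_mul]
  map_par f := by
    funext m
    rw [par_mvPowerSeries_apply]
    by_cases h : ∃ a, Finsupp.embDomain e a = m
    · obtain ⟨a, rfl⟩ := h
      simp only [renameSeries_embDomain, par_mvPowerSeries_apply]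
    · simp only [renameSeries_of_notMem e _ h, map_zero]

theorem renameHom_apply {σ τ : Type*} [DecidableEq σ] [DecidableEq τ] (e : σ ↪ τ)
    (f : MvPowerSeries σ A) : renameHom e f = renameSeries e f := rfl

theorem renameHom_X {σ τ : Type*} [DecidableEq σ] [DecidableEq τ] (e : σ ↪ τ) (s : σ) :
    renameHom e (MvPowerSeries.X s : MvPowerSeries σ A) = MvPowerSeries.X (e s) := by
  funext m
  rw [renameHom_apply]
  change _ = MvPowerSeries.coeff m (MvPowerSeries.X (e s))
  rw [MvPowerSeries.coeff_X, ← Finsupp.embDomain_single]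
  by_cases h : ∃ a, Finsupp.embDomain e a = m
  · obtain ⟨a, rfl⟩ := h
    rw [renameSeries_embDomain]
    change MvPowerSeries.coeff a (MvPowerSeries.X s) = _
    rw [MvPowerSeries.coeff_X]
    simp only [Finsupp.embDomain_inj]
  · rw [renameSeries_of_notMem e _ h, if_neg]
    rintro rfl
    exact h ⟨_, rfl⟩

theorem renameHom_atVar {d d' : ℕ} (e : Fin d ↪ Fin d') (k : Fin d) (ε : ℤ) (f : PowerSeries A) :
    renameHom e (atVar k ε f) = atVar (e k) ε f := by
  funext m
  rw [renameHom_apply]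
  by_cases h : ∃ a, Finsupp.embDomain e a = m
  · obtain ⟨a, rfl⟩ := h
    rw [renameSeries_embDomain]
    unfold atVar
    simp only [Finsupp.embDomain_apply_self, ← Finsupp.embDomain_single, Finsupp.embDomain_inj]
  · rw [renameSeries_of_notMem e _ h, atVar_of_ne]
    intro hm
    rw [← Finsupp.embDomain_single] at hm
    exact h ⟨_, hm.symm⟩

/-- Coefficientwise application of a homomorphism. -/
def SuperHom.mvPowerSeries {B : Type*} [Ring B] [SuperRing B] (σ : Type*) (φ : SuperHom A B) :
    SuperHom (MvPowerSeries σ A) (MvPowerSeries σ B) where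
  toRingHom := MvPowerSeries.map φ.toRingHom
  map_par f := by
    funext m
    exact φ.apply_par (f m)

theorem SuperHom.mvPowerSeries_apply {B : Type*} [Ring B] [SuperRing B] {σ : Type*}
    (φ : SuperHom A B) (f : MvPowerSeries σ A) (m : σ →₀ ℕ) :
    φ.mvPowerSeries σ f m = φ (f m) := rfl

theorem SuperHom.mvPowerSeries_X {B : Type*} [Ring B] [SuperRing B] {σ : Type*}
    (φ : SuperHom A B) (s : σ) :
    φ.mvPowerSeries σ (MvPowerSeries.X s) = MvPowerSeries.X s := MvPowerSeries.map_X _ s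

theorem SuperHom.mvPowerSeries_atVar {B : Type*} [Ring B] [SuperRing B] {d : ℕ}
    (φ : SuperHom A B) (k : Fin d) (ε : ℤ) (f : PowerSeries A) :
    φ.mvPowerSeries (Fin d) (atVar k ε f) = atVar k ε (φ.mvPowerSeries Unit f) := by
  funext m
  rw [SuperHom.mvPowerSeries_apply]
  unfold atVar
  split_ifs
  · rw [map_zsmul]; rfl
  · exact map_zero φ

end SeriesHoms

/-! ### The defining relations of the queer super-Yangian -/

section YangianRTT

/-- The projection of the free superalgebra onto `Y(q_n)`. -/
def yangianMk (n : ℕ) : SuperHom (FreeGen n) (Yangian n) where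
  toRingHom := (RingQuot.mkAlgHom ℂ (Rel n)).toRingHom
  map_par a := (yangianPar_mk a).symm

theorem yangianMk_tCoeff {n : ℕ} (i j : Idx n) (r : ℕ) :
    yangianMk n (tCoeff (freeT n) i j r) = tCoeff (yangianT n) i j r := by
  cases r with
  | zero => simp only [tCoeff]; split_ifs <;> simp
  | succ r => rfl

theorem yangianMk_tMatrix {n : ℕ} (i j : Idx n) :
    (yangianMk n).mvPowerSeries Unit (tMatrix (freeT n) i j) = genMatrix n i j := by
  refine PowerSeries.ext fun r => ?_
  change yangianMk n (PowerSeries.coeff r (tMatrix (freeT n) i j)) = _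
  simp only [tMatrix, genMatrix, PowerSeries.coeff_mk, yangianMk_tCoeff]

variable {A B : Type*} [Ring A] [Ring B] [SuperRing A] [SuperRing B]

theorem SuperHom.sEnd_emb {n : ℕ} (φ : SuperHom A B) (a : A) :
    φ.sEnd n (SEnd.emb a) = SEnd.emb (φ a) := by
  ext i j
  rw [SuperHom.sEnd_apply]
  by_cases h : i = j <;> simp [SEnd.emb, h]

theorem SuperHom.sEnd_sEnd_P {n : ℕ} (φ : SuperHom A B) :
    (φ.sEnd n).sEnd n (SEnd.P n A) = SEnd.P n B := by
  ext i j k l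
  rw [SuperHom.sEnd_apply, SuperHom.sEnd_apply]
  unfold SEnd.P
  split_ifs <;> simp

theorem SuperHom.sEnd_sEnd_Q {n : ℕ} (φ : SuperHom A B) :
    (φ.sEnd n).sEnd n (SEnd.Q n A) = SEnd.Q n B := by
  ext i j k l
  rw [SuperHom.sEnd_apply, SuperHom.sEnd_apply]
  unfold SEnd.Q
  split_ifs <;> simp

/-- The RTT relation of `Y(q_n)`, for the matrices themselves instead of their coefficients. -/
theorem yangian_rtt (n : ℕ) :
    rMatrix n (Yangian n) * tOne (yangianT n) * tTwo (yangianT n)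
      = tTwo (yangianT n) * tOne (yangianT n) * rMatrix n (Yangian n) := by
  set Φ := (((yangianMk n).mvPowerSeries (Fin 2)).sEnd n).sEnd n with hΦ
  have hR : Φ (rMatrix n (FreeGen n)) = rMatrix n (Yangian n) := by
    simp only [rMatrix, map_sub, map_mul, hΦ, SuperHom.sEnd_emb, SuperHom.sEnd_sEnd_P,
      SuperHom.sEnd_sEnd_Q, map_pow, map_add, SuperHom.mvPowerSeries_X]
  have h1 : Φ (tOne (freeT n)) = tOne (yangianT n) := by
    refine SEnd.ext fun i j => ?_
    rw [hΦ, SuperHom.sEnd_apply]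
    simp only [tOne, SEnd.map, SuperHom.sEnd_emb, SuperHom.mvPowerSeries_atVar, yangianMk_tMatrix]
    rfl
  have h2 : Φ (tTwo (freeT n)) = tTwo (yangianT n) := by
    rw [hΦ, tTwo, SuperHom.sEnd_emb, tTwo]
    congr 1
    ext i j : 2
    rw [SuperHom.sEnd_apply]
    simp only [SEnd.map, SuperHom.mvPowerSeries_atVar, yangianMk_tMatrix]
    rfl
  rw [← hR, ← h1, ← h2, ← map_mul, ← map_mul, ← map_mul, ← map_mul]
  ext i j k l m
  exact RingQuot.mkAlgHom_rel ℂ (Rel.rtt i j k l m)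

/-- The relation `t_{-i,-j}(u) = t_{ij}(-u)` of `Y(q_n)`. -/
theorem yangian_symm {n : ℕ} (i j : Idx n) :
    genMatrix n i.opp j.opp = PowerSeries.mk fun r =>
      (-1 : ℤ) ^ r • PowerSeries.coeff r (genMatrix n i j) := by
  refine PowerSeries.ext fun r => ?_
  have := RingQuot.mkAlgHom_rel ℂ (Rel.symm i j r)
  rw [map_zsmul] at this
  change (-1 : ℤ) ^ r • yangianMk n _ = yangianMk n _ at this
  rw [yangianMk_tCoeff, yangianMk_tCoeff] at this
  simp only [genMatrix, tMatrix, PowerSeries.coeff_mk]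
  exact this.symm

theorem par_genMatrix (n : ℕ) : par (genMatrix n) = genMatrix n := by
  refine SEnd.ext fun i j => PowerSeries.ext fun r => ?_
  rw [SEnd.par_apply]
  change PowerSeries.coeff r
    (sgn (i.2 + j.2) • (par (genMatrix n i j) : PowerSeries (Yangian n))) = _
  have h : PowerSeries.coeff r (par (genMatrix n i j) : PowerSeries (Yangian n)) =
      sgn (i.2 + j.2) • PowerSeries.coeff r (genMatrix n i j) := by
    change par (PowerSeries.coeff r (genMatrix n i j)) = _
    simp only [genMatrix, tMatrix, PowerSeries.coeff_mk]
    rw [← yangianMk_tCoeff, ← SuperHom.apply_par, par_free, freePar_tCoeff, map_zsmul]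
  rw [map_zsmul, h, smul_smul, sgn_mul_self, one_smul]

end YangianRTT

/-! ### Tensor factors and variables -/

section Legs
variable {A : Type*} [Ring A] [SuperRing A]

/-- `X ↦ X^1(ε u_k)` as a homomorphism. -/
def legOneHom (k : Fin 3) (ε : ℤ) : SuperHom (SEnd 1 (PowerSeries A)) (Triple A) :=
  SuperHom.sEnd 1 ((SuperHom.emb 1).comp ((SuperHom.emb 1).comp (atVarHom k ε)))

/-- `X ↦ X^2(ε u_k)` as a homomorphism. -/
def legTwoHom (k : Fin 3) (ε : ℤ) : SuperHom (SEnd 1 (PowerSeries A)) (Triple A) :=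
  (SuperHom.emb 1).comp (SuperHom.sEnd 1 ((SuperHom.emb 1).comp (atVarHom k ε)))

/-- `X ↦ X^3(ε u_k)` as a homomorphism. -/
def legThreeHom (k : Fin 3) (ε : ℤ) : SuperHom (SEnd 1 (PowerSeries A)) (Triple A) :=
  (SuperHom.emb 1).comp ((SuperHom.emb 1).comp (SuperHom.sEnd 1 (atVarHom k ε)))

theorem legOneHom_apply (k : Fin 3) (ε : ℤ) (X : SEnd 1 (PowerSeries A)) :
    legOneHom k ε X = legOne X k ε := rfl

theorem legTwoHom_apply (k : Fin 3) (ε : ℤ) (X : SEnd 1 (PowerSeries A)) :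
    legTwoHom k ε X = legTwo X k ε := rfl

theorem legThreeHom_apply (k : Fin 3) (ε : ℤ) (X : SEnd 1 (PowerSeries A)) :
    legThreeHom k ε X = legThree X k ε := rfl

/-- `P^{13}`. -/
def P13 (A : Type*) [Ring A] [SuperRing A] : Triple A := (SuperHom.emb 1).sEnd 1 (SEnd.P 1 _)

/-- `Q^{13}`. -/
def Q13 (A : Type*) [Ring A] [SuperRing A] : Triple A := (SuperHom.emb 1).sEnd 1 (SEnd.Q 1 _)

/-- `P^{23}`. -/
def P23 (A : Type*) [Ring A] [SuperRing A] : Triple A := SEnd.emb (SEnd.P 1 _)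

/-- `Q^{23}`. -/
def Q23 (A : Type*) [Ring A] [SuperRing A] : Triple A := SEnd.emb (SEnd.Q 1 _)

/-- The map `c ↦ 1 ⊗ 1 ⊗ 1 ⊗ c` as a homomorphism. -/
def scalarHom : SuperHom (MvPowerSeries (Fin 3) A) (Triple A) :=
  (SuperHom.emb 1).comp ((SuperHom.emb 1).comp (SuperHom.emb 1))

theorem scalarHom_apply (c : MvPowerSeries (Fin 3) A) : scalarHom c = scalar c := rfl

theorem scalar_commute {c : MvPowerSeries (Fin 3) A} (hp : par c = c) (hc : ∀ f, c * f = f * c)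
    (G : Triple A) : scalar c * G = G * scalar c := by
  refine SEnd.emb_commute (by rw [SEnd.par_emb, SEnd.par_emb, hp]) fun i j => ?_
  refine SEnd.emb_commute (by rw [SEnd.par_emb, hp]) fun k l => ?_
  exact SEnd.emb_commute hp fun p q => hc _

/-- The variable `u_k⁻¹`, as a central element. -/
def var (A : Type*) [Ring A] [SuperRing A] (k : Fin 3) : Subring.center (Triple A) :=
  ⟨scalar (MvPowerSeries.X k), by
    rw [Subring.mem_center_iff]
    intro G
    exact (scalar_commute (par_X k) (fun f => (MvPowerSeries.commute_X f k).symm.eq) G).symm⟩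

theorem var_smul (k : Fin 3) (G : Triple A) :
    var A k • G = scalar (MvPowerSeries.X k) * G := rfl

end Legs

/-! ### The RTT relation in the threefold tensor product -/

section TripleRTT
variable {A : Type*} [Ring A] [SuperRing A]

/-- The matrix of the blocks of `X`, placed in a tensor factor by `φ`. -/
def legMatrix {n : ℕ} (φ : SuperHom (SEnd 1 (PowerSeries A)) (Triple A))
    (X : SEnd n (PowerSeries A)) : Matrix (Fin n) (Fin n) (Triple A) :=
  (SEnd.blockEquiv n _ X).map φ

/-- The embedding of two variables among three. -/
def varEmb {p q : Fin 3} (h : p ≠ q) : Fin 2 ↪ Fin 3 :=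
  ⟨![p, q], by
    intro i j hij
    fin_cases i <;> fin_cases j <;> simp_all [eq_comm]⟩

/-- The relation `R(u, v) X^1(u) X^2(v) = X^2(v) X^1(u) R(u, v)`,
multiplied by `u^{-2} v^{-2} (u^2 - v^2)`. -/
def SatisfiesRTT {n : ℕ} (X : SEnd n (PowerSeries A)) : Prop :=
  rMatrix n A * (X.map (atVar 0 1)).map SEnd.emb * SEnd.emb (X.map (atVar 1 1))
    = SEnd.emb (X.map (atVar 1 1)) * (X.map (atVar 0 1)).map SEnd.emb * rMatrix n A

/-- The RTT relation between the images of the blocks of `X` in two tensor factors, where `J` is the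
inclusion of these two tensor factors in the threefold tensor product. -/
theorem SatisfiesRTT.rtt {n : ℕ} {X : SEnd n (PowerSeries A)} (hX : SatisfiesRTT X) {p q : Fin 3}
    (hpq : p ≠ q) (J : SuperHom (SEnd 1 (SEnd 1 (MvPowerSeries (Fin 2) A))) (Triple A))
    (φ ψ : SuperHom (SEnd 1 (PowerSeries A)) (Triple A)) (P Q : Triple A)
    (hJ : ∀ c, J (SEnd.emb (SEnd.emb c)) = scalar (renameHom (varEmb hpq) c))
    (hP : J (SEnd.P 1 _) = P) (hQ : J (SEnd.Q 1 _) = Q)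
    (hφ : ∀ Z : SEnd 1 (PowerSeries A), J ((Z.map (atVar 0 1)).map SEnd.emb) = φ Z)
    (hψ : ∀ Z : SEnd 1 (PowerSeries A), J (SEnd.emb (Z.map (atVar 1 1))) = ψ Z) :
    RTT (var A q ^ 2 - var A p ^ 2) (kMat (var A p) (var A q) P Q)
      (legMatrix φ X) (legMatrix ψ X) := by
  intro a b c e
  have h := congrArg J (SEnd.rtt_blocks _ _ _ _ _ hX a b c e)
  simp only [map_sub, map_mul, map_add, map_pow] at h
  have hb : ∀ (f : PowerSeries A → MvPowerSeries (Fin 2) A) (a b : Fin n),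
      (X.map f).block a b = (X.block a b).map f := fun _ _ _ => rfl
  simp only [hb, hφ, hψ, hJ, hP, hQ, map_sub, map_mul, map_add, map_pow, renameHom_X] at h
  have hp : varEmb hpq 0 = p := rfl
  have hq : varEmb hpq 1 = q := rfl
  have hd : ∀ G : Triple A, scalar (MvPowerSeries.X q ^ 2 - MvPowerSeries.X p ^ 2) * G
      = (var A q ^ 2 - var A p ^ 2) • G := fun G => by
    simp only [← scalarHom_apply, map_sub, map_pow]; rfl
  have hd' : ∀ G : Triple A, G * scalar (MvPowerSeries.X q ^ 2 - MvPowerSeries.X p ^ 2)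
      = (var A q ^ 2 - var A p ^ 2) • G := fun G => by
    rw [← mul_one (scalar _), hd, mul_smul_comm, mul_one]
  have hk : scalar (MvPowerSeries.X p * MvPowerSeries.X q
      * (MvPowerSeries.X p + MvPowerSeries.X q)) * P
      + scalar (MvPowerSeries.X p * MvPowerSeries.X q
      * (MvPowerSeries.X q - MvPowerSeries.X p)) * Q = kMat (var A p) (var A q) P Q := by
    simp only [kMat, ← scalarHom_apply, map_sub, map_mul, map_add, smul_add, smul_smul]; rfl
  rw [hp, hq, hk, hd, hd'] at h
  rw [smul_sub]
  change _ • (φ (X.block a b) * ψ (X.block c e)) - _ • (ψ (X.block c e) * φ (X.block a b))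
    = _ * φ (X.block c b) * ψ (X.block a e) - ψ (X.block c b) * φ (X.block a e) * _
  rw [mul_assoc (kMat _ _ _ _)]
  linear_combination (norm := abel) h

theorem SatisfiesRTT.rtt12 {n : ℕ} {X : SEnd n (PowerSeries A)} (hX : SatisfiesRTT X)
    {p q : Fin 3} (hpq : p ≠ q) :
    RTT (var A q ^ 2 - var A p ^ 2) (kMat (var A p) (var A q) (P12 A) (Q12 A))
      (legMatrix (legOneHom p 1) X) (legMatrix (legTwoHom q 1) X) := by
  refine hX.rtt hpq (((SuperHom.emb 1).comp (renameHom (varEmb hpq))).sEnd 1 |>.sEnd 1) _ _ _ _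
    (fun c => ?_) (SuperHom.sEnd_sEnd_P _) (SuperHom.sEnd_sEnd_Q _) (fun Z => ?_) (fun Z => ?_)
  · simp only [SuperHom.sEnd_emb]; rfl
  · ext i j : 2
    rw [SuperHom.sEnd_apply]
    simp only [SEnd.map, SuperHom.sEnd_emb, SuperHom.comp_apply, renameHom_atVar]
    rfl
  · rw [SuperHom.sEnd_emb]
    simp only [legTwoHom_apply, legTwo]
    congr 1
    ext i j : 2
    rw [SuperHom.sEnd_apply]
    simp only [SEnd.map, SuperHom.sEnd_emb, SuperHom.comp_apply, renameHom_atVar]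
    rfl

theorem SatisfiesRTT.rtt13 {n : ℕ} {X : SEnd n (PowerSeries A)} (hX : SatisfiesRTT X)
    {p q : Fin 3} (hpq : p ≠ q) :
    RTT (var A q ^ 2 - var A p ^ 2) (kMat (var A p) (var A q) (P13 A) (Q13 A))
      (legMatrix (legOneHom p 1) X) (legMatrix (legThreeHom q 1) X) := by
  refine hX.rtt hpq (((SuperHom.emb 1).comp ((renameHom (varEmb hpq)).sEnd 1)).sEnd 1) _ _ _ _
    (fun c => ?_) ?_ ?_ (fun Z => ?_) (fun Z => ?_)
  · simp only [SuperHom.sEnd_emb, SuperHom.comp_apply]; rfl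
  · rw [P13, ← SuperHom.sEnd_sEnd_P (renameHom (varEmb hpq))]; rfl
  · rw [Q13, ← SuperHom.sEnd_sEnd_Q (renameHom (varEmb hpq))]; rfl
  · ext i j : 2
    rw [SuperHom.sEnd_apply]
    simp only [SEnd.map, SuperHom.sEnd_emb, SuperHom.comp_apply, renameHom_atVar]
    rfl
  · rw [SuperHom.sEnd_emb]
    simp only [legThreeHom_apply, legThree]
    congr 1
    rw [SuperHom.comp_apply, SuperHom.emb_apply]
    congr 1
    ext i j : 2
    rw [SuperHom.sEnd_apply]
    simp only [SEnd.map, SuperHom.sEnd_emb, SuperHom.comp_apply, renameHom_atVar]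
    rfl

theorem SatisfiesRTT.rtt23 {n : ℕ} {X : SEnd n (PowerSeries A)} (hX : SatisfiesRTT X)
    {p q : Fin 3} (hpq : p ≠ q) :
    RTT (var A q ^ 2 - var A p ^ 2) (kMat (var A p) (var A q) (P23 A) (Q23 A))
      (legMatrix (legTwoHom p 1) X) (legMatrix (legThreeHom q 1) X) := by
  refine hX.rtt hpq ((SuperHom.emb 1).comp (((renameHom (varEmb hpq)).sEnd 1).sEnd 1)) _ _ _ _
    (fun c => ?_) ?_ ?_ (fun Z => ?_) (fun Z => ?_)
  · simp only [SuperHom.sEnd_emb, SuperHom.comp_apply]; rfl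
  · rw [SuperHom.comp_apply, SuperHom.sEnd_sEnd_P]; rfl
  · rw [SuperHom.comp_apply, SuperHom.sEnd_sEnd_Q]; rfl
  · simp only [SuperHom.comp_apply, SuperHom.emb_apply, legTwoHom_apply, legTwo]
    congr 1
    ext i j : 2
    rw [SuperHom.sEnd_apply]
    simp only [SEnd.map, SuperHom.sEnd_emb, SuperHom.comp_apply, renameHom_atVar]
    rfl
  · simp only [SuperHom.comp_apply, SuperHom.emb_apply, legThreeHom_apply, legThree]
    congr 1
    rw [SuperHom.sEnd_emb]
    congr 1
    ext i j : 2
    rw [SuperHom.sEnd_apply]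
    simp only [SEnd.map, SuperHom.sEnd_emb, SuperHom.comp_apply, renameHom_atVar]
    rfl

end TripleRTT

/-! ### Gauss decomposition -/

section Gauss
variable {S : Type*} [Ring S]

/-- `T = F H E` is the Gauss decomposition of `T`: `F` is lower unitriangular, `H` is diagonal and
`E` is upper unitriangular. -/
structure IsGauss {n : ℕ} (T F H E : Matrix (Fin n) (Fin n) S) : Prop where
  eq_mul : T = F * H * E
  lower : ∀ a b, a < b → F a b = 0
  lower_diag : ∀ a, F a a = 1
  diag : ∀ a b, a ≠ b → H a b = 0
  upper : ∀ a b, b < a → E a b = 0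
  upper_diag : ∀ a, E a a = 1

theorem mul_diag_mul_apply {n : ℕ} {F H E : Matrix (Fin n) (Fin n) S}
    (hH : ∀ a b, a ≠ b → H a b = 0) (i j : Fin n) :
    (F * H * E) i j = ∑ k, F i k * H k k * E k j := by
  rw [Matrix.mul_apply]
  refine Finset.sum_congr rfl fun k _ => ?_
  rw [Matrix.mul_apply, Finset.sum_eq_single k]
  · intro l _ hl; rw [hH l k hl, mul_zero]
  · simp

variable {S₀ : Type*} [Ring S₀]

/-- The Schur complement of the entry `(0, 0)` of `T`, where `w` is the inverse of this entry. -/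
def schur {n : ℕ} (T : Matrix (Fin (n + 1)) (Fin (n + 1)) S) (w : S) : Matrix (Fin n) (Fin n) S :=
  Matrix.of fun i j => T i.succ j.succ - T i.succ 0 * w * T 0 j.succ

/-- Deleting the first rows and columns of the factors of a Gauss decomposition gives the Gauss
decomposition of the Schur complement. -/
theorem IsGauss.schur {n : ℕ} {T F H E : Matrix (Fin (n + 1)) (Fin (n + 1)) S}
    (h : IsGauss T F H E) {w : S} (hw : T 0 0 * w = 1) :
    H 0 0 = T 0 0 ∧ (∀ j, T 0 j = T 0 0 * E 0 j) ∧ (∀ i, T i 0 = F i 0 * T 0 0) ∧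
    IsGauss (QueerYangian.schur T w) (F.submatrix Fin.succ Fin.succ)
      (H.submatrix Fin.succ Fin.succ) (E.submatrix Fin.succ Fin.succ) := by
  have hT : ∀ i j, T i j = F i 0 * H 0 0 * E 0 j
      + ∑ k : Fin n, F i k.succ * H k.succ k.succ * E k.succ j := fun i j => by
    rw [h.eq_mul, mul_diag_mul_apply h.diag, Fin.sum_univ_succ]
  have h0 : ∀ j, T 0 j = H 0 0 * E 0 j := fun j => by
    rw [hT, h.lower_diag, one_mul, Finset.sum_eq_zero, add_zero]
    intro k _
    rw [h.lower 0 k.succ (Fin.succ_pos k), zero_mul, zero_mul]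
  have h1 : ∀ i, T i 0 = F i 0 * H 0 0 := fun i => by
    rw [hT, h.upper_diag, mul_one, Finset.sum_eq_zero, add_zero]
    intro k _
    rw [h.upper k.succ 0 (Fin.succ_pos k), mul_zero]
  have hH : H 0 0 = T 0 0 := by rw [h0, h.upper_diag, mul_one]
  refine ⟨hH, fun j => by rw [h0, hH], fun i => by rw [h1, hH], ?_, ?_, ?_, ?_, ?_, ?_⟩
  · refine Matrix.ext fun i j => ?_
    have hd : ∀ a b, a ≠ b → (H.submatrix Fin.succ Fin.succ) a b = 0 :=
      fun a b hab => h.diag _ _ fun e => hab (Fin.succ_injective _ e)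
    rw [mul_diag_mul_apply hd, QueerYangian.schur, Matrix.of_apply, h0, h1, hT i.succ j.succ, hH,
      mul_assoc (F i.succ 0) (T 0 0) w, hw, mul_one, ← mul_assoc]
    simp
  · exact fun a b hab => h.lower _ _ (Fin.succ_lt_succ_iff.2 hab)
  · exact fun a => h.lower_diag _
  · exact fun a b hab => h.diag _ _ (fun e => hab (Fin.succ_injective _ e))
  · exact fun a b hab => h.upper _ _ (Fin.succ_lt_succ_iff.2 hab)
  · exact fun a => h.upper_diag _

/-- A matrix that becomes the identity under a homomorphism `c` has a Gauss decomposition, provided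
that `c` detects units. -/
theorem exists_isGauss {n : ℕ} (c : S →+* S₀) (hc : ∀ s, c s = 1 → IsUnit s)
    (T : Matrix (Fin n) (Fin n) S) (hT : T.map c = 1) :
    ∃ F H E, IsGauss T F H E ∧ ∀ a, IsUnit (H a a) := by
  induction n with
  | zero =>
    exact ⟨0, 0, 0, ⟨Subsingleton.elim _ _, fun a => a.elim0, fun a => a.elim0, fun a => a.elim0,
      fun a => a.elim0, fun a => a.elim0⟩, fun a => a.elim0⟩
  | succ n ih =>
    have hT' : ∀ i j, c (T i j) = (1 : Matrix (Fin (n + 1)) (Fin (n + 1)) S₀) i j :=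
      fun i j => by rw [← hT]; rfl
    obtain ⟨w, hw⟩ : IsUnit (T 0 0) := hc _ (by rw [hT', Matrix.one_apply_eq])
    obtain ⟨F, H, E, hG, hU⟩ := ih (schur T ↑w⁻¹) (by
      refine Matrix.ext fun i j => ?_
      simp only [schur, Matrix.of_apply, Matrix.map_apply, map_sub, map_mul, hT',
        Matrix.one_apply_ne (Fin.succ_ne_zero i), zero_mul, sub_zero, Matrix.one_apply,
        Fin.succ_inj])
    have hGe := hG.eq_mul
    refine ⟨Matrix.of (Fin.cons (Fin.cons 1 0) fun i => Fin.cons (T i.succ 0 * ↑w⁻¹) (F i)),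
      Matrix.of (Fin.cons (Fin.cons (T 0 0) 0) fun i => Fin.cons 0 (H i)),
      Matrix.of (Fin.cons (Fin.cons 1 fun j => ↑w⁻¹ * T 0 j.succ) fun i => Fin.cons 0 (E i)),
      ⟨?_, ?_, ?_, ?_, ?_, ?_⟩, ?_⟩
    · refine Matrix.ext fun i j => ?_
      rw [mul_diag_mul_apply]
      · rw [Fin.sum_univ_succ]
        refine Fin.cases ?_ (fun i => ?_) i <;> refine Fin.cases ?_ (fun j => ?_) j
        · simp
        · simp [← hw]
        · simp [← hw]
        · have := congrFun (congrFun hGe i) j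
          rw [mul_diag_mul_apply hG.diag] at this
          rw [schur, Matrix.of_apply, sub_eq_iff_eq_add'] at this
          simp only [mul_assoc] at this
          simp [← hw, mul_assoc, this]
      · intro a b
        refine Fin.cases ?_ (fun a => ?_) a <;> refine Fin.cases ?_ (fun b => ?_) b
        · simp
        · simp
        · simp
        · simpa using hG.diag a b
    · intro a b
      refine Fin.cases ?_ (fun a => ?_) a <;> refine Fin.cases ?_ (fun b => ?_) b
      · simp
      · simp
      · simp
      · simpa using hG.lower a b
    · intro a
      refine Fin.cases ?_ (fun a => ?_) a
      · simp
      · simpa using hG.lower_diag a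
    · intro a b
      refine Fin.cases ?_ (fun a => ?_) a <;> refine Fin.cases ?_ (fun b => ?_) b
      · simp
      · simp
      · simp
      · simpa using hG.diag a b
    · intro a b
      refine Fin.cases ?_ (fun a => ?_) a <;> refine Fin.cases ?_ (fun b => ?_) b
      · simp
      · simp
      · simp
      · simpa using hG.upper a b
    · intro a
      refine Fin.cases ?_ (fun a => ?_) a
      · simp
      · simpa using hG.upper_diag a
    · intro a
      refine Fin.cases ?_ (fun a => ?_) a
      · simp [← hw]
      · simpa using hU a

theorem IsGauss.unique {n : ℕ} {T F H E F' H' E' : Matrix (Fin n) (Fin n) S} (h : IsGauss T F H E)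
    (hU : ∀ a, IsUnit (H a a)) (h' : IsGauss T F' H' E') : F' = F ∧ H' = H ∧ E' = E := by
  induction n with
  | zero => exact ⟨Subsingleton.elim _ _, Subsingleton.elim _ _, Subsingleton.elim _ _⟩
  | succ n ih =>
    obtain ⟨w, hw⟩ := hU 0
    have hH : H 0 0 = T 0 0 := by
      rw [h.eq_mul, mul_diag_mul_apply h.diag, Fin.sum_univ_succ, h.lower_diag, h.upper_diag,
        Finset.sum_eq_zero, add_zero, one_mul, mul_one]
      intro k _
      rw [h.lower 0 k.succ (Fin.succ_pos k), zero_mul, zero_mul]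
    have hw' : T 0 0 * ↑w⁻¹ = 1 := by rw [← hH, ← hw, Units.mul_inv]
    obtain ⟨a1, a2, a3, a4⟩ := h.schur hw'
    obtain ⟨b1, b2, b3, b4⟩ := h'.schur hw'
    obtain ⟨c1, c2, c3⟩ := ih a4 (fun a => hU a.succ) b4
    rw [← hH, ← hw] at a2 a3 b2 b3
    refine ⟨Matrix.ext fun i j => ?_, Matrix.ext fun i j => ?_, Matrix.ext fun i j => ?_⟩
    · refine Fin.cases ?_ (fun j => ?_) j
      · exact w.mul_left_inj.1 ((b3 i).symm.trans (a3 i))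
      · refine Fin.cases ?_ (fun i => congrFun (congrFun c1 i) j) i
        rw [h.lower _ _ (Fin.succ_pos j), h'.lower _ _ (Fin.succ_pos j)]
    · by_cases hij : i = j
      · subst hij
        refine Fin.cases (b1.trans a1.symm) (fun i => congrFun (congrFun c2 i) i) i
      · rw [h.diag _ _ hij, h'.diag _ _ hij]
    · refine Fin.cases ?_ (fun i => ?_) i
      · exact w.mul_right_inj.1 ((b2 j).symm.trans (a2 j))
      · refine Fin.cases ?_ (fun j => congrFun (congrFun c3 i) j) j
        rw [h.upper _ _ (Fin.succ_pos i), h'.upper _ _ (Fin.succ_pos i)]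

end Gauss

/-! ### Corners of the Gauss decomposition -/

section Corner
variable {S : Type*} [Ring S]

theorem IsGauss.map {S' : Type*} [Ring S'] {n : ℕ} {T F H E : Matrix (Fin n) (Fin n) S}
    (h : IsGauss T F H E) (φ : S →+* S') : IsGauss (T.map φ) (F.map φ) (H.map φ) (E.map φ) where
  eq_mul := by rw [h.eq_mul, Matrix.map_mul, Matrix.map_mul]
  lower a b hab := by rw [Matrix.map_apply, h.lower a b hab, map_zero]
  lower_diag a := by rw [Matrix.map_apply, h.lower_diag, map_one]
  diag a b hab := by rw [Matrix.map_apply, h.diag a b hab, map_zero]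
  upper a b hab := by rw [Matrix.map_apply, h.upper a b hab, map_zero]
  upper_diag a := by rw [Matrix.map_apply, h.upper_diag, map_one]

/-- The leading corners of the factors of a Gauss decomposition form the Gauss decomposition of the
leading corner. -/
theorem IsGauss.castLE {n m : ℕ} {T F H E : Matrix (Fin n) (Fin n) S}
    (h : IsGauss T F H E) (hmn : m ≤ n) :
    IsGauss (T.submatrix (Fin.castLE hmn) (Fin.castLE hmn))
      (F.submatrix (Fin.castLE hmn) (Fin.castLE hmn))
      (H.submatrix (Fin.castLE hmn) (Fin.castLE hmn))
      (E.submatrix (Fin.castLE hmn) (Fin.castLE hmn)) where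
  eq_mul := by
    refine Matrix.ext fun i j => ?_
    have hd : ∀ a b, a ≠ b → (H.submatrix (Fin.castLE hmn) (Fin.castLE hmn)) a b = 0 :=
      fun a b hab => h.diag _ _ fun e => hab (Fin.castLE_injective hmn e)
    rw [mul_diag_mul_apply hd, Matrix.submatrix_apply, h.eq_mul, mul_diag_mul_apply h.diag]
    symm
    refine Finset.sum_of_injOn (Fin.castLE hmn) (Fin.castLE_injective hmn).injOn (by simp) ?_
      (fun _ _ => rfl)
    intro k _ hk
    rw [h.upper, mul_zero]
    by_contra hkj
    apply hk
    refine ⟨⟨k, ?_⟩, by simp, by ext; simp⟩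
    have := j.2
    simp only [Fin.lt_def, Fin.val_castLE] at hkj
    omega
  lower a b hab := h.lower _ _ hab
  lower_diag a := h.lower_diag _
  diag a b hab := h.diag _ _ fun e => hab (Fin.castLE_injective hmn e)
  upper a b hab := h.upper _ _ hab
  upper_diag a := h.upper_diag _

/-- The inverse of the Schur complement is a corner of the inverse matrix. -/
theorem schur_mul_submatrix {n : ℕ} {T T' : Matrix (Fin (n + 1)) (Fin (n + 1)) S} {w : S}
    (hw : w * T 0 0 = 1) (h : T * T' = 1) :
    schur T w * T'.submatrix Fin.succ Fin.succ = 1 := by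
  refine Matrix.ext fun i j => ?_
  have h0 := congrFun (congrFun h 0) j.succ
  have h1 := congrFun (congrFun h i.succ) j.succ
  rw [Matrix.mul_apply, Fin.sum_univ_succ] at h0 h1
  rw [Matrix.one_apply_ne (Fin.succ_ne_zero j).symm] at h0
  rw [Matrix.mul_apply]
  simp only [schur, Matrix.of_apply, Matrix.submatrix_apply, sub_mul, Finset.sum_sub_distrib,
    mul_assoc, ← Finset.mul_sum]
  have h2 : T' 0 j.succ = -(w * ∑ k : Fin n, T 0 k.succ * T' k.succ j.succ) := by
    have := congrArg (w * ·) h0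
    rw [mul_zero, mul_add, ← mul_assoc, hw, one_mul] at this
    exact eq_neg_of_add_eq_zero_left this
  rw [h2] at h1
  rw [show (1 : Matrix (Fin n) (Fin n) S) i j = (1 : Matrix (Fin (n + 1)) _ S) i.succ j.succ by
    simp [Matrix.one_apply], ← h1]
  noncomm_ring

theorem submatrix_mul_schur {n : ℕ} {T T' : Matrix (Fin (n + 1)) (Fin (n + 1)) S} {w : S}
    (hw : T 0 0 * w = 1) (h : T' * T = 1) :
    T'.submatrix Fin.succ Fin.succ * schur T w = 1 := by
  refine Matrix.ext fun i j => ?_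
  have h0 := congrFun (congrFun h i.succ) 0
  have h1 := congrFun (congrFun h i.succ) j.succ
  rw [Matrix.mul_apply, Fin.sum_univ_succ] at h0 h1
  rw [Matrix.one_apply_ne (Fin.succ_ne_zero i)] at h0
  rw [Matrix.mul_apply]
  simp only [schur, Matrix.of_apply, Matrix.submatrix_apply, mul_sub, Finset.sum_sub_distrib,
    ← mul_assoc, ← Finset.sum_mul]
  have h2 : T' i.succ 0 = -((∑ k : Fin n, T' i.succ k.succ * T k.succ 0) * w) := by
    have := congrArg (· * w) h0
    rw [zero_mul, add_mul, mul_assoc, hw, mul_one] at this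
    exact eq_neg_of_add_eq_zero_left this
  rw [h2] at h1
  rw [show (1 : Matrix (Fin n) (Fin n) S) i j = (1 : Matrix (Fin (n + 1)) _ S) i.succ j.succ by
    simp [Matrix.one_apply], ← h1]
  noncomm_ring

variable {𝕜 R : Type*} [CommRing 𝕜] [Ring R] [Algebra 𝕜 R] {S₀ : Type*} [Ring S₀]

theorem map_mul_map_eq_one {ι Φ : Type*} [Fintype ι] [DecidableEq ι] [FunLike Φ S R]
    [RingHomClass Φ S R] {M N : Matrix ι ι S} (h : M * N = 1) (φ : Φ) : M.map φ * N.map φ = 1 := by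
  have := Matrix.map_mul (f := (φ : S →+* R)) (L := M) (M := N)
  rw [h, Matrix.map_one _ (map_zero _) (map_one _)] at this
  exact this.symm

/-- The RTT relation passes to the Schur complement: its inverse is a submatrix of the inverse. -/
theorem RTT.schur {n : ℕ} {T : Matrix (Fin (n + 1)) (Fin (n + 1)) S} (hT : IsUnit T) {w : S}
    (hw : T 0 0 * w = 1) (hw' : w * T 0 0 = 1) {d : 𝕜} {k : R} {φ ψ : S →+* R}
    (h : RTT d k (T.map φ) (T.map ψ)) :
    RTT d k ((QueerYangian.schur T w).map φ) ((QueerYangian.schur T w).map ψ) := by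
  obtain ⟨⟨T, T', h1, h2⟩, rfl⟩ := hT
  dsimp only at *
  have h3 := h.inv (map_mul_map_eq_one h1 φ) (map_mul_map_eq_one h2 φ)
    (map_mul_map_eq_one h1 ψ) (map_mul_map_eq_one h2 ψ)
  have e1 := schur_mul_submatrix hw' h1
  have e2 := submatrix_mul_schur hw h2
  exact (h3.submatrix Fin.succ).inv (map_mul_map_eq_one e2 ψ) (map_mul_map_eq_one e1 ψ)
    (map_mul_map_eq_one e2 φ) (map_mul_map_eq_one e1 φ)

theorem schur_map_eq_one {n : ℕ} (c : S →+* S₀) {T : Matrix (Fin (n + 1)) (Fin (n + 1)) S}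
    (hT : T.map c = 1) (w : S) : (schur T w).map c = 1 := by
  have hT' : ∀ i j, c (T i j) = (1 : Matrix (Fin (n + 1)) (Fin (n + 1)) S₀) i j :=
    fun i j => by rw [← hT]; rfl
  refine Matrix.ext fun i j => ?_
  simp only [schur, Matrix.of_apply, Matrix.map_apply, map_sub, map_mul, hT',
    Matrix.one_apply_ne (Fin.succ_ne_zero i), zero_mul, sub_zero, Matrix.one_apply,
    Fin.succ_inj]

/-- The product of the last `3 × 3` corners of the factors of the Gauss decomposition of `T`
satisfies all RTT relations that `T` satisfies. -/
theorem IsGauss.exists_tail (c : S →+* S₀) (hc : ∀ s, c s = 1 → IsUnit s)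
    (hc' : ∀ n, ∀ M : Matrix (Fin n) (Fin n) S, M.map c = 1 → IsUnit M) {a : ℕ}
    {T F H E : Matrix (Fin (a + 3)) (Fin (a + 3)) S} (hG : IsGauss T F H E) (hT : T.map c = 1) :
    let σ : Fin 3 → Fin (a + 3) := Fin.natAdd a
    ∃ T3, IsGauss T3 (F.submatrix σ σ) (H.submatrix σ σ) (E.submatrix σ σ) ∧ T3.map c = 1 ∧
      ∀ (d : 𝕜) (k : R) (φ ψ : S →+* R), RTT d k (T.map φ) (T.map ψ) →
        RTT d k (T3.map φ) (T3.map ψ) := by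
  induction a with
  | zero =>
    intro σ
    have hσ : ∀ M : Matrix (Fin 3) (Fin 3) S,
        (M.submatrix (Fin.natAdd 0) (Fin.natAdd 0) : Matrix (Fin 3) (Fin 3) S)
        = M := fun M => by
      refine Matrix.ext fun i j => ?_
      rw [Matrix.submatrix_apply]
      congr 1 <;> ext <;> simp
    refine ⟨T, ?_, hT, fun _ _ _ _ h => h⟩
    simp only [σ]
    rw [hσ, hσ, hσ]
    exact hG
  | succ a ih =>
    intro σ
    have h00 : c (T 0 0) = 1 := by
      have := congrFun (congrFun hT 0) 0
      rwa [Matrix.map_apply, Matrix.one_apply_eq] at this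
    obtain ⟨w, hw⟩ := hc _ h00
    have hw1 : T 0 0 * ↑w⁻¹ = 1 := by rw [← hw, Units.mul_inv]
    have hw2 : ↑w⁻¹ * T 0 0 = 1 := by rw [← hw, Units.inv_mul]
    have hσ : σ = Fin.succ ∘ Fin.natAdd a := by
      funext i; ext; simp [σ]; omega
    rw [hσ]
    obtain ⟨T3, h1, h2, h3⟩ := ih (hG.schur hw1).2.2.2 (schur_map_eq_one c hT _)
    exact ⟨T3, h1, h2, fun d k φ ψ h => h3 d k φ ψ (h.schur (hc' _ _ hT) hw1 hw2)⟩

end Corner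

/-! ### The Gauss decomposition of the generator matrix -/

section Units
variable {A : Type*} [Ring A] [SuperRing A]

/-- Taking the constant term of a power series. -/
def constHom (A : Type*) [Ring A] [SuperRing A] : SuperHom (PowerSeries A) A where
  toRingHom := PowerSeries.constantCoeff
  map_par _ := rfl

theorem constHom_apply (f : PowerSeries A) : constHom A f = PowerSeries.constantCoeff f := rfl

theorem coeff_twist (x : ZMod 2) (r : ℕ) (f : PowerSeries A) :
    PowerSeries.coeff r (twist x f) = twist x (PowerSeries.coeff r f) := by
  unfold twist; split_ifs <;> rfl

/-- Matrices of power series are power series of matrices. -/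
def SEnd.seriesEquiv (n : ℕ) (A : Type*) [Ring A] [SuperRing A] :
    SEnd n (PowerSeries A) ≃+* PowerSeries (SEnd n A) where
  toFun X := PowerSeries.mk fun r => X.map (PowerSeries.coeff r)
  invFun f := fun i j => PowerSeries.mk fun r => PowerSeries.coeff r f i j
  left_inv X := by
    ext i j r
    rw [PowerSeries.coeff_mk, PowerSeries.coeff_mk, SEnd.map]
  right_inv f := by
    ext r i j
    rw [PowerSeries.coeff_mk]
    exact PowerSeries.coeff_mk r fun r => PowerSeries.coeff r f i j
  map_add' X Y := by
    ext r i j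
    rw [map_add, SEnd.add_apply, PowerSeries.coeff_mk, PowerSeries.coeff_mk, PowerSeries.coeff_mk,
      SEnd.map, SEnd.add_apply, map_add]
    rfl
  map_mul' X Y := by
    ext r i j
    rw [PowerSeries.coeff_mul, SEnd.sum_apply, PowerSeries.coeff_mk, SEnd.map]
    simp only [PowerSeries.coeff_mk, SEnd.mul_apply, map_sum, PowerSeries.coeff_mul, coeff_twist]
    rw [Finset.sum_comm]
    rfl

theorem SEnd.coeff_seriesEquiv {n : ℕ} (X : SEnd n (PowerSeries A)) (r : ℕ) :
    PowerSeries.coeff r (SEnd.seriesEquiv n A X) = X.map (PowerSeries.coeff r) :=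
  PowerSeries.coeff_mk r fun r => X.map (PowerSeries.coeff r)

/-- A series of matrices with constant term `1` is a unit. -/
theorem isUnit_of_constHom_sEnd {n : ℕ} {X : SEnd n (PowerSeries A)}
    (h : (constHom A).sEnd n X = 1) : IsUnit X := by
  rw [← MulEquiv.isUnit_map (SEnd.seriesEquiv n A), PowerSeries.isUnit_iff_constantCoeff]
  have : PowerSeries.constantCoeff (SEnd.seriesEquiv n A X) = (constHom A).sEnd n X := by
    rw [← PowerSeries.coeff_zero_eq_constantCoeff_apply, SEnd.coeff_seriesEquiv]
    refine SEnd.ext fun i j => ?_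
    rw [SuperHom.sEnd_apply, constHom_apply, ← PowerSeries.coeff_zero_eq_constantCoeff_apply,
      SEnd.map]
  rw [this, h]
  exact isUnit_one

theorem isUnit_of_map_constHom {n : ℕ} {M : Matrix (Fin n) (Fin n) (SEnd 1 (PowerSeries A))}
    (h : M.map ((constHom A).sEnd 1) = 1) : IsUnit M := by
  rw [← MulEquiv.isUnit_map (SEnd.blockEquiv n (PowerSeries A)).symm]
  refine isUnit_of_constHom_sEnd ((SEnd.blockEquiv n A).injective ?_)
  rw [map_one, ← h]
  refine Matrix.ext fun a b => ?_
  change (constHom A).sEnd 1 (SEnd.blockEquiv n _ ((SEnd.blockEquiv n _).symm M) a b) = _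
  rw [RingEquiv.apply_symm_apply]
  rfl

theorem SEnd.isBlockGauss_iff {n : ℕ} {T F H E : SEnd n A} :
    SEnd.IsBlockGauss T F H E ↔ IsGauss (SEnd.blockEquiv n A T) (SEnd.blockEquiv n A F)
      (SEnd.blockEquiv n A H) (SEnd.blockEquiv n A E) := by
  constructor
  · intro h
    exact ⟨by rw [h.eq_mul, map_mul, map_mul], h.lower, h.lower_diag, h.diag, h.upper,
      h.upper_diag⟩
  · intro h
    exact ⟨(SEnd.blockEquiv n A).injective (by rw [h.eq_mul, map_mul, map_mul]), h.lower,
      h.lower_diag, h.diag, h.upper, h.upper_diag⟩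

/-- The image of a matrix under `E_{ij} ↦ E_{-i,-j}`. -/
def SEnd.conjOpp {n : ℕ} {A : Type*} (X : SEnd n A) : SEnd n A := fun i j => X i.opp j.opp

/-- The involution `E_{ij} ↦ E_{-i,-j}` of `End(ℂ^{n|n}) ⊗ A`, as a homomorphism. -/
def SEnd.oppHom (n : ℕ) (A : Type*) [Ring A] [SuperRing A] : SuperHom (SEnd n A) (SEnd n A) where
  toFun := SEnd.conjOpp
  map_one' := by
    ext i j
    have : i.opp = j.opp ↔ i = j := by simp [Idx.opp, Prod.ext_iff]
    simp only [SEnd.conjOpp, SEnd.one_apply, this]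
  map_zero' := rfl
  map_add' X Y := rfl
  map_mul' X Y := by
    ext i j
    rw [SEnd.mul_apply, SEnd.conjOpp, SEnd.mul_apply]
    let σ : Idx n ≃ Idx n := Equiv.prodCongr (Equiv.refl _) (Equiv.addRight 1)
    rw [← Equiv.sum_comp σ]
    refine Finset.sum_congr rfl fun k _ => ?_
    have : (σ k).2 + j.opp.2 = k.2 + j.2 := by
      have : (1 : ZMod 2) + 1 = 0 := by decide
      change k.2 + 1 + (j.2 + 1) = _
      linear_combination this
    rw [this]
    rfl
  map_par X := by
    ext i j
    have : i.opp.2 + j.opp.2 = i.2 + j.2 := by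
      have : (1 : ZMod 2) + 1 = 0 := by decide
      change i.2 + 1 + (j.2 + 1) = _
      linear_combination this
    rw [SEnd.par_apply, SEnd.conjOpp, SEnd.par_apply, this]
    rfl

theorem SEnd.oppHom_apply {n : ℕ} (X : SEnd n A) (i j : Idx n) :
    SEnd.oppHom n A X i j = X i.opp j.opp := rfl

/-- The substitution `f(u) ↦ f(-u)`. -/
def negVarHom (A : Type*) [Ring A] [SuperRing A] : SuperHom (PowerSeries A) (PowerSeries A) where
  toFun f := PowerSeries.mk fun r => (-1 : ℤ) ^ r • PowerSeries.coeff r f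
  map_one' := by
    ext r
    by_cases hr : r = 0 <;> simp [PowerSeries.coeff_one, hr]
  map_zero' := by ext r; simp
  map_add' f g := by ext r; simp
  map_mul' f g := by
    ext r
    simp only [PowerSeries.coeff_mk, PowerSeries.coeff_mul, Finset.smul_sum]
    refine Finset.sum_congr rfl fun p hp => ?_
    rw [Finset.HasAntidiagonal.mem_antidiagonal] at hp
    rw [smul_mul_smul_comm, ← pow_add, hp]
  map_par f := by
    ext r
    rw [PowerSeries.coeff_mk]
    change _ = par (PowerSeries.coeff r (PowerSeries.mk _))
    rw [PowerSeries.coeff_mk, map_zsmul]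
    rfl

theorem coeff_negVarHom (f : PowerSeries A) (r : ℕ) :
    PowerSeries.coeff r (negVarHom A f) = (-1 : ℤ) ^ r • PowerSeries.coeff r f :=
  PowerSeries.coeff_mk r fun r => (-1 : ℤ) ^ r • PowerSeries.coeff r f

/-- The involution `X(u) ↦ θ X(-u)`, where `θ E_{ij} = E_{-i,-j}`. -/
def reflectHom (n : ℕ) (A : Type*) [Ring A] [SuperRing A] :
    SuperHom (SEnd n (PowerSeries A)) (SEnd n (PowerSeries A)) :=
  ((negVarHom A).sEnd n).comp (SEnd.oppHom n _)

theorem reflectHom_apply {n : ℕ} (X : SEnd n (PowerSeries A)) (i j : Idx n) :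
    reflectHom n A X i j = negVarHom A (X i.opp j.opp) := rfl

/-- The properties of the generator matrix of `Y(q_n)` that are used: the RTT relation, the constant
term `1`, evenness, and the symmetry `t_{-i,-j}(-u) = t_{ij}(u)`. -/
structure IsGenMatrix {n : ℕ} (T : SEnd n (PowerSeries A)) : Prop where
  rtt : SatisfiesRTT T
  const : (constHom A).sEnd n T = 1
  even : par T = T
  reflect : reflectHom n A T = T

theorem isGenMatrix_genMatrix (n : ℕ) : IsGenMatrix (genMatrix n) where
  rtt := yangian_rtt n
  const := by
    ext i j
    rw [SuperHom.sEnd_apply, constHom_apply, ← PowerSeries.coeff_zero_eq_constantCoeff_apply]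
    simp only [genMatrix, tMatrix, PowerSeries.coeff_mk, tCoeff, SEnd.one_apply]
  even := par_genMatrix n
  reflect := by
    ext i j r
    rw [reflectHom_apply, yangian_symm, coeff_negVarHom, PowerSeries.coeff_mk, smul_smul,
      ← mul_pow]
    simp

variable {n : ℕ} {T F H E : SEnd n (PowerSeries A)}

theorem IsGenMatrix.map_const (hT : IsGenMatrix T) :
    (SEnd.blockEquiv n _ T).map ((constHom A).sEnd 1) = 1 := by
  rw [← map_one (SEnd.blockEquiv n A), ← hT.const]
  rfl

theorem IsGenMatrix.exists_isGauss (hT : IsGenMatrix T) :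
    ∃ F H E, IsGauss (SEnd.blockEquiv n _ T) F H E ∧ ∀ a, IsUnit (H a a) :=
  QueerYangian.exists_isGauss ((constHom A).sEnd 1 : SEnd 1 (PowerSeries A) →+* SEnd 1 A)
    (fun _ h => isUnit_of_constHom_sEnd h) _ hT.map_const

theorem IsGenMatrix.existsUnique_isBlockGauss (hT : IsGenMatrix T) :
    ∃! G : SEnd n (PowerSeries A) × SEnd n (PowerSeries A) × SEnd n (PowerSeries A),
      SEnd.IsBlockGauss T G.1 G.2.1 G.2.2 := by
  obtain ⟨F, H, E, hG, hU⟩ := hT.exists_isGauss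
  refine ⟨((SEnd.blockEquiv n _).symm F, (SEnd.blockEquiv n _).symm H,
    (SEnd.blockEquiv n _).symm E), ?_, ?_⟩
  · refine SEnd.isBlockGauss_iff.2 ?_
    simpa only [RingEquiv.apply_symm_apply] using hG
  · rintro ⟨F', H', E'⟩ h
    rw [SEnd.isBlockGauss_iff] at h
    obtain ⟨h1, h2, h3⟩ := hG.unique hU h
    simp only [← h1, ← h2, ← h3, RingEquiv.symm_apply_apply]

theorem IsGenMatrix.isUnit_diag (hT : IsGenMatrix T)
    (h : IsGauss (SEnd.blockEquiv n _ T) (SEnd.blockEquiv n _ F) (SEnd.blockEquiv n _ H)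
      (SEnd.blockEquiv n _ E)) (a : Fin n) : IsUnit (H.block a a) := by
  obtain ⟨F', H', E', hG, hU⟩ := hT.exists_isGauss
  obtain ⟨h1, h2, h3⟩ := hG.unique hU h
  have := hU a
  rw [← h2] at this
  exact this

/-- An endomorphism that fixes `T` fixes the factors of its Gauss decomposition. -/
theorem IsGenMatrix.fixed_factors (hT : IsGenMatrix T)
    (h : IsGauss (SEnd.blockEquiv n _ T) (SEnd.blockEquiv n _ F) (SEnd.blockEquiv n _ H)
      (SEnd.blockEquiv n _ E)) (φ : SEnd 1 (PowerSeries A) →+* SEnd 1 (PowerSeries A))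
    (hφ : (SEnd.blockEquiv n _ T).map φ = SEnd.blockEquiv n _ T) (a b : Fin n) :
    φ (F.block a b) = F.block a b ∧ φ (H.block a b) = H.block a b ∧
      φ (E.block a b) = E.block a b := by
  have h' := h.map φ
  rw [hφ] at h'
  obtain ⟨h1, h2, h3⟩ := h.unique (hT.isUnit_diag h) h'
  exact ⟨congrFun (congrFun h1 a) b, congrFun (congrFun h2 a) b, congrFun (congrFun h3 a) b⟩

end Units

/-! ### Multiplication by `P` and `Q` -/

section Intertwiners
variable {n : ℕ} {B : Type*} [Ring B] [SuperRing B]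

/-- The sign `(-1)^{xy}`. -/
def bichar (x y : ZMod 2) : ℤ := if x = 0 then 1 else sgn y

namespace SEnd

theorem twist_apply (x : ZMod 2) (X : SEnd n B) (i j : Idx n) :
    twist x X i j = bichar x (i.2 + j.2) • twist x (X i j) := by
  unfold twist bichar
  split_ifs
  · rw [one_smul]
  · exact par_apply X i j

theorem twist_intCast (x : ZMod 2) (k : ℤ) : twist x (k : B) = k := by
  unfold twist; split_ifs <;> simp

/-- Left multiplication by `P` permutes the entries of a tensor up to signs. -/
theorem P_mul_apply (X : SEnd n (SEnd n B)) (i l k m : Idx n) :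
    (P n B * X) i l k m = (sgn k.2 * bichar (k.2 + l.2) (k.2 + i.2)) • X k l i m := by
  rw [mul_apply, sum_apply, Finset.sum_eq_single k, mul_apply, Finset.sum_eq_single i]
  · rw [twist_apply, twist_zsmul, twist_twist]
    simp [P, twist_intCast, mul_comm, mul_assoc]
  · intro q _ hq; simp [twist_apply, P, hq, twist_of_zero]
  · simp
  · intro j _ hj
    rw [mul_apply]
    refine Finset.sum_eq_zero fun q _ => ?_
    simp [twist_apply, P, hj.symm, twist_of_zero]
  · simp

theorem mul_P_apply (X : SEnd n (SEnd n B)) (i l k m : Idx n) :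
    (X * P n B) i l k m = (sgn l.2 * bichar (m.2 + l.2) (k.2 + l.2)) • X i m k l := by
  rw [mul_apply, sum_apply, Finset.sum_eq_single m, mul_apply, Finset.sum_eq_single l]
  · have : m.2 + l.2 + (l.2 + m.2) = 0 := by
      rw [add_comm m.2 l.2]; exact CharTwo.add_self_eq_zero _
    rw [twist_apply, twist_zsmul, twist_twist, this, twist_zero]
    simp [P, mul_smul]
    exact (Int.cast_comm (sgn l.2) (_ * _ : B)).symm
  · intro q _ hq; simp [twist_apply, P, hq, twist_of_zero]
  · simp
  · intro j _ hj
    rw [mul_apply]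
    refine Finset.sum_eq_zero fun q _ => ?_
    simp [twist_apply, P, hj.symm, twist_of_zero]
  · simp

theorem opp_opp (i : Idx n) : i.opp.opp = i := by
  have : (1 : ZMod 2) + 1 = 0 := by decide
  simp [Idx.opp, add_assoc, this]

theorem eq_opp_comm {i j : Idx n} : i = j.opp ↔ j = i.opp := by
  constructor <;> rintro rfl <;> rw [opp_opp]

theorem Q_mul_apply (X : SEnd n (SEnd n B)) (i l k m : Idx n) :
    (Q n B * X) i l k m
      = (sgn (k.2 + 1) * bichar (k.2 + 1 + l.2) (k.2 + i.2 + 1)) • X k.opp l i.opp m := by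
  rw [mul_apply, sum_apply, Finset.sum_eq_single k.opp, mul_apply, Finset.sum_eq_single i.opp]
  · rw [twist_apply, twist_zsmul, twist_twist]
    simp [Q, opp_opp, twist_intCast, mul_comm, mul_assoc]
    simp [Idx.opp, add_assoc]
  · intro q _ hq; simp [twist_apply, Q, hq, twist_of_zero]
  · simp
  · intro j _ hj
    rw [mul_apply]
    refine Finset.sum_eq_zero fun q _ => ?_
    have : k ≠ j.opp := fun h => hj (eq_opp_comm.1 h)
    simp [twist_apply, Q, this, twist_of_zero]
  · simp

theorem mul_Q_apply (X : SEnd n (SEnd n B)) (i l k m : Idx n) :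
    (X * Q n B) i l k m
      = (sgn l.2 * bichar (m.2 + l.2 + 1) (k.2 + l.2 + 1)) • X i m.opp k l.opp := by
  rw [mul_apply, sum_apply, Finset.sum_eq_single m.opp, mul_apply, Finset.sum_eq_single l.opp]
  · have : m.opp.2 + l.2 + (l.opp.2 + m.2) = 0 := by
      have h : (1 : ZMod 2) + 1 = 0 := by decide
      have h1 := CharTwo.add_self_eq_zero m.2
      have h2 := CharTwo.add_self_eq_zero l.2
      simp only [Idx.opp]
      linear_combination h + h1 + h2
    rw [twist_apply, twist_zsmul, twist_twist, this, twist_zero]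
    have h2 : m.opp.2 + l.2 = m.2 + l.2 + 1 := by simp only [Idx.opp]; ring
    have h3 : k.2 + l.opp.2 = k.2 + l.2 + 1 := by simp only [Idx.opp]; ring
    rw [h2, h3]
    simp [Q, opp_opp, mul_smul]
    exact (Int.cast_comm (sgn l.2) (_ * _ : B)).symm
  · intro q _ hq; simp [twist_apply, Q, hq, twist_of_zero]
  · simp
  · intro j _ hj
    rw [mul_apply]
    refine Finset.sum_eq_zero fun q _ => ?_
    have : m ≠ j.opp := fun h => hj (eq_opp_comm.1 h)
    simp [twist_apply, Q, this, twist_of_zero]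
  · simp

/-- `P Y^2 = Y^1 P`; no parity condition on `Y` is needed. -/
theorem P_mul_emb (Y : SEnd n B) : P n B * emb Y = Y.map emb * P n B := by
  ext i l k m
  rw [P_mul_apply, mul_P_apply]
  by_cases h : k = l
  · subst h
    have h := CharTwo.add_self_eq_zero k.2
    simp [emb, map, h, bichar, sgn]
  · simp [emb, map, h, zero_apply]

theorem P_mul_map_emb (Y : SEnd n B) : P n B * Y.map emb = emb Y * P n B := by
  ext i l k m
  rw [P_mul_apply, mul_P_apply]
  by_cases h : i = m
  · subst h
    have : ∀ i k l : ZMod 2, sgn k * bichar (k + l) (k + i) = sgn l * bichar (i + l) (k + l) := by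
      decide
    simp [emb, map, this]
  · simp [emb, map, h, zero_apply]

theorem opp_inj {i j : Idx n} : i.opp = j.opp ↔ i = j := by
  rw [eq_opp_comm, opp_opp, eq_comm]

/-- `Q Y^2 = (θ Y)^1 Q`, where `θ E_{ij} = E_{-i,-j}`. -/
theorem Q_mul_emb (Y : SEnd n B) : Q n B * emb Y = (oppHom n B Y).map emb * Q n B := by
  ext i l k m
  rw [Q_mul_apply, mul_Q_apply]
  by_cases h : k = l.opp
  · subst h
    have : ∀ l i m : ZMod 2, bichar (l + l) (l + 1 + i + 1)
        = bichar (m + l + 1) (l + 1 + l + 1) := by decide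
    have h1 : ∀ x : ZMod 2, x + 1 + 1 = x := by decide
    simp [emb, map, opp_opp, oppHom_apply, Idx.opp, this l.2 i.2 m.2, h1]
  · have h' : k.opp ≠ l := fun e => h (by rw [← e, opp_opp])
    simp [emb, map, h, h', zero_apply]

theorem Q_mul_map_emb (Y : SEnd n B) : Q n B * Y.map emb = emb (oppHom n B Y) * Q n B := by
  ext i l k m
  rw [Q_mul_apply, mul_Q_apply]
  by_cases h : m = i.opp
  · subst h
    have : ∀ k l i : ZMod 2, sgn (k + 1) * bichar (k + 1 + l) (k + i + 1)
        = sgn l * bichar (i + 1 + l + 1) (k + l + 1) := by decide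
    have h1 : ∀ x : ZMod 2, x + 1 + 1 = x := by decide
    simp [emb, map, opp_opp, oppHom_apply, Idx.opp, this k.2 l.2 i.2, h1]
  · have h' : i.opp ≠ m := fun e => h e.symm
    have h'' : i ≠ m.opp := fun e => h (eq_opp_comm.1 e)
    simp [emb, map, h', h'', zero_apply]

theorem isPQPair (n : ℕ) (B : Type*) [Ring B] [SuperRing B] : IsPQPair (P n B) (Q n B) where
  P_mul_P := by
    ext i l k m
    rw [P_mul_apply]
    have : ∀ k l : ZMod 2, sgn k * bichar (k + l) (k + l) * sgn l = 1 := by decide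
    by_cases h : i = l
    · subst h
      by_cases h' : k = m
      · subst h'
        simp [P, one_apply, ← Int.cast_mul, this]
      · simp [P, one_apply, h', Ne.symm h']
    · simp [P, one_apply, h, zero_apply]
  Q_mul_Q := by
    ext i l k m
    rw [Q_mul_apply]
    have : ∀ k l : ZMod 2, sgn (k + 1) * bichar (k + 1 + l) (k + l + 1) * sgn l = 1 := by decide
    by_cases h : i = l
    · subst h
      by_cases h' : k = m
      · subst h'
        simp [Q, one_apply, opp_opp, ← Int.cast_mul, this]
      · simp [Q, one_apply, opp_opp, h', Ne.symm h']
    · simp [Q, one_apply, opp_inj, h, zero_apply]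
  Q_mul_P := by
    ext i l k m
    change _ = -((P n B * Q n B) i l k m)
    rw [Q_mul_apply, P_mul_apply]
    have : ∀ k l : ZMod 2, sgn (k + 1) * bichar (k + 1 + l) (k + (l + 1) + 1) * sgn l
      = - (sgn k * bichar (k + l) (k + (l + 1)) * sgn l) := by decide
    by_cases h : i = l.opp
    · subst h
      by_cases h' : m = k.opp
      · subst h'
        simp only [P, Q, opp_opp, true_and, if_true, zsmul_eq_mul, ← Int.cast_mul]
        rw [← Int.cast_neg]
        exact congrArg _ (this k.2 l.2)
      · simp [P, Q, h']
    · have h'' : i.opp ≠ l := fun e => h (by rw [← e, opp_opp])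
      simp [P, Q, h, h'']

end SEnd

end Intertwiners

/-! ### The tensors of the threefold tensor product -/

section SwapRTT
variable {𝕜 R ι : Type*} [CommRing 𝕜] [Ring R] [Algebra 𝕜 R]

/-- Conjugation by `P` exchanges the two tensor factors in an RTT relation. -/
theorem RTT.swap {d x y : 𝕜} {P Q : R} {A B A' B' : Matrix ι ι R} (hPQ : IsPQPair P Q)
    (h : RTT d (kMat x y P Q) A B) (hA : ∀ a b, P * A a b = A' a b * P)
    (hB : ∀ a b, P * B a b = B' a b * P) : RTT d (kMat y x P Q) A' B' := by
  intro a b c e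
  have hk : P * kMat x y P Q = kMat y x P Q * P := by
    unfold kMat
    simp only [mul_smul_comm, smul_mul_assoc, mul_add, add_mul, hPQ.P_mul_P, hPQ.Q_mul_P]
    module
  have := congrArg (fun r => P * r * P) (h a b c e)
  have hPP : ∀ r, P * (P * r) = r := fun r => by rw [← mul_assoc, hPQ.P_mul_P, one_mul]
  simp only [mul_smul_comm, smul_mul_assoc, mul_sub, sub_mul, mul_assoc, hA, hB,
    mul_mul_of_eq (hA _ _), mul_mul_of_eq (hB _ _), hk, mul_mul_of_eq hk, hPP,
    hPQ.P_mul_P, mul_one] at this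
  simpa only [mul_assoc, smul_sub] using this

end SwapRTT

section TripleTensors
variable {A : Type*} [Ring A] [SuperRing A]

theorem SEnd.map_emb_eq (Z : SEnd 1 (SEnd 1 (MvPowerSeries (Fin 3) A))) :
    (SuperHom.emb 1).sEnd 1 Z = (Z.map SEnd.emb : Triple A) := rfl

theorem isPQPair_P12 (A : Type*) [Ring A] [SuperRing A] : IsPQPair (P12 A) (Q12 A) :=
  SEnd.isPQPair _ _

theorem IsPQPair.map {R R' : Type*} [Ring R] [Ring R'] {P Q : R} (h : IsPQPair P Q)
    (φ : R →+* R') : IsPQPair (φ P) (φ Q) where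
  P_mul_P := by rw [← map_mul, h.P_mul_P, map_one]
  Q_mul_Q := by rw [← map_mul, h.Q_mul_Q, map_one]
  Q_mul_P := by rw [← map_mul, h.Q_mul_P, map_neg, map_mul]

theorem isPQPair_P13 (A : Type*) [Ring A] [SuperRing A] : IsPQPair (P13 A) (Q13 A) :=
  (SEnd.isPQPair 1 (MvPowerSeries (Fin 3) A)).map ((SuperHom.emb 1).sEnd 1).toRingHom

theorem isPQPair_P23 (A : Type*) [Ring A] [SuperRing A] : IsPQPair (P23 A) (Q23 A) :=
  (SEnd.isPQPair 1 (MvPowerSeries (Fin 3) A)).map (SuperHom.emb 1).toRingHom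

theorem P12_mul_P23 : P12 A * P23 A = P13 A * P12 A := SEnd.P_mul_emb _

theorem P12_mul_Q23 : P12 A * Q23 A = Q13 A * P12 A := SEnd.P_mul_emb _

theorem Q12_mul_P23 : Q12 A * P23 A = -(Q13 A * Q12 A) := by
  rw [P23, Q12, SEnd.Q_mul_emb, ← neg_mul, Q13, ← map_neg, SEnd.map_emb_eq]
  congr 2
  refine SEnd.ext fun i j => SEnd.ext fun k l => ?_
  change (SEnd.P 1 _ i.opp j.opp k l : MvPowerSeries (Fin 3) A) = -SEnd.Q 1 _ i j k l
  have : ∀ x : ZMod 2, sgn (x + 1) = - sgn x := by decide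
  simp only [SEnd.P, SEnd.Q, Idx.opp, this]
  split_ifs with h <;> simp [h]

theorem Q12_mul_Q23 : Q12 A * Q23 A = -(P13 A * Q12 A) := by
  rw [Q23, Q12, SEnd.Q_mul_emb, ← neg_mul, P13, ← map_neg, SEnd.map_emb_eq]
  congr 2
  refine SEnd.ext fun i j => SEnd.ext fun k l => ?_
  change (SEnd.Q 1 _ i.opp j.opp k l : MvPowerSeries (Fin 3) A) = -SEnd.P 1 _ i j k l
  have : ∀ x : ZMod 2, sgn (x + 1) = - sgn x := by decide
  simp only [SEnd.P, SEnd.Q, SEnd.opp_opp]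
  simp only [Idx.opp, this]
  split_ifs <;> simp

theorem emb_mul_of_entries {C : Type*} [Ring C] [SuperRing C] {a : C} (ha : par a = a)
    {X Y : SEnd 1 C} (h : ∀ i j, a * X i j = Y i j * a) :
    (SEnd.emb a : SEnd 1 C) * X = Y * SEnd.emb a := by
  ext i j
  have : ∀ x, twist x a = a := fun x => by unfold twist; split_ifs <;> simp [ha]
  rw [SEnd.emb_mul_apply, SEnd.mul_emb_apply, this, h]

theorem P12_apply (i j : Idx 1) :
    P12 A i j = (SEnd.P 1 (MvPowerSeries (Fin 3) A) i j).map SEnd.emb := by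
  refine SEnd.ext fun k l => ?_
  change _ = SuperHom.emb 1 (SEnd.P 1 _ i j k l)
  simp only [P12, SEnd.P]
  split_ifs
  · exact (map_intCast (SuperHom.emb (A := MvPowerSeries (Fin 3) A) 1) _).symm
  · exact (map_zero (SuperHom.emb (A := MvPowerSeries (Fin 3) A) 1)).symm

theorem Q12_apply (i j : Idx 1) :
    Q12 A i j = (SEnd.Q 1 (MvPowerSeries (Fin 3) A) i j).map SEnd.emb := by
  refine SEnd.ext fun k l => ?_
  change _ = SuperHom.emb 1 (SEnd.Q 1 _ i j k l)
  simp only [Q12, SEnd.Q]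
  split_ifs
  · exact (map_intCast (SuperHom.emb (A := MvPowerSeries (Fin 3) A) 1) _).symm
  · exact (map_zero (SuperHom.emb (A := MvPowerSeries (Fin 3) A) 1)).symm

theorem P23_mul_P13 : P23 A * P13 A = P12 A * P23 A := by
  refine emb_mul_of_entries SEnd.par_P fun i j => ?_
  rw [P12_apply]
  exact SEnd.P_mul_emb _

theorem P23_mul_Q13 : P23 A * Q13 A = Q12 A * P23 A := by
  refine emb_mul_of_entries SEnd.par_P fun i j => ?_
  rw [Q12_apply]
  exact SEnd.P_mul_emb _

theorem Q23_mul_P13 : Q23 A * P13 A = Q12 A * Q23 A := by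
  refine emb_mul_of_entries SEnd.par_Q fun i j => ?_
  rw [Q12_apply]
  refine (SEnd.Q_mul_emb _).trans ?_
  congr 2
  refine SEnd.ext fun k l => ?_
  change (SEnd.P 1 _ i j k.opp l.opp : MvPowerSeries (Fin 3) A) = SEnd.Q 1 _ i j k l
  have h : ∀ x y : Idx 1, x.opp = y ↔ x = y.opp := fun x y => by
    rw [SEnd.eq_opp_comm, eq_comm]
  simp only [SEnd.P, SEnd.Q, h]

theorem Q23_mul_Q13 : Q23 A * Q13 A = P12 A * Q23 A := by
  refine emb_mul_of_entries SEnd.par_Q fun i j => ?_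
  rw [P12_apply]
  refine (SEnd.Q_mul_emb _).trans ?_
  congr 2
  refine SEnd.ext fun k l => ?_
  change (SEnd.Q 1 _ i j k.opp l.opp : MvPowerSeries (Fin 3) A) = SEnd.P 1 _ i j k l
  simp only [SEnd.P, SEnd.Q, SEnd.opp_inj]

theorem isYBTriple (A : Type*) [Ring A] [SuperRing A] :
    IsYBTriple (P12 A) (Q12 A) (P13 A) (Q13 A) (P23 A) (Q23 A) where
  PP := P23_mul_P13.symm
  PP' := by rw [← P12_mul_P23, P23_mul_P13]
  PQ := Q23_mul_Q13.symm
  PQ' := by rw [← P12_mul_Q23, Q23_mul_Q13]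
  QP := P23_mul_Q13.symm
  QP' := by rw [P23_mul_Q13, Q12_mul_P23, neg_neg]
  QQ := Q23_mul_P13.symm
  QQ' := by rw [Q23_mul_P13, Q12_mul_Q23, neg_neg]

theorem P12_mul_legOne (X : SEnd 1 (PowerSeries A)) (k : Fin 3) (ε : ℤ) :
    P12 A * legOne X k ε = legTwo X k ε * P12 A :=
  SEnd.P_mul_map_emb (X.map fun f => (SEnd.emb (atVar k ε f) : SEnd 1 (MvPowerSeries (Fin 3) A)))

theorem P12_mul_legTwo (X : SEnd 1 (PowerSeries A)) (k : Fin 3) (ε : ℤ) :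
    P12 A * legTwo X k ε = legOne X k ε * P12 A :=
  SEnd.P_mul_emb _

theorem P13_mul_legOne (X : SEnd 1 (PowerSeries A)) (k : Fin 3) (ε : ℤ) :
    P13 A * legOne X k ε = legThree X k ε * P13 A := by
  have := congrArg ((SuperHom.emb 1).sEnd 1 : SuperHom _ (Triple A))
    (SEnd.P_mul_map_emb (X.map (atVar k ε)))
  rw [map_mul, map_mul, SuperHom.sEnd_emb] at this
  exact this

theorem P13_mul_legThree (X : SEnd 1 (PowerSeries A)) (k : Fin 3) (ε : ℤ) :
    P13 A * legThree X k ε = legOne X k ε * P13 A := by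
  have := congrArg ((SuperHom.emb 1).sEnd 1 : SuperHom _ (Triple A))
    (SEnd.P_mul_emb (X.map (atVar k ε)))
  rw [map_mul, map_mul, SuperHom.sEnd_emb] at this
  exact this

theorem P23_mul_legTwo (X : SEnd 1 (PowerSeries A)) (k : Fin 3) (ε : ℤ) :
    P23 A * legTwo X k ε = legThree X k ε * P23 A := by
  have := congrArg (SuperHom.emb 1 : SuperHom _ (Triple A))
    (SEnd.P_mul_map_emb (X.map (atVar k ε)))
  rw [map_mul, map_mul] at this
  exact this

theorem P23_mul_legThree (X : SEnd 1 (PowerSeries A)) (k : Fin 3) (ε : ℤ) :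
    P23 A * legThree X k ε = legTwo X k ε * P23 A := by
  have := congrArg (SuperHom.emb 1 : SuperHom _ (Triple A))
    (SEnd.P_mul_emb (X.map (atVar k ε)))
  rw [map_mul, map_mul] at this
  exact this

theorem atVar_negVarHom {d : ℕ} (k : Fin d) (ε : ℤ) (f : PowerSeries A) :
    atVar k ε (negVarHom A f) = atVar k (-ε) f := by
  funext m
  unfold atVar
  split_ifs
  · rw [coeff_negVarHom, smul_smul, ← mul_pow, mul_neg_one]
  · rfl

theorem oppHom_map_atVar {B : Type*} [Ring B] [SuperRing B] {X : SEnd 1 (PowerSeries A)}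
    (hX : reflectHom 1 A X = X) (k : Fin 3) (ε : ℤ) (g : MvPowerSeries (Fin 3) A → B) :
    SEnd.oppHom 1 B (X.map fun f => g (atVar k ε f)) = X.map fun f => g (atVar k (-ε) f) := by
  ext i j
  change g (atVar k ε (X i.opp j.opp)) = g (atVar k (-ε) (X i j))
  have h : X i j = negVarHom A (X i.opp j.opp) := by rw [← reflectHom_apply, hX]
  rw [h, atVar_negVarHom, neg_neg]

/-- Since `θ X(u) = X(-u)`, the tensor `Q` exchanges the two tensor factors and changes the sign of
the variable. -/
theorem legSwap {X : SEnd 1 (PowerSeries A)} (hX : reflectHom 1 A X = X) :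
    LegSwap (P12 A) (Q12 A) (legOne X) (legTwo X) where
  P_one := P12_mul_legOne X
  P_two := P12_mul_legTwo X
  Q_one k ε := by
    refine (SEnd.Q_mul_map_emb
      (X.map fun f => (SEnd.emb (atVar k ε f) : SEnd 1 (MvPowerSeries (Fin 3) A)))).trans ?_
    rw [oppHom_map_atVar hX]
    rfl
  Q_two k ε := by
    refine (SEnd.Q_mul_emb
      (X.map fun f => (SEnd.emb (atVar k ε f) : SEnd 1 (MvPowerSeries (Fin 3) A)))).trans ?_
    rw [oppHom_map_atVar hX]
    rfl

theorem par_map_atVar {X : SEnd 1 (PowerSeries A)} (hX : par X = X) (k : Fin 3) (ε : ℤ) :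
    par (X.map (atVar k ε)) = X.map (atVar k ε) := by
  have := ((atVarHom (A := A) k ε).sEnd 1).apply_par X
  rw [hX] at this
  exact this.symm

theorem P12_commute_legThree {X : SEnd 1 (PowerSeries A)} (hX : par X = X) (k : Fin 3) (ε : ℤ) :
    P12 A * legThree X k ε = legThree X k ε * P12 A := by
  refine (SEnd.emb_commute (by rw [SEnd.par_emb, par_map_atVar hX]) fun i j => ?_).symm
  refine SEnd.emb_commute (par_map_atVar hX k ε) fun p q => ?_
  simp only [P12, SEnd.P]
  split_ifs
  · exact (Int.cast_commute _ _).symm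
  · simp

theorem Q12_commute_legThree {X : SEnd 1 (PowerSeries A)} (hX : par X = X) (k : Fin 3) (ε : ℤ) :
    Q12 A * legThree X k ε = legThree X k ε * Q12 A := by
  refine (SEnd.emb_commute (by rw [SEnd.par_emb, par_map_atVar hX]) fun i j => ?_).symm
  refine SEnd.emb_commute (par_map_atVar hX k ε) fun p q => ?_
  simp only [Q12, SEnd.Q]
  split_ifs
  · exact (Int.cast_commute _ _).symm
  · simp

theorem P23_commute_legOne (X : SEnd 1 (PowerSeries A)) (k : Fin 3) (ε : ℤ) :
    P23 A * legOne X k ε = legOne X k ε * P23 A := by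
  refine emb_mul_of_entries SEnd.par_P fun i j => ?_
  refine (SEnd.P_mul_emb _).trans ?_
  congr 1
  exact SuperHom.sEnd_emb (SuperHom.emb 1) _

theorem Q23_commute_legOne (X : SEnd 1 (PowerSeries A)) (k : Fin 3) (ε : ℤ) :
    Q23 A * legOne X k ε = legOne X k ε * Q23 A := by
  refine emb_mul_of_entries SEnd.par_Q fun i j => ?_
  refine (SEnd.Q_mul_emb _).trans ?_
  congr 1
  have : ∀ f : MvPowerSeries (Fin 3) A, SEnd.oppHom 1 _ (SEnd.emb f) = SEnd.emb f := fun f => by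
    ext p q
    simp only [SEnd.oppHom_apply, SEnd.emb, SEnd.opp_inj]
  rw [this]
  exact SuperHom.sEnd_emb (SuperHom.emb 1) _

end TripleTensors

/-! ### Coefficients of power series -/

section SeriesCoefficients
variable {d : ℕ} {A : Type*} [Ring A]

theorem X_pow_mul_apply (s : Fin d) (n : ℕ) (f : MvPowerSeries (Fin d) A) (m : Fin d →₀ ℕ) :
    (MvPowerSeries.X s ^ n * f : MvPowerSeries (Fin d) A) m =
      if n ≤ m s then f (m - Finsupp.single s n) else 0 := by
  rw [MvPowerSeries.X_pow_eq]
  refine (MvPowerSeries.coeff_monomial_mul _ _ _ _).trans ?_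
  simp only [Finsupp.single_le_iff, one_mul]
  rfl

theorem X_mul_apply (s : Fin d) (f : MvPowerSeries (Fin d) A) (m : Fin d →₀ ℕ) :
    (MvPowerSeries.X s * f : MvPowerSeries (Fin d) A) m =
      if 1 ≤ m s then f (m - Finsupp.single s 1) else 0 := by
  rw [← X_pow_mul_apply, pow_one]

theorem eq_zero_of_X_mul {s : Fin d} {f : MvPowerSeries (Fin d) A} (h : MvPowerSeries.X s * f = 0) :
    f = 0 := by
  funext m
  have := congrFun h (m + Finsupp.single s 1)
  rw [X_mul_apply, if_pos (by simp), add_tsub_cancel_right] at this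
  exact this

/-- The difference of the squares of two variables is not a zero divisor: if it annihilates `f`,
then each coefficient of `f` equals one of smaller degree in `X s`, or zero. -/
theorem eq_zero_of_X_sq_sub_mul {s t : Fin d} (hst : s ≠ t) {f : MvPowerSeries (Fin d) A}
    (h : (MvPowerSeries.X t ^ 2 - MvPowerSeries.X s ^ 2) * f = 0) : f = 0 := by
  have key : ∀ N : ℕ, ∀ m : Fin d →₀ ℕ, m s < N → f m = 0 := by
    intro N
    induction N with
    | zero => intro m hm; omega
    | succ N ih =>
      intro m hm
      rw [sub_mul, sub_eq_zero] at h
      have := congrFun h (m + Finsupp.single t 2)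
      rw [X_pow_mul_apply, X_pow_mul_apply, if_pos (by simp), add_tsub_cancel_right] at this
      rw [this]
      split_ifs with h2
      · refine ih _ ?_
        simp [hst] at h2 ⊢
        omega
      · rfl
  funext m
  exact key _ m (Nat.lt_succ_self _)

theorem eq_zero_of_forall_X_pow {s : Fin d} {f : MvPowerSeries (Fin d) A}
    (h : ∀ n : ℕ, ∃ g, f = MvPowerSeries.X s ^ n * g) : f = 0 := by
  funext m
  obtain ⟨g, hg⟩ := h (m s + 1)
  rw [hg, X_pow_mul_apply, if_neg (by omega)]
  rfl

/-- The coefficient of `u_l^{-s}`, a series in the remaining variables. -/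
def varCoeff (l : Fin d) (s : ℕ) : MvPowerSeries (Fin d) A →+ MvPowerSeries (Fin d) A where
  toFun f := fun m => if m l = 0 then f (m + Finsupp.single l s) else 0
  map_zero' := by funext m; split_ifs <;> rfl
  map_add' f g := by
    funext m
    change _ = (if m l = 0 then f (m + Finsupp.single l s) else 0)
      + if m l = 0 then g (m + Finsupp.single l s) else 0
    split_ifs
    · rfl
    · rw [add_zero]

theorem varCoeff_apply (l : Fin d) (s : ℕ) (f : MvPowerSeries (Fin d) A) (m : Fin d →₀ ℕ) :
    varCoeff l s f m = if m l = 0 then f (m + Finsupp.single l s) else 0 := rfl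

theorem varCoeff_X_mul {k l : Fin d} (hkl : k ≠ l) (s : ℕ) (f : MvPowerSeries (Fin d) A) :
    varCoeff l s (MvPowerSeries.X k * f) = MvPowerSeries.X k * varCoeff l s f := by
  funext m
  rw [varCoeff_apply, X_mul_apply, X_mul_apply, varCoeff_apply]
  have h1 : (m + Finsupp.single l s) k = m k := by simp [hkl.symm, hkl]
  have h2 : (m - Finsupp.single k 1 : Fin d →₀ ℕ) l = m l := by simp [hkl.symm, hkl]
  rw [h1, h2]
  by_cases h : 1 ≤ m k
  · have h3 : m + Finsupp.single l s - Finsupp.single k 1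
        = m - Finsupp.single k 1 + Finsupp.single l s :=
      tsub_add_eq_add_tsub (Finsupp.single_le_iff.2 h) |>.symm
    rw [if_pos h, if_pos h, h3]
  · simp [h]

theorem varCoeff_zero_X_mul (l : Fin d) (f : MvPowerSeries (Fin d) A) :
    varCoeff l 0 (MvPowerSeries.X l * f) = 0 := by
  funext m
  rw [varCoeff_apply, X_mul_apply]
  by_cases h : m l = 0 <;> simp [h] <;> rfl

theorem varCoeff_succ_X_mul (l : Fin d) (s : ℕ) (f : MvPowerSeries (Fin d) A) :
    varCoeff l (s + 1) (MvPowerSeries.X l * f) = varCoeff l s f := by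
  funext m
  rw [varCoeff_apply, X_mul_apply, varCoeff_apply, Finsupp.single_add,
    ← add_assoc, add_tsub_cancel_right, if_pos (c := 1 ≤ _) (by simp)]

theorem eq_zero_of_varCoeff {l : Fin d} {f : MvPowerSeries (Fin d) A}
    (h : ∀ s, varCoeff l s f = 0) :
    f = 0 := by
  funext m
  have := congrFun (h (m l)) (m.erase l)
  rw [varCoeff_apply, if_pos (by simp), Finsupp.erase_add_single] at this
  exact this

variable [SuperRing A]

/-- The substitution of `0` for the variable `u_l^{-1}`, as a homomorphism. -/
def zeroVarHom (l : Fin d) : SuperHom (MvPowerSeries (Fin d) A) (MvPowerSeries (Fin d) A) where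
  toFun := varCoeff l 0
  map_zero' := map_zero _
  map_add' := map_add _
  map_one' := by
    funext m
    rw [varCoeff_apply, Finsupp.single_zero, add_zero]
    split_ifs with h
    · rfl
    · symm
      refine (MvPowerSeries.coeff_one (R := A) (n := m)).trans (if_neg ?_)
      rintro rfl
      exact h rfl
  map_mul' f g := by
    funext m
    rw [varCoeff_apply, Finsupp.single_zero, add_zero, mvPowerSeries_mul_apply,
      mvPowerSeries_mul_apply]
    simp only [varCoeff_apply, Finsupp.single_zero, add_zero]
    by_cases h : m l = 0
    · rw [if_pos h]
      refine Finset.sum_congr rfl fun p hp => ?_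
      rw [Finset.HasAntidiagonal.mem_antidiagonal] at hp
      have : p.1 l + p.2 l = 0 := by rw [← h, ← hp]; rfl
      rw [if_pos (by omega), if_pos (by omega)]
    · rw [if_neg h]
      symm
      refine Finset.sum_eq_zero fun p hp => ?_
      rw [Finset.HasAntidiagonal.mem_antidiagonal] at hp
      have : p.1 l + p.2 l ≠ 0 := fun e => h (by rw [← e, ← hp]; rfl)
      by_cases h1 : p.1 l = 0
      · rw [if_neg (c := p.2 l = 0) (by omega), mul_zero]
      · rw [if_neg h1, zero_mul]
  map_par f := by
    funext m
    rw [par_mvPowerSeries_apply, varCoeff_apply, varCoeff_apply, par_mvPowerSeries_apply]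
    split_ifs
    · rfl
    · rw [map_zero]

theorem zeroVarHom_apply (l : Fin d) (f : MvPowerSeries (Fin d) A) :
    zeroVarHom l f = varCoeff l 0 f := rfl

theorem varCoeff_succ_zeroVarHom (l : Fin d) (s : ℕ) (f : MvPowerSeries (Fin d) A) :
    varCoeff l (s + 1) (zeroVarHom l f) = 0 := by
  funext m
  rw [varCoeff_apply, zeroVarHom_apply, varCoeff_apply, if_neg (c := (_ + _ : Fin d →₀ ℕ) l = 0)]
  · simp; rfl
  · simp

theorem zeroVarHom_X {k l : Fin d} (hkl : k ≠ l) :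
    zeroVarHom l (MvPowerSeries.X k : MvPowerSeries (Fin d) A) = MvPowerSeries.X k := by
  have := varCoeff_X_mul hkl 0 (1 : MvPowerSeries (Fin d) A)
  rw [← zeroVarHom_apply, ← zeroVarHom_apply, map_one, mul_one] at this
  exact this

theorem zeroVarHom_atVar {k l : Fin d} (hkl : k ≠ l) (ε : ℤ) (f : PowerSeries A) :
    zeroVarHom l (atVar k ε f) = atVar k ε f := by
  funext m
  rw [zeroVarHom_apply, varCoeff_apply, Finsupp.single_zero, add_zero]
  split_ifs with h
  · rfl
  · rw [atVar_of_ne]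
    intro hm
    apply h
    rw [hm]
    simp [hkl.symm, hkl]

end SeriesCoefficients

/-! ### Coefficients in the threefold tensor product -/

section TripleCoefficients
variable {A : Type*} [Ring A] [SuperRing A]

/-- Apply an additive map to all entries of the three matrix factors. -/
def mapEntries (g : MvPowerSeries (Fin 3) A →+ MvPowerSeries (Fin 3) A) :
    Triple A →+ Triple A where
  toFun r := r.map fun Y => Y.map fun Z => Z.map g
  map_zero' := by
    refine SEnd.ext fun i j => SEnd.ext fun k l => SEnd.ext fun p q => ?_
    exact map_zero g
  map_add' r r' := by
    refine SEnd.ext fun i j => SEnd.ext fun k l => SEnd.ext fun p q => ?_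
    exact map_add g _ _

theorem mapEntries_apply (g : MvPowerSeries (Fin 3) A →+ MvPowerSeries (Fin 3) A) (r : Triple A)
    (i j k l p q : Idx 1) : mapEntries g r i j k l p q = g (r i j k l p q) := rfl

theorem Triple.ext {A : Type*} {r r' : Triple A}
    (h : ∀ i j k l p q, r i j k l p q = r' i j k l p q) :
    r = r' :=
  SEnd.ext fun i j => SEnd.ext fun k l => SEnd.ext fun p q => h i j k l p q

theorem zsmul_entry (c : ℤ) (Z : SEnd 1 (MvPowerSeries (Fin 3) A)) (p q : Idx 1) :
    (c • Z) p q = c • Z p q := rfl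

theorem mapEntries_P12_mul (g : MvPowerSeries (Fin 3) A →+ MvPowerSeries (Fin 3) A)
    (r : Triple A) : mapEntries g (P12 A * r) = P12 A * mapEntries g r := by
  refine Triple.ext fun i j k l p q => ?_
  rw [mapEntries_apply, P12, SEnd.P_mul_apply, SEnd.P_mul_apply, zsmul_entry, zsmul_entry,
    map_zsmul, mapEntries_apply]

theorem mapEntries_Q12_mul (g : MvPowerSeries (Fin 3) A →+ MvPowerSeries (Fin 3) A)
    (r : Triple A) : mapEntries g (Q12 A * r) = Q12 A * mapEntries g r := by
  refine Triple.ext fun i j k l p q => ?_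
  rw [mapEntries_apply, Q12, SEnd.Q_mul_apply, SEnd.Q_mul_apply, zsmul_entry, zsmul_entry,
    map_zsmul, mapEntries_apply]

theorem mapEntries_mul_P12 (g : MvPowerSeries (Fin 3) A →+ MvPowerSeries (Fin 3) A)
    (r : Triple A) : mapEntries g (r * P12 A) = mapEntries g r * P12 A := by
  refine Triple.ext fun i j k l p q => ?_
  rw [mapEntries_apply, P12, SEnd.mul_P_apply, SEnd.mul_P_apply, zsmul_entry, zsmul_entry,
    map_zsmul, mapEntries_apply]

theorem mapEntries_mul_Q12 (g : MvPowerSeries (Fin 3) A →+ MvPowerSeries (Fin 3) A)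
    (r : Triple A) : mapEntries g (r * Q12 A) = mapEntries g r * Q12 A := by
  refine Triple.ext fun i j k l p q => ?_
  rw [mapEntries_apply, Q12, SEnd.mul_Q_apply, SEnd.mul_Q_apply, zsmul_entry, zsmul_entry,
    map_zsmul, mapEntries_apply]

theorem scalar_mul_apply {c : MvPowerSeries (Fin 3) A} (hc : par c = c) (r : Triple A)
    (i j k l p q : Idx 1) : (scalar c * r) i j k l p q = c * r i j k l p q := by
  have h : ∀ {B : Type _} [Ring B] [SuperRing B] {b : B} (x : ZMod 2), par b = b →
      twist x b = b := fun x hb => by unfold twist; split_ifs <;> simp [hb]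
  rw [scalar, SEnd.emb_mul_apply, h _ (by rw [SEnd.par_emb, SEnd.par_emb, hc]),
    SEnd.emb_mul_apply, h _ (by rw [SEnd.par_emb, hc]), SEnd.emb_mul_apply, h _ hc]

theorem var_pow_smul (k : Fin 3) (n : ℕ) (r : Triple A) :
    var A k ^ n • r = scalar (MvPowerSeries.X k ^ n) * r := by
  rw [← scalarHom_apply, map_pow]
  rfl

theorem var_pow_smul_apply (k : Fin 3) (n : ℕ) (r : Triple A) (i j l m p q : Idx 1) :
    (var A k ^ n • r) i j l m p q = MvPowerSeries.X k ^ n * r i j l m p q := by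
  rw [var_pow_smul, scalar_mul_apply (by rw [map_pow, par_X])]

theorem var_smul_apply (k : Fin 3) (r : Triple A) (i j l m p q : Idx 1) :
    (var A k • r) i j l m p q = MvPowerSeries.X k * r i j l m p q := by
  rw [var_smul, scalar_mul_apply (par_X k)]

theorem var_sq_sub_smul_apply (k k' : Fin 3) (r : Triple A) (i j l m p q : Idx 1) :
    ((var A k ^ 2 - var A k' ^ 2) • r) i j l m p q
      = (MvPowerSeries.X k ^ 2 - MvPowerSeries.X k' ^ 2) * r i j l m p q := by
  rw [sub_smul, sub_mul, ← var_pow_smul_apply, ← var_pow_smul_apply]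
  rfl

theorem eq_zero_of_entries {r : Triple A} (h : ∀ i j k l p q, r i j k l p q = 0) : r = 0 :=
  Triple.ext h

theorem entries_of_eq_zero {r : Triple A} (h : r = 0) (i j k l p q : Idx 1) :
    r i j k l p q = 0 := by rw [h]; rfl

theorem eq_zero_of_var_smul {k : Fin 3} {r : Triple A} (h : var A k • r = 0) : r = 0 :=
  eq_zero_of_entries fun i j l m p q => eq_zero_of_X_mul (by
    rw [← var_smul_apply]; exact entries_of_eq_zero h i j l m p q)

theorem eq_zero_of_var_sq_sub_smul {k k' : Fin 3} (hk : k' ≠ k) {r : Triple A}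
    (h : (var A k ^ 2 - var A k' ^ 2) • r = 0) : r = 0 :=
  eq_zero_of_entries fun i j l m p q => eq_zero_of_X_sq_sub_mul hk (by
    rw [← var_sq_sub_smul_apply]; exact entries_of_eq_zero h i j l m p q)

theorem eq_zero_of_forall_var_pow {k : Fin 3} {r : Triple A}
    (h : ∀ n : ℕ, ∃ r', r = var A k ^ n • r') : r = 0 :=
  eq_zero_of_entries fun i j l m p q => eq_zero_of_forall_X_pow fun n => by
    obtain ⟨r', hr⟩ := h n
    exact ⟨r' i j l m p q, by rw [← var_pow_smul_apply, ← hr]⟩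

theorem eq_zero_of_two_smul (h2 : ∀ a : A, (2 : ℤ) • a = 0 → a = 0) {r : Triple A}
    (h : (2 : ℤ) • r = 0) : r = 0 :=
  eq_zero_of_entries fun i j l m p q => by
    funext n
    exact h2 _ (congrFun (entries_of_eq_zero h i j l m p q) n)

/-- The substitution of `0` for the variable `u_l^{-1}`, as a homomorphism. -/
def tripleZeroVarHom (A : Type*) [Ring A] [SuperRing A] (l : Fin 3) :
    SuperHom (Triple A) (Triple A) :=
  (((zeroVarHom l).sEnd 1).sEnd 1).sEnd 1

/-- The tensors that do not involve the variable `u_l`. -/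
def freeOfVar (A : Type*) [Ring A] [SuperRing A] (l : Fin 3) : Subring (Triple A) :=
  (tripleZeroVarHom A l).toRingHom.eqLocus (RingHom.id _)

theorem mem_freeOfVar {l : Fin 3} {r : Triple A} :
    r ∈ freeOfVar A l ↔ tripleZeroVarHom A l r = r := Iff.rfl

theorem P12_mem_freeOfVar (l : Fin 3) : P12 A ∈ freeOfVar A l :=
  SuperHom.sEnd_sEnd_P _

theorem Q12_mem_freeOfVar (l : Fin 3) : Q12 A ∈ freeOfVar A l :=
  SuperHom.sEnd_sEnd_Q _

theorem var_smul_mem_freeOfVar {k l : Fin 3} (hkl : k ≠ l) {r : Triple A}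
    (hr : r ∈ freeOfVar A l) : var A k • r ∈ freeOfVar A l := by
  rw [mem_freeOfVar] at *
  rw [var_smul, map_mul, hr, scalar, tripleZeroVarHom, SuperHom.sEnd_emb, SuperHom.sEnd_emb,
    SuperHom.sEnd_emb, zeroVarHom_X hkl]

theorem legOne_mem_freeOfVar {k l : Fin 3} (hkl : k ≠ l) (X : SEnd 1 (PowerSeries A)) (ε : ℤ) :
    legOne X k ε ∈ freeOfVar A l := by
  rw [mem_freeOfVar]
  refine SEnd.ext fun i j => ?_
  change ((zeroVarHom l).sEnd 1).sEnd 1 (SEnd.emb (SEnd.emb (atVar k ε (X i j)))) = _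
  rw [SuperHom.sEnd_emb, SuperHom.sEnd_emb, zeroVarHom_atVar hkl]
  rfl

theorem legTwo_mem_freeOfVar {k l : Fin 3} (hkl : k ≠ l) (X : SEnd 1 (PowerSeries A)) (ε : ℤ) :
    legTwo X k ε ∈ freeOfVar A l := by
  rw [mem_freeOfVar, legTwo, tripleZeroVarHom, SuperHom.sEnd_emb]
  congr 1
  refine SEnd.ext fun i j => ?_
  change ((zeroVarHom l).sEnd 1) (SEnd.emb (atVar k ε (X i j))) = _
  rw [SuperHom.sEnd_emb, zeroVarHom_atVar hkl]
  rfl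

theorem legThree_mem_freeOfVar {k l : Fin 3} (hkl : k ≠ l) (X : SEnd 1 (PowerSeries A)) (ε : ℤ) :
    legThree X k ε ∈ freeOfVar A l := by
  rw [mem_freeOfVar, legThree, tripleZeroVarHom, SuperHom.sEnd_emb, SuperHom.sEnd_emb]
  congr 2
  refine SEnd.ext fun i j => ?_
  exact zeroVarHom_atVar hkl _ _

/-- The coefficient maps of the variable `u_l`. -/
def coeffMaps {k l : Fin 3} (hkl : k ≠ l) :
    CoeffMaps (var A k) (var A l) (P12 A) (Q12 A) (freeOfVar A l) where
  coeff s := mapEntries (varCoeff l s)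
  coeff_x s r := Triple.ext fun i j m n p q => by
    rw [mapEntries_apply, var_smul_apply, var_smul_apply, varCoeff_X_mul hkl, mapEntries_apply]
  coeff_zero_y r := Triple.ext fun i j m n p q => by
    rw [mapEntries_apply, var_smul_apply, varCoeff_zero_X_mul]
    rfl
  coeff_succ_y s r := Triple.ext fun i j m n p q => by
    rw [mapEntries_apply, var_smul_apply, varCoeff_succ_X_mul, mapEntries_apply]
  coeff_P s r := mapEntries_P12_mul _ r
  coeff_Q s r := mapEntries_Q12_mul _ r
  ext_zero r h := eq_zero_of_entries fun i j m n p q => eq_zero_of_varCoeff (l := l) fun s => by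
    rw [← mapEntries_apply]
    exact entries_of_eq_zero (h s) i j m n p q
  coeff_succ_mem s r hr := Triple.ext fun i j m n p q => by
    rw [mem_freeOfVar] at hr
    rw [mapEntries_apply, ← hr]
    exact varCoeff_succ_zeroVarHom l s _
  coeff_zero_mem r hr := hr

/-- The tensors and variables of the threefold tensor product satisfy the hypotheses of the
abstract Serre relation. -/
def tensorSetup (h2 : ∀ a : A, (2 : ℤ) • a = 0 → a = 0) :
    TensorSetup (fun p : Fin 2 => var A p.castSucc) (var A 2) (P12 A) (Q12 A) (P13 A) (Q13 A)
      (P23 A) (Q23 A) (fun p : Fin 2 => freeOfVar A p.rev.castSucc) where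
  pq := isPQPair_P12 A
  yb := isYBTriple A
  reg_two _ := eq_zero_of_two_smul h2
  reg_var _ _ := eq_zero_of_var_smul
  reg_sub p q hpq _ := eq_zero_of_var_sq_sub_smul (by simpa using hpq)
  reg_sub_last p _ := eq_zero_of_var_sq_sub_smul (by revert p; decide)
  sep _ _ := eq_zero_of_forall_var_pow
  coeffMaps p q hpq := by
    have hq : p.rev = q := by revert p q; decide
    rw [hq]
    exact coeffMaps (by simpa using hpq)
  P_mem _ := P12_mem_freeOfVar _
  Q_mem _ := Q12_mem_freeOfVar _
  smul_mem p _ := var_smul_mem_freeOfVar (by revert p; decide)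

end TripleCoefficients

open MulOpposite

/-! ### The opposite ring -/

section Opposite
variable {𝕜 R : Type*} [CommRing 𝕜] [Ring R] [Algebra 𝕜 R]

theorem IsPQPair.op {P Q : R} (h : IsPQPair P Q) : IsPQPair (op (-P)) (op (-Q)) where
  P_mul_P := by rw [← op_mul, neg_mul_neg, h.P_mul_P, op_one]
  Q_mul_Q := by rw [← op_mul, neg_mul_neg, h.Q_mul_Q, op_one]
  Q_mul_P := by rw [← op_mul, ← op_mul, neg_mul_neg, neg_mul_neg, h.Q_mul_P, op_neg, neg_neg]

theorem LegSwap.op {κ : Type*} {P Q : R} {e1 e2 : κ → ℤ → R} (h : LegSwap P Q e1 e2) :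
    LegSwap (op (-P)) (op (-Q)) (fun p ε => op (-e1 p ε)) (fun p ε => op (-e2 p ε)) where
  P_one p ε := by rw [← op_mul, ← op_mul, neg_mul_neg, neg_mul_neg, h.P_two]
  P_two p ε := by rw [← op_mul, ← op_mul, neg_mul_neg, neg_mul_neg, h.P_one]
  Q_one p ε := by rw [← op_mul, ← op_mul, neg_mul_neg, neg_mul_neg, h.Q_two, neg_neg]
  Q_two p ε := by rw [← op_mul, ← op_mul, neg_mul_neg, neg_mul_neg, h.Q_one, neg_neg]

/-- An identity between products of two involutions may be inverted. -/
theorem mul_comm_of_involutive {a b c d : R} (ha : a * a = 1) (hb : b * b = 1) (hc : c * c = 1)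
    (hd : d * d = 1) (h : a * b = c * d) : b * a = d * c := by
  have h1 : c * d * (d * c) = 1 := by rw [mul_assoc, ← mul_assoc d, hd, one_mul, hc]
  have h2 : b * a * (a * b) = 1 := by rw [mul_assoc, ← mul_assoc a, ha, one_mul, hb]
  rw [h] at h2
  calc b * a = b * a * (c * d * (d * c)) := by rw [h1, mul_one]
    _ = d * c := by rw [← mul_assoc, h2, one_mul]

theorem IsYBTriple.op {P12 Q12 P13 Q13 P23 Q23 : R} (h : IsYBTriple P12 Q12 P13 Q13 P23 Q23)
    (h12 : IsPQPair P12 Q12) (h13 : IsPQPair P13 Q13) (h23 : IsPQPair P23 Q23) :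
    IsYBTriple (op (-P12)) (op (-Q12)) (op (-P13)) (op (-Q13)) (op (-P23)) (op (-Q23)) := by
  obtain ⟨p1, q1, -⟩ := h12
  obtain ⟨p2, q2, -⟩ := h13
  obtain ⟨p3, q3, -⟩ := h23
  have nn : ∀ {r : R}, r * r = 1 → -r * -r = 1 := fun h => by rw [neg_mul_neg, h]
  constructor <;> simp only [← op_mul, ← op_neg, neg_mul_neg, op_inj]
  · exact mul_comm_of_involutive p1 p3 p3 p2 h.PP
  · exact mul_comm_of_involutive p2 p1 p3 p2 h.PP'
  · exact mul_comm_of_involutive p1 q3 q3 q2 h.PQ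
  · exact mul_comm_of_involutive q2 p1 q3 q2 h.PQ'
  · exact mul_comm_of_involutive q1 p3 p3 q2 h.QP
  · rw [← mul_neg]
    exact mul_comm_of_involutive q2 q1 (nn p3) q2 (by rw [h.QP', neg_mul])
  · exact mul_comm_of_involutive q1 q3 q3 p2 h.QQ
  · rw [← mul_neg]
    exact mul_comm_of_involutive p2 q1 (nn q3) p2 (by rw [h.QQ', neg_mul])

theorem op_kMat (x y : 𝕜) (P Q : R) : op (kMat x y P Q) = kMat x y (op P) (op Q) := rfl

/-- The transpose of a matrix along the antidiagonal, with entries in the opposite ring. -/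
def opRev {R : Type*} {m : ℕ} (M : Matrix (Fin m) (Fin m) R) : Matrix (Fin m) (Fin m) Rᵐᵒᵖ :=
  Matrix.of fun a b => op (M b.rev a.rev)

theorem opRev_apply {R : Type*} {m : ℕ} (M : Matrix (Fin m) (Fin m) R) (a b : Fin m) :
    opRev M a b = op (M b.rev a.rev) := rfl

theorem opRev_mul {m : ℕ} (M N : Matrix (Fin m) (Fin m) R) :
    opRev M * opRev N = opRev (N * M) := by
  refine Matrix.ext fun i j => ?_
  rw [Matrix.mul_apply, opRev_apply, Matrix.mul_apply, Finset.op_sum, ← Equiv.sum_comp Fin.revPerm]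
  simp [opRev_apply]

theorem opRev_one {m : ℕ} : opRev (1 : Matrix (Fin m) (Fin m) R) = 1 := by
  refine Matrix.ext fun i j => ?_
  rw [opRev_apply, Matrix.one_apply, Matrix.one_apply]
  by_cases h : i = j
  · simp [h]
  · rw [if_neg h, if_neg (fun e => h (Fin.rev_injective e).symm), op_zero]

/-- The RTT relation passes to the transposed matrices over the opposite ring. -/
theorem RTT.opRev {m : ℕ} {d : 𝕜} {k : R} {A B : Matrix (Fin m) (Fin m) R} (h : RTT d k A B) :
    RTT d (op k) (QueerYangian.opRev A) (QueerYangian.opRev B) := by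
  intro a b c e
  simp only [opRev_apply, ← op_mul, ← op_sub, ← op_smul]
  congr 1
  have := h b.rev a.rev e.rev c.rev
  rw [← neg_inj, ← smul_neg, neg_sub, this, neg_sub, mul_assoc, mul_assoc]

theorem RTT.neg {ι : Type*} {d : 𝕜} {k : R} {A B : Matrix ι ι R} (h : RTT d k A B) :
    RTT (-d) (-k) A B := by
  intro a b c e
  rw [neg_smul, h]
  noncomm_ring

end Opposite

section TripleOpposite
variable {A : Type*} [Ring A] [SuperRing A]

/-- The coefficient maps of the variable `u_l`, on the opposite ring. -/
def coeffMapsOp {k l : Fin 3} (hkl : k ≠ l) :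
    CoeffMaps (var A k) (var A l) (op (-P12 A)) (op (-Q12 A)) (freeOfVar A l).op :=
  let cm := coeffMaps (A := A) hkl
  { coeff := fun s => AddMonoidHom.mulOp (cm.coeff s)
    coeff_x := fun s r => congrArg op (cm.coeff_x s r.unop)
    coeff_zero_y := fun r => congrArg op (cm.coeff_zero_y r.unop)
    coeff_succ_y := fun s r => congrArg op (cm.coeff_succ_y s r.unop)
    coeff_P := fun s r => congrArg op (by
      change mapEntries _ (r.unop * -P12 A) = mapEntries _ r.unop * -P12 A
      rw [mul_neg, mul_neg, map_neg, mapEntries_mul_P12])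
    coeff_Q := fun s r => congrArg op (by
      change mapEntries _ (r.unop * -Q12 A) = mapEntries _ r.unop * -Q12 A
      rw [mul_neg, mul_neg, map_neg, mapEntries_mul_Q12])
    ext_zero := fun r h => congrArg op (cm.ext_zero r.unop fun s => congrArg unop (h s))
    coeff_succ_mem := fun s r hr => congrArg op (cm.coeff_succ_mem s r.unop hr)
    coeff_zero_mem := fun r hr => congrArg op (cm.coeff_zero_mem r.unop hr) }

/-- The opposite of the threefold tensor product, with the tensors `-P` and `-Q`. -/
def tensorSetupOp (h2 : ∀ a : A, (2 : ℤ) • a = 0 → a = 0) :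
    TensorSetup (fun p : Fin 2 => var A p.castSucc) (var A 2) (op (-P12 A)) (op (-Q12 A))
      (op (-P13 A)) (op (-Q13 A)) (op (-P23 A)) (op (-Q23 A))
      (fun p : Fin 2 => (freeOfVar A p.rev.castSucc).op) :=
  let ts := tensorSetup h2
  { pq := ts.pq.op
    yb := ts.yb.op (isPQPair_P12 A) (isPQPair_P13 A) (isPQPair_P23 A)
    reg_two := fun r h => congrArg op (ts.reg_two r.unop (congrArg unop h))
    reg_var := fun p r h => congrArg op (ts.reg_var p r.unop (congrArg unop h))
    reg_sub := fun p q hpq r h => congrArg op (ts.reg_sub p q hpq r.unop (congrArg unop h))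
    reg_sub_last := fun p r h => congrArg op (ts.reg_sub_last p r.unop (congrArg unop h))
    sep := fun p r h => congrArg op (ts.sep p r.unop fun n => by
      obtain ⟨r', hr⟩ := h n
      exact ⟨r'.unop, congrArg unop hr⟩)
    coeffMaps := fun p q hpq => by
      have hq : p.rev = q := by revert p q; decide
      rw [hq]
      exact coeffMapsOp (by simpa using hpq)
    P_mem := fun p => neg_mem (ts.P_mem p)
    Q_mem := fun p => neg_mem (ts.Q_mem p)
    smul_mem := fun p r hr => ts.smul_mem p r.unop hr }

end TripleOpposite

/-! ### The currents of a corner -/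

section Corners
variable {A : Type*} [Ring A] [SuperRing A]

/-- The last entries of the inverse of a `3 × 3` matrix in terms of its Gauss decomposition: as
`F H (E T') = 1`, the matrix `E T'` is lower triangular. -/
theorem IsGauss.inv_last {S : Type*} [Ring S] {T T' F H E : Matrix (Fin 3) (Fin 3) S}
    (h : IsGauss T F H E) (hU : ∀ a, IsUnit (H a a)) (hT : T * T' = 1) :
    IsUnit (T' 2 2) ∧ T' 1 2 = -(E 1 2 * T' 2 2) := by
  choose U hU using hU
  have key : F * H * (E * T') = 1 := by rw [← mul_assoc, ← h.eq_mul, hT]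
  have hN : ∀ i j, ∑ k, F i k * H k k * (E * T') k j = (1 : Matrix (Fin 3) (Fin 3) S) i j := by
    intro i j
    rw [← key, mul_diag_mul_apply h.diag]
  have h02 := hN 0 2
  have h12 := hN 1 2
  have h22 := hN 2 2
  simp only [Fin.sum_univ_three, h.lower_diag, h.lower 0 1 (by decide), h.lower 0 2 (by decide),
    h.lower 1 2 (by decide), zero_mul, one_mul, add_zero, ← hU] at h02 h12 h22
  rw [Matrix.one_apply_ne (by decide), Units.mul_right_eq_zero] at h02
  rw [h02, mul_zero, zero_add, Matrix.one_apply_ne (by decide), Units.mul_right_eq_zero] at h12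
  rw [h02, h12, mul_zero, mul_zero, zero_add, zero_add, Matrix.one_apply_eq] at h22
  have e12 : (E * T') 1 2 = T' 1 2 + E 1 2 * T' 2 2 := by
    rw [Matrix.mul_apply, Fin.sum_univ_three, h.upper 1 0 (by decide), h.upper_diag]
    noncomm_ring
  have e22 : (E * T') 2 2 = T' 2 2 := by
    rw [Matrix.mul_apply, Fin.sum_univ_three, h.upper 2 0 (by decide), h.upper 2 1 (by decide),
      h.upper_diag]
    noncomm_ring
  rw [e12] at h12
  rw [e22] at h22
  refine ⟨?_, eq_neg_of_add_eq_zero_left h12⟩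
  have h3 : T' 2 2 = ↑(U 2)⁻¹ := by
    rw [← mul_one (↑(U 2)⁻¹ : S), ← h22, Units.inv_mul_cancel_left]
  rw [h3]
  exact Units.isUnit _

variable (A) in
/-- A `3 × 3` matrix of `2 × 2` blocks with the properties of the generator matrix, together with
its inverse and its Gauss decomposition. -/
structure Corner (T T' F H E : Matrix (Fin 3) (Fin 3) (SEnd 1 (PowerSeries A))) : Prop where
  mul_inv : T * T' = 1
  inv_mul : T' * T = 1
  gauss : IsGauss T F H E
  diag_unit : ∀ a, IsUnit (H a a)
  even : ∀ a b, par (T a b) = T a b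
  reflect : ∀ a b, reflectHom 1 A (E a b) = E a b
  rtt12 : ∀ p q : Fin 3, p ≠ q →
    RTT (var A q ^ 2 - var A p ^ 2) (kMat (var A p) (var A q) (P12 A) (Q12 A))
      (T.map (legOneHom p 1)) (T.map (legTwoHom q 1))
  rtt13 : ∀ p q : Fin 3, p ≠ q →
    RTT (var A q ^ 2 - var A p ^ 2) (kMat (var A p) (var A q) (P13 A) (Q13 A))
      (T.map (legOneHom p 1)) (T.map (legThreeHom q 1))
  rtt23 : ∀ p q : Fin 3, p ≠ q →
    RTT (var A q ^ 2 - var A p ^ 2) (kMat (var A p) (var A q) (P23 A) (Q23 A))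
      (T.map (legTwoHom p 1)) (T.map (legThreeHom q 1))

/-- The product of the rows and columns `a`, `a + 1`, `a + 2` of the factors of the Gauss
decomposition of the generator matrix has the properties collected in `Corner`. -/
theorem IsGenMatrix.exists_corner {n a : ℕ} {T F H E : SEnd n (PowerSeries A)}
    (hT : IsGenMatrix T) (hG : SEnd.IsBlockGauss T F H E) (ha : a + 3 ≤ n) :
    let σ : Fin 3 → Fin n := Fin.castLE ha ∘ Fin.natAdd a
    ∃ T3 T3' F3 H3 E3, Corner A T3 T3' F3 H3 E3 ∧ ∀ i j, E3 i j = E.block (σ i) (σ j) := by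
  intro σ
  rw [SEnd.isBlockGauss_iff] at hG
  have hc : ((SEnd.blockEquiv n _ T).submatrix (Fin.castLE ha) (Fin.castLE ha)).map
      ((constHom A).sEnd 1 : SEnd 1 (PowerSeries A) →+* SEnd 1 A) = 1 := by
    rw [RingHom.coe_coe, ← Matrix.submatrix_map, hT.map_const]
    exact Matrix.submatrix_one _ (Fin.castLE_injective ha)
  obtain ⟨T3, g, u, r⟩ := (hG.castLE ha).exists_tail (𝕜 := Subring.center (Triple A))
    (R := Triple A) ((constHom A).sEnd 1 : SEnd 1 (PowerSeries A) →+* SEnd 1 A)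
    (fun _ h => isUnit_of_constHom_sEnd h) (fun _ _ h => isUnit_of_map_constHom h) hc
  obtain ⟨⟨T3, T3', i1, i2⟩, rfl⟩ := isUnit_of_map_constHom u
  dsimp only at *
  have hp := hT.fixed_factors hG (par : SEnd 1 (PowerSeries A) →+* SEnd 1 (PowerSeries A)) (by
    refine Matrix.ext fun a b => ?_
    rw [Matrix.map_apply, SEnd.blockEquiv_apply]
    conv_rhs => rw [← hT.even]
    rfl)
  have hr := hT.fixed_factors hG
    (reflectHom 1 A : SEnd 1 (PowerSeries A) →+* SEnd 1 (PowerSeries A)) (by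
    refine Matrix.ext fun a b => ?_
    rw [Matrix.map_apply, SEnd.blockEquiv_apply]
    conv_rhs => rw [← hT.reflect]
    rfl)
  refine ⟨T3, T3', _, _, _, ⟨i1, i2, g, fun a => hT.isUnit_diag hG _, fun a b => ?_,
    fun a b => (hr _ _).2.2, fun p q h => ?_, fun p q h => ?_, fun p q h => ?_⟩, fun i j => rfl⟩
  · rw [g.eq_mul, mul_diag_mul_apply g.diag, map_sum]
    refine Finset.sum_congr rfl fun k _ => ?_
    rw [map_mul, map_mul]
    exact congrArg₂ _ (congrArg₂ _ (hp _ _).1 (hp _ _).2.1) (hp _ _).2.2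
  · have hr := r (var A q ^ 2 - var A p ^ 2) (kMat (var A p) (var A q) (P12 A) (Q12 A))
      (legOneHom (A := A) p 1 : _ →+* Triple A) (legTwoHom (A := A) q 1 : _ →+* Triple A)
    simp only [RingHom.coe_coe] at hr
    exact hr ((hT.rtt.rtt12 h).submatrix (Fin.castLE ha))
  · have hr := r (var A q ^ 2 - var A p ^ 2) (kMat (var A p) (var A q) (P13 A) (Q13 A))
      (legOneHom (A := A) p 1 : _ →+* Triple A) (legThreeHom (A := A) q 1 : _ →+* Triple A)
    simp only [RingHom.coe_coe] at hr
    exact hr ((hT.rtt.rtt13 h).submatrix (Fin.castLE ha))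
  · have hr := r (var A q ^ 2 - var A p ^ 2) (kMat (var A p) (var A q) (P23 A) (Q23 A))
      (legTwoHom (A := A) p 1 : _ →+* Triple A) (legThreeHom (A := A) q 1 : _ →+* Triple A)
    simp only [RingHom.coe_coe] at hr
    exact hr ((hT.rtt.rtt23 h).submatrix (Fin.castLE ha))

variable {T T' F H E : Matrix (Fin 3) (Fin 3) (SEnd 1 (PowerSeries A))}

theorem Corner.row_zero (h : Corner A T T' F H E) (j : Fin 3) :
    T 0 j = T 0 0 * E 0 j := by
  have hT : ∀ j, T 0 j = H 0 0 * E 0 j := fun j => by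
    rw [h.gauss.eq_mul, mul_diag_mul_apply h.gauss.diag, Fin.sum_univ_three,
      h.gauss.lower_diag, h.gauss.lower 0 1 (by decide), h.gauss.lower 0 2 (by decide)]
    noncomm_ring
  rw [hT j, hT 0, h.gauss.upper_diag, mul_one]

theorem Corner.isUnit_zero (h : Corner A T T' F H E) : IsUnit (T 0 0) := by
  have : T 0 0 = H 0 0 := by
    rw [h.gauss.eq_mul, mul_diag_mul_apply h.gauss.diag, Fin.sum_univ_three,
      h.gauss.lower_diag, h.gauss.lower 0 1 (by decide), h.gauss.lower 0 2 (by decide),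
      h.gauss.upper_diag]
    noncomm_ring
  rw [this]
  exact h.diag_unit 0

theorem Corner.inv_even (h : Corner A T T' F H E) (a b : Fin 3) : par (T' a b) = T' a b := by
  have hm : T.map (par : SEnd 1 (PowerSeries A) →+* SEnd 1 (PowerSeries A)) = T :=
    Matrix.ext h.even
  have h1 := map_mul_map_eq_one h.inv_mul
    (par : SEnd 1 (PowerSeries A) →+* SEnd 1 (PowerSeries A))
  rw [hm] at h1
  have h2 := left_inv_eq_right_inv h1 h.mul_inv
  exact congrFun (congrFun h2 a) b

/-- The abstract setting of the Serre relation for `e = E 0 1` and `f = E 1 2`. -/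
theorem Corner.currentSetup (h : Corner A T T' F H E) :
    CurrentSetup (fun p : Fin 2 => var A p.castSucc) (var A 2) (P12 A) (Q12 A) (P13 A) (Q13 A)
      (P23 A) (Q23 A) (fun p : Fin 2 => freeOfVar A p.rev.castSucc)
      (fun p => T.map (legOneHom p.castSucc 1)) (fun p => T.map (legTwoHom p.castSucc 1))
      (T.map (legThreeHom 2 1)) (T'.map (legThreeHom 2 1))
      (fun p => legOne (E 0 1) p.castSucc) (fun p => legTwo (E 0 1) p.castSucc)
      (legThree (E 1 2) 2 1) where
  rtt12 p q hpq := h.rtt12 _ _ (by simpa using hpq)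
  rtt13 p := h.rtt13 _ _ (by revert p; decide)
  rtt23 p := h.rtt23 _ _ (by revert p; decide)
  mul_inv := map_mul_map_eq_one h.mul_inv (legThreeHom 2 1)
  inv_mul := map_mul_map_eq_one h.inv_mul (legThreeHom 2 1)
  h1_unit p := h.isUnit_zero.map (legOneHom p.castSucc 1)
  h2_unit p := h.isUnit_zero.map (legTwoHom p.castSucc 1)
  e1_eq p := by
    rw [← legOneHom_apply, Matrix.map_apply, h.row_zero, map_mul]
    rfl
  e2_eq p := by
    rw [← legTwoHom_apply, Matrix.map_apply, h.row_zero, map_mul]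
    rfl
  q_unit := (h.gauss.inv_last h.diag_unit h.mul_inv).1.map (legThreeHom 2 1)
  f_eq := by
    rw [← legThreeHom_apply, Matrix.map_apply, (h.gauss.inv_last h.diag_unit h.mul_inv).2,
      map_neg, map_mul]
    rfl
  swap :=
    have hs := legSwap (h.reflect 0 1)
    ⟨fun _ => hs.P_one _, fun _ => hs.P_two _, fun _ => hs.Q_one _, fun _ => hs.Q_two _⟩
  P_comm i := P12_commute_legThree (h.inv_even _ _) 2 1
  Q_comm i := Q12_commute_legThree (h.inv_even _ _) 2 1
  P23_comm p j := P23_commute_legOne _ _ _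
  Q23_comm p j := Q23_commute_legOne _ _ _
  e1_mem p ε := legOne_mem_freeOfVar (by revert p; decide) _ _
  e2_mem p ε := legTwo_mem_freeOfVar (by revert p; decide) _ _
  f_mem p := legThree_mem_freeOfVar (by revert p; decide) _ _

/-- The RTT relation for the inverse of `T` over the opposite ring: inversion reverses the order of
the two tensor factors, and conjugation by `P` restores it. The denominators `y² - x²` change sign,
whence the tensors `-P` and `-Q`. -/
theorem RTT.opRev_inv {x y : Subring.center (Triple A)} {P Q : Triple A}
    (hPQ : IsPQPair P Q) {φ φ' ψ ψ' : SuperHom (SEnd 1 (PowerSeries A)) (Triple A)}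
    (hφ : ∀ X, P * φ X = φ' X * P) (hψ : ∀ X, P * ψ X = ψ' X * P)
    (hT : T * T' = 1) (hT' : T' * T = 1)
    (h : RTT (y ^ 2 - x ^ 2) (kMat x y P Q) (T.map φ) (T.map ψ)) :
    RTT (x ^ 2 - y ^ 2) (kMat y x (op (-P)) (op (-Q))) (QueerYangian.opRev (T'.map ψ'))
      (QueerYangian.opRev (T'.map φ')) := by
  have h1 := h.swap (A' := T.map φ') (B' := T.map ψ') hPQ (fun _ _ => hφ _) (fun _ _ => hψ _)
  have h2 := h1.inv (map_mul_map_eq_one hT φ')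
    (map_mul_map_eq_one hT' φ') (map_mul_map_eq_one hT ψ')
    (map_mul_map_eq_one hT' ψ')
  have h3 := h2.opRev.neg
  rw [neg_sub] at h3
  rw [op_neg, op_neg, kMat_neg, ← op_kMat]
  exact h3

/-- The abstract setting of the Serre relation over the opposite ring for `e = -E 1 2` and
`f = -E 0 1`: the matrix is the transpose of the inverse of `T` along the antidiagonal. -/
theorem Corner.currentSetupOp (h : Corner A T T' F H E) :
    CurrentSetup (fun p : Fin 2 => var A p.castSucc) (var A 2) (op (-P12 A)) (op (-Q12 A))
      (op (-P13 A)) (op (-Q13 A)) (op (-P23 A)) (op (-Q23 A))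
      (fun p : Fin 2 => (freeOfVar A p.rev.castSucc).op)
      (fun p => opRev (T'.map (legOneHom p.castSucc 1)))
      (fun p => opRev (T'.map (legTwoHom p.castSucc 1)))
      (opRev (T'.map (legThreeHom 2 1))) (opRev (T.map (legThreeHom 2 1)))
      (fun p ε => op (-legOne (E 1 2) p.castSucc ε))
      (fun p ε => op (-legTwo (E 1 2) p.castSucc ε))
      (op (-legThree (E 0 1) 2 1)) where
  rtt12 p q hpq := RTT.opRev_inv (φ := legOneHom q.castSucc 1) (φ' := legTwoHom q.castSucc 1)
    (ψ := legTwoHom p.castSucc 1) (ψ' := legOneHom p.castSucc 1) (isPQPair_P12 A)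
    (fun X => P12_mul_legOne X _ _) (fun X => P12_mul_legTwo X _ _) h.mul_inv h.inv_mul
    (h.rtt12 q.castSucc p.castSucc (by simpa using hpq.symm))
  rtt13 p := RTT.opRev_inv (φ := legOneHom 2 1) (φ' := legThreeHom 2 1)
    (ψ := legThreeHom p.castSucc 1) (ψ' := legOneHom p.castSucc 1) (isPQPair_P13 A)
    (fun X => P13_mul_legOne X _ _) (fun X => P13_mul_legThree X _ _) h.mul_inv h.inv_mul
    (h.rtt13 2 p.castSucc (by revert p; decide))
  rtt23 p := RTT.opRev_inv (φ := legTwoHom 2 1) (φ' := legThreeHom 2 1)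
    (ψ := legThreeHom p.castSucc 1) (ψ' := legTwoHom p.castSucc 1) (isPQPair_P23 A)
    (fun X => P23_mul_legTwo X _ _) (fun X => P23_mul_legThree X _ _) h.mul_inv h.inv_mul
    (h.rtt23 2 p.castSucc (by revert p; decide))
  mul_inv := by
    rw [opRev_mul, map_mul_map_eq_one h.mul_inv (legThreeHom 2 1), opRev_one]
  inv_mul := by
    rw [opRev_mul, map_mul_map_eq_one h.inv_mul (legThreeHom 2 1), opRev_one]
  h1_unit p := ((h.gauss.inv_last h.diag_unit h.mul_inv).1.map (legOneHom p.castSucc 1)).op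
  h2_unit p := ((h.gauss.inv_last h.diag_unit h.mul_inv).1.map (legTwoHom p.castSucc 1)).op
  e1_eq p := by
    rw [opRev_apply, opRev_apply, ← op_mul]
    change op (legOneHom p.castSucc 1 (T' 1 2)) = op (_ * legOneHom p.castSucc 1 (T' 2 2))
    rw [(h.gauss.inv_last h.diag_unit h.mul_inv).2, map_neg, map_mul, ← neg_mul]
    rfl
  e2_eq p := by
    rw [opRev_apply, opRev_apply, ← op_mul]
    change op (legTwoHom p.castSucc 1 (T' 1 2)) = op (_ * legTwoHom p.castSucc 1 (T' 2 2))
    rw [(h.gauss.inv_last h.diag_unit h.mul_inv).2, map_neg, map_mul, ← neg_mul]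
    rfl
  q_unit := (h.isUnit_zero.map (legThreeHom 2 1)).op
  f_eq := by
    rw [opRev_apply, opRev_apply, ← op_mul, ← op_neg, mul_neg, neg_neg]
    change op (legThreeHom 2 1 (T 0 1)) = op (legThreeHom 2 1 (T 0 0) * _)
    rw [h.row_zero, map_mul]
    rfl
  swap :=
    have hs := (legSwap (h.reflect 1 2)).op
    ⟨fun _ => hs.P_one _, fun _ => hs.P_two _, fun _ => hs.Q_one _, fun _ => hs.Q_two _⟩
  P_comm i := by
    rw [opRev_apply, ← op_mul, ← op_mul, mul_neg, neg_mul]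
    exact congrArg (fun r => op (-r)) (P12_commute_legThree (h.even _ _) 2 1).symm
  Q_comm i := by
    rw [opRev_apply, ← op_mul, ← op_mul, mul_neg, neg_mul]
    exact congrArg (fun r => op (-r)) (Q12_commute_legThree (h.even _ _) 2 1).symm
  P23_comm p j := by
    rw [opRev_apply, ← op_mul, ← op_mul, mul_neg, neg_mul]
    exact congrArg (fun r => op (-r)) (P23_commute_legOne _ _ _).symm
  Q23_comm p j := by
    rw [opRev_apply, ← op_mul, ← op_mul, mul_neg, neg_mul]
    exact congrArg (fun r => op (-r)) (Q23_commute_legOne _ _ _).symm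
  e1_mem p ε := neg_mem (legOne_mem_freeOfVar (by revert p; decide) _ _)
  e2_mem p ε := neg_mem (legTwo_mem_freeOfVar (by revert p; decide) _ _)
  f_mem p := neg_mem (legThree_mem_freeOfVar (by revert p; decide) _ _)

end Corners

/-! ### The Serre relation -/

section Serre

/-- The Serre relation over the opposite ring, for the variables `v` and `u`, becomes the Serre
relation for `u` and `v` after conjugation by `P`. -/
theorem serre_of_op {𝕜 R κ : Type*} [CommRing 𝕜] [Ring R] [Algebra 𝕜 R] {x y : 𝕜} {P Q f : R}
    {e1 e2 : κ → ℤ → R} {u v : κ} (hPQ : IsPQPair P Q) (he : LegSwap P Q e1 e2)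
    (hP : P * f = f * P) (hQ : Q * f = f * Q)
    (h : (y + x) • (op (-P) * ⁅op (-e1 v 1) - op (-e1 u 1),
          ⁅op (-e2 v 1) - op (-e2 u 1), op (-f)⁆⁆)
      + (x - y) • (op (-Q) * ⁅op (-e1 v 1) - op (-e1 u (-1)),
          ⁅op (-e2 v (-1)) - op (-e2 u 1), op (-f)⁆⁆) = 0) :
    (x + y) • (P * ⁅e1 u 1 - e1 v 1, ⁅e2 u 1 - e2 v 1, f⁆⁆)
      + (y - x) • (Q * ⁅e1 u 1 - e1 v (-1), ⁅e2 u (-1) - e2 v 1, f⁆⁆) = 0 := by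
  have h1 := congrArg (fun r => P * unop r * P) h
  obtain ⟨hPP, hQQ, hQP⟩ := hPQ
  obtain ⟨Pe1, Pe2, Qe1, Qe2⟩ := he
  have p1 := fun p ε => mul_mul_of_eq (Pe1 p ε)
  have p2 := fun p ε => mul_mul_of_eq (Pe2 p ε)
  have p3 := fun p ε => mul_mul_of_eq (Qe1 p ε)
  have p4 := fun p ε => mul_mul_of_eq (Qe2 p ε)
  have p5 := mul_mul_of_eq hP
  have p6 := mul_mul_of_eq hQ
  have p9 : ∀ z, P * (P * z) = z := fun z => by rw [← mul_assoc, hPP, one_mul]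
  have p11 : ∀ z, Q * (P * z) = -(P * (Q * z)) := fun z => by
    rw [← mul_assoc, hQP, neg_mul, mul_assoc]
  rw [← sub_eq_zero]
  linear_combination (norm := skip) h1
  simp only [Ring.lie_def, unop_add, unop_smul, unop_mul, unop_sub, unop_op, unop_zero, unop_neg,
    op_neg, mul_add,
    add_mul, mul_sub, sub_mul, smul_mul_assoc, mul_smul_comm, smul_add, smul_sub, smul_smul,
    mul_assoc, Pe1, Pe2, Qe1, Qe2, p1, p2, p3, p4, p5, p6, p9, p11, hP, hQ, hPP, hQP, neg_neg,
    mul_neg, neg_mul, smul_neg, mul_zero, zero_mul, mul_one]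
  module

variable {A : Type*} [Ring A] [SuperRing A]
variable {T T' F H E : Matrix (Fin 3) (Fin 3) (SEnd 1 (PowerSeries A))}

theorem Corner.even_row_zero (h : Corner A T T' F H E) (j : Fin 3) : par (E 0 j) = E 0 j := by
  have h1 := congrArg par (h.row_zero j)
  rw [map_mul, h.even, h.even, h.row_zero] at h1
  exact (h.isUnit_zero.mul_right_inj.1 h1).symm

/-- The Serre relation for `E_a`, `E_{a+1}`. -/
theorem Corner.serre (h : Corner A T T' F H E) (h2 : ∀ a : A, (2 : ℤ) • a = 0 → a = 0) :
    (var A 0 + var A 1) • (P12 A * ⁅legOne (E 0 1) 0 1 - legOne (E 0 1) 1 1,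
        ⁅legTwo (E 0 1) 0 1 - legTwo (E 0 1) 1 1, legThree (E 1 2) 2 1⁆⁆)
      + (var A 1 - var A 0) • (Q12 A * ⁅legOne (E 0 1) 0 1 - legOne (E 0 1) 1 (-1),
        ⁅legTwo (E 0 1) 0 (-1) - legTwo (E 0 1) 1 1, legThree (E 1 2) 2 1⁆⁆) = 0 :=
  serre_of_setup (tensorSetup h2) h.currentSetup (u := 0) (v := 1) (by decide)

/-- The Serre relation for `E_{a+1}`, `E_a`. -/
theorem Corner.serre_reverse (h : Corner A T T' F H E)
    (h2 : ∀ a : A, (2 : ℤ) • a = 0 → a = 0) :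
    (var A 0 + var A 1) • (P12 A * ⁅legOne (E 1 2) 0 1 - legOne (E 1 2) 1 1,
        ⁅legTwo (E 1 2) 0 1 - legTwo (E 1 2) 1 1, legThree (E 0 1) 2 1⁆⁆)
      + (var A 1 - var A 0) • (Q12 A * ⁅legOne (E 1 2) 0 1 - legOne (E 1 2) 1 (-1),
        ⁅legTwo (E 1 2) 0 (-1) - legTwo (E 1 2) 1 1, legThree (E 0 1) 2 1⁆⁆) = 0 :=
  serre_of_op (isPQPair_P12 A) (legSwap (h.reflect 1 2))
    (P12_commute_legThree (h.even_row_zero 1) 2 1) (Q12_commute_legThree (h.even_row_zero 1) 2 1)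
    (serre_of_setup (tensorSetupOp h2) h.currentSetupOp (u := 1) (v := 0) (by decide))

theorem IsGenMatrix.serre {n : ℕ} {T F H E : SEnd (n + 1) (PowerSeries A)} (hT : IsGenMatrix T)
    (hG : SEnd.IsBlockGauss T F H E) (h2 : ∀ a : A, (2 : ℤ) • a = 0 → a = 0) (a b : Fin n)
    (hab : (a : ℕ) + 1 = b ∨ (b : ℕ) + 1 = a) :
    let Ea := E.block a.castSucc a.succ
    let Eb := E.block b.castSucc b.succ
    (var A 0 + var A 1) • (P12 A * ⁅legOne Ea 0 1 - legOne Ea 1 1,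
        ⁅legTwo Ea 0 1 - legTwo Ea 1 1, legThree Eb 2 1⁆⁆)
      + (var A 1 - var A 0) • (Q12 A * ⁅legOne Ea 0 1 - legOne Ea 1 (-1),
        ⁅legTwo Ea 0 (-1) - legTwo Ea 1 1, legThree Eb 2 1⁆⁆) = 0 := by
  intro Ea Eb
  rcases hab with hab | hab
  · obtain ⟨T3, T3', F3, H3, E3, hc, hE⟩ := hT.exists_corner hG (a := a) (by omega)
    have e1 : E3 0 1 = Ea := by
      rw [hE]; congr 1
    have e2 : E3 1 2 = Eb := by
      rw [hE]; congr 1 <;> ext <;> simp <;> omega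
    rw [← e1, ← e2]
    exact hc.serre h2
  · obtain ⟨T3, T3', F3, H3, E3, hc, hE⟩ := hT.exists_corner hG (a := b) (by omega)
    have e1 : E3 0 1 = Eb := by
      rw [hE]; congr 1
    have e2 : E3 1 2 = Ea := by
      rw [hE]; congr 1 <;> ext <;> simp <;> omega
    rw [← e1, ← e2]
    exact hc.serre_reverse h2

theorem yangian_two_smul {n : ℕ} (a : Yangian n) (h : (2 : ℤ) • a = 0) : a = 0 := by
  have h1 : (2 : ℂ) • a = 0 := by
    rw [← h, two_smul, two_zsmul]
  have := congrArg ((2 : ℂ)⁻¹ • ·) h1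
  simpa using this

end Serre

end QueerYangian

end

theorem mainTheorem8 (n : ℕ) :
    (∃! G : SEnd (n + 1) (PowerSeries (Yangian (n + 1))) ×
        SEnd (n + 1) (PowerSeries (Yangian (n + 1))) ×
        SEnd (n + 1) (PowerSeries (Yangian (n + 1))),
      SEnd.IsBlockGauss (genMatrix (n + 1)) G.1 G.2.1 G.2.2) ∧
    ∀ F H E : SEnd (n + 1) (PowerSeries (Yangian (n + 1))),
      SEnd.IsBlockGauss (genMatrix (n + 1)) F H E →
      ∀ a b : Fin n, ((a : ℕ) + 1 = b ∨ (b : ℕ) + 1 = a) →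
        let Ea := E.block a.castSucc a.succ
        let Eb := E.block b.castSucc b.succ
        let uInv : MvPowerSeries (Fin 3) (Yangian (n + 1)) := MvPowerSeries.X 0
        let vInv : MvPowerSeries (Fin 3) (Yangian (n + 1)) := MvPowerSeries.X 1
        scalar (uInv + vInv) * P12 (Yangian (n + 1)) *
            ⁅legOne Ea 0 1 - legOne Ea 1 1,
              ⁅legTwo Ea 0 1 - legTwo Ea 1 1, legThree Eb 2 1⁆⁆
          + scalar (vInv - uInv) * Q12 (Yangian (n + 1)) *
            ⁅legOne Ea 0 1 - legOne Ea 1 (-1),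
              ⁅legTwo Ea 0 (-1) - legTwo Ea 1 1, legThree Eb 2 1⁆⁆ = 0 := by
  refine ⟨(isGenMatrix_genMatrix _).existsUnique_isBlockGauss, fun F H E hG a b hab => ?_⟩
  have h := (isGenMatrix_genMatrix _).serre hG yangian_two_smul a b hab
  simp only [add_smul, sub_smul, var_smul, ← scalarHom_apply] at h
  simpa only [← scalarHom_apply, map_add, map_sub, mul_assoc, add_mul, sub_mul] using h
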